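/- Let $\mathcal A=\{u+\sigma v: u,v\in\mathbb R\}$, $\sigma^2=1$, be the algebra of Lorentz numbers, $\widehat{u+\sigma v}=u-\sigma v$, let $Sl_2(\mathcal A)$ be the group of $2\times2$ matrices over $\mathcal A$ of determinant $1$, and let $B^*$ be the transpose of the entrywise conjugate $\widehat B$. Let $\mathbb R^{2,2}$ be $\mathbb R^4$ with $\langle x,x\rangle=-x_0^2+x_1^2-x_2^2+x_3^2$, identified with the space of Hermitian matrices ($C=C^*$) equipped with $-\det$ by $$x\mapsto\begin{pmatrix}-x_1-x_0&-x_3-\sigma x_2\\-x_3+\sigma x_2&x_1-x_0\end{pmatrix},$$ and let $\mathbb H^{2,1}=\{\langle x,x\rangle=-1\}$ and $\mathbb S^{1,2}=\{\langle x,x\rangle=1\}$. A Lorentz surface is a smooth surface with an atlas of $\mathcal A$-valued charts whose transition functions are conformal, where a smooth map between open subsets of $\mathcal A$ is conformal if its differential commutes with multiplication by $\sigma$; a map from a Lorentz surface to $\mathcal A$ or to $M_2(\mathcal A)$ is conformal if it (resp. each of its entries) is smooth and conformal in these charts. An $\mathcal A$-valued $1$-form is conformal if in every such chart $a$ it is $P\,da$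 with $P$ conformal. For an $\mathcal A$-valued $1$-form $\theta$, $|\theta|^2=\theta\,\widehat\theta$ as a quadratic form. **Theorem.** Let $M$ be a simply-connected Lorentz surface, let $B:M\to Sl_2(\mathcal A)$ be a conformal immersion, and let $\theta,\omega$ be conformal $1$-forms on $M$ with $$B^{-1}dB=\begin{pmatrix}0&\theta\\ \omega&0\end{pmatrix}.$$ If $|\theta|^2\neq|\omega|^2$ at every point, then $$F=BB^*:M\to\mathbb H^{2,1}\qquad\text{and}\qquad F=B\begin{pmatrix}-1&0\\0&1\end{pmatrix}B^*:M\to\mathbb S^{1,2}$$ are smooth immersions whose induced metrics are flat Lorentzian metrics. Conversely, let $(M,g)$ be a simply-connected flat Lorentzian surface and let $F$ be an isometric immersion of $(M,g)$ into $\mathbb H^{2,1}$ (resp. into $\mathbb S^{1,2}$). Then there are a Lorentz structure on $M$, a conformal immersion $B:M\to Sl_2(\mathcal A)$ and conformal $1$-forms $\theta,\omega$ with $B^{-1}dB=\begin{pmatrix}0&\theta\\ \omega&0\end{pmatrix}$ and $|\theta|^2\neq|\omega|^2$ at every point, such that $F=BB^*$ (resp. $F=B\begin{pmatrix}-1&0\\0&1\end{pmatrix}B^*$).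 -/

import Mathlib

open scoped Manifold ContDiff Matrix Topology

noncomputable section

namespace LorentzSurf

/-! ### Lorentz numbers -/

/-- The Lorentz numbers `u + σ v` with `σ ^ 2 = 1`, as a real algebra; the generator `σ` is `⟨0, 1⟩`
and `star (u + σ v) = u - σ v`. -/
abbrev LNum : Type := QuadraticAlgebra ℝ 1 0

/-- The Lorentz number `σ`. -/
def σ : LNum := ⟨0, 1⟩

theorem σ_mul_σ : σ * σ = 1 := by
  rw [QuadraticAlgebra.ext_iff]
  constructor <;> simp [σ, QuadraticAlgebra.re_one, QuadraticAlgebra.im_one]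

theorem star_eq (u v : ℝ) : star (⟨u, v⟩ : LNum) = ⟨u, -v⟩ := by
  ext <;> simp

/-- The real coordinates `u + σ v ↦ (u, v)`. -/
def toProd : LNum →ₗ[ℝ] ℝ × ℝ where
  toFun a := (a.re, a.im)
  map_add' a b := by simp
  map_smul' r a := by simp

theorem toProd_injective : Function.Injective toProd := by
  intro a b h
  have h1 : a.re = b.re := congrArg Prod.fst h
  have h2 : a.im = b.im := congrArg Prod.snd h
  exact QuadraticAlgebra.ext h1 h2

/-- The Lorentz numbers carry the norm of `ℝ × ℝ`; only the topology and the smooth structure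
of the real plane matter. -/
instance : NormedAddCommGroup LNum :=
  NormedAddCommGroup.induced LNum (ℝ × ℝ) toProd toProd_injective

instance : NormedSpace ℝ LNum := NormedSpace.induced ℝ LNum (ℝ × ℝ) toProd

/-- A smooth map between open sets of Lorentz numbers is conformal if its differential commutes
with the multiplication by `σ`. -/
def IsConformalOn (f : LNum → LNum) (U : Set LNum) : Prop :=
  ContDiffOn ℝ ∞ f U ∧ ∀ a ∈ U, ∀ h : LNum, fderiv ℝ f a (σ * h) = σ * fderiv ℝ f a h

/-- The `2 × 2` matrix underlying an element of `SL₂` of the Lorentz numbers. -/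
abbrev toMat (A : Matrix.SpecialLinearGroup (Fin 2) LNum) : Matrix (Fin 2) (Fin 2) LNum := ↑A

/-! ### The space `ℝ^{2,2}` and its pseudo-spheres -/

/-- The underlying vector space of `ℝ^{2,2}`. -/
abbrev R22 : Type := Fin 4 → ℝ

/-- The scalar product of `ℝ^{2,2}`. -/
def ip (x y : R22) : ℝ := -(x 0 * y 0) + x 1 * y 1 - x 2 * y 2 + x 3 * y 3

/-- The Anti-de Sitter space `ℍ^{2,1}`. -/
def H21 : Set R22 := {x | ip x x = -1}

/-- The pseudo-sphere `𝕊^{1,2}`. -/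
def S12 : Set R22 := {x | ip x x = 1}

/-- The identification of `ℝ^{2,2}` with the Hermitian matrices over the Lorentz numbers. -/
def toHerm : R22 →ₗ[ℝ] Matrix (Fin 2) (Fin 2) LNum where
  toFun x := !![⟨-x 1 - x 0, 0⟩, ⟨-x 3, -x 2⟩; ⟨-x 3, x 2⟩, ⟨x 1 - x 0, 0⟩]
  map_add' x y := by
    ext i j <;> fin_cases i <;> fin_cases j <;> simp <;> ring
  map_smul' r x := by
    ext i j <;> fin_cases i <;> fin_cases j <;> simp <;> ring

theorem toHerm_injective : Function.Injective toHerm := by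
  intro x y h
  have h00 := congrArg QuadraticAlgebra.re (congrFun (congrFun h 0) 0)
  have h11 := congrArg QuadraticAlgebra.re (congrFun (congrFun h 1) 1)
  have h10 := congrArg QuadraticAlgebra.re (congrFun (congrFun h 1) 0)
  have h10' := congrArg QuadraticAlgebra.im (congrFun (congrFun h 1) 0)
  simp [toHerm] at h00 h11 h10 h10'
  funext i
  fin_cases i <;> simp <;> linarith

/-- The image of `toHerm` is exactly the set of Hermitian matrices. -/
theorem mem_range_toHerm (C : Matrix (Fin 2) (Fin 2) LNum) :
    C ∈ Set.range toHerm ↔ Cᴴ = C := by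
  constructor
  · rintro ⟨x, rfl⟩
    ext i j <;> fin_cases i <;> fin_cases j <;> simp [toHerm, Matrix.conjTranspose_apply]
  · intro h
    have k00 := congrArg QuadraticAlgebra.im (congrFun (congrFun h 0) 0)
    have k11 := congrArg QuadraticAlgebra.im (congrFun (congrFun h 1) 1)
    have k01 := congrArg QuadraticAlgebra.re (congrFun (congrFun h 0) 1)
    have k01' := congrArg QuadraticAlgebra.im (congrFun (congrFun h 0) 1)
    simp [Matrix.conjTranspose_apply] at k00 k11 k01 k01'
    refine ⟨![-((C 0 0).re + (C 1 1).re) / 2, ((C 1 1).re - (C 0 0).re) / 2, (C 1 0).im,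
      -(C 1 0).re], ?_⟩
    ext i j <;> fin_cases i <;> fin_cases j <;> simp [toHerm] <;> linarith

/-- Under `toHerm` the scalar product of `ℝ^{2,2}` is given by the quadratic form `-det`. -/
theorem det_toHerm (x : R22) : -(toHerm x).det = algebraMap ℝ LNum (ip x x) := by
  rw [Matrix.det_fin_two]
  ext <;> simp [toHerm, ip, QuadraticAlgebra.algebraMap_eq] <;> ring

/-! ### Lorentz surfaces

A smooth surface is a manifold modelled on the real plane underlying `LNum`. -/

section Surface

variable (M : Type*) [TopologicalSpace M] [ChartedSpace LNum M]

/-- A Lorentz structure on a smooth surface: an atlas of smooth charts with values in the Lorentz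
numbers whose transition functions are conformal. -/
structure LorentzStructure where
  charts : Set (OpenPartialHomeomorph M LNum)
  smooth : ∀ φ ∈ charts, φ ∈ IsManifold.maximalAtlas 𝓘(ℝ, LNum) ∞ M
  cover : ∀ p : M, ∃ φ ∈ charts, p ∈ φ.source
  conformal : ∀ φ ∈ charts, ∀ ψ ∈ charts,
    IsConformalOn (φ.symm.trans ψ) (φ.symm.trans ψ).source

/-- A field of real linear forms with values in the Lorentz numbers. -/
abbrev LForm : Type _ := ∀ p : M, TangentSpace 𝓘(ℝ, LNum) p →L[ℝ] LNum

variable {M}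

/-- The differential at `p` of a function with values in the Lorentz numbers. -/
def dL (f : M → LNum) (p : M) : TangentSpace 𝓘(ℝ, LNum) p →L[ℝ] LNum :=
  mfderiv 𝓘(ℝ, LNum) 𝓘(ℝ, LNum) f p

/-- The differential at `p` of a map into `ℝ^{2,2}`. -/
def dR (F : M → R22) (p : M) : TangentSpace 𝓘(ℝ, LNum) p →L[ℝ] R22 :=
  mfderiv 𝓘(ℝ, LNum) 𝓘(ℝ, R22) F p

/-- The entrywise differential at `p`, in the direction `X`, of a matrix valued map. -/
def dMat (B : M → Matrix.SpecialLinearGroup (Fin 2) LNum) (p : M)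
    (X : TangentSpace 𝓘(ℝ, LNum) p) : Matrix (Fin 2) (Fin 2) LNum :=
  Matrix.of fun i j => dL (fun q => toMat (B q) i j) p X

namespace LorentzStructure

/-- Conformal maps from a Lorentz surface to the Lorentz numbers. -/
def IsConformalMap (L : LorentzStructure M) (f : M → LNum) : Prop :=
  ContMDiff 𝓘(ℝ, LNum) 𝓘(ℝ, LNum) ∞ f ∧
    ∀ φ ∈ L.charts, IsConformalOn (f ∘ φ.symm) φ.target

/-- Conformal `1`-forms: in every chart `a` of the Lorentz structure the form is `P da` with `P`
conformal. -/
def IsConformalForm (L : LorentzStructure M) (θ : LForm M) : Prop :=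
  ∀ φ ∈ L.charts, ∃ P : LNum → LNum, IsConformalOn P φ.target ∧
    ∀ p ∈ φ.source, ∀ X, θ p X = P (φ p) * dL φ p X

/-- `B` is a conformal immersion into `SL₂` of the Lorentz numbers, `θ` and `η` are conformal
`1`-forms, and `B⁻¹ dB` is the off-diagonal matrix with entries `θ` and `η`. -/
structure IsOffDiagonal (L : LorentzStructure M)
    (B : M → Matrix.SpecialLinearGroup (Fin 2) LNum) (θ η : LForm M) : Prop where
  conformal : ∀ i j, L.IsConformalMap fun p => toMat (B p) i j
  immersion : ∀ p, Function.Injective (dMat B p)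
  conformal_left : L.IsConformalForm θ
  conformal_right : L.IsConformalForm η
  inv_mul_d : ∀ p X, toMat (B p)⁻¹ * dMat B p X = !![0, θ p X; η p X, 0]

end LorentzStructure

/-- The quadratic forms `|θ|² = θ θ̂` and `|η|² = η η̂` are different at every point. -/
def NormSqNe (θ η : LForm M) : Prop :=
  ∀ p, ∃ X, θ p X * star (θ p X) ≠ η p X * star (η p X)

/-! ### Lorentzian metrics -/

variable (M) in
/-- A smooth Lorentzian metric on a surface: a smooth symmetric `2`-tensor of signature `(1,1)`. -/
structure LorentzianMetric [IsManifold 𝓘(ℝ, LNum) ∞ M] where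
  val (p : M) :
    TangentSpace 𝓘(ℝ, LNum) p →L[ℝ] TangentSpace 𝓘(ℝ, LNum) p →L[ℝ] ℝ
  symm (p : M) (X Y : TangentSpace 𝓘(ℝ, LNum) p) : val p X Y = val p Y X
  signature (p : M) : ∃ X Y : TangentSpace 𝓘(ℝ, LNum) p,
    val p X X = -1 ∧ val p Y Y = 1 ∧ val p X Y = 0
  contMDiff : ContMDiff 𝓘(ℝ, LNum) (𝓘(ℝ, LNum).prod 𝓘(ℝ, LNum →L[ℝ] LNum →L[ℝ] ℝ)) ∞
    (fun p ↦ Bundle.TotalSpace.mk' (LNum →L[ℝ] LNum →L[ℝ] ℝ)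
      (E := fun q : M =>
        TangentSpace 𝓘(ℝ, LNum) q →L[ℝ] TangentSpace 𝓘(ℝ, LNum) q →L[ℝ] ℝ) p (val p))

/-- The coordinate basis `∂_u, ∂_v` of the plane. -/
def coordBasis : Fin 2 → LNum := ![1, σ]

/-- The partial derivative in the `i`-th coordinate direction. -/
def pd (i : Fin 2) (f : LNum → ℝ) (x : LNum) : ℝ := fderiv ℝ f x (coordBasis i)

/-- The Christoffel symbol `Γ^k_{ij}` of a matrix of metric coefficients. -/
def christoffel (G : LNum → Matrix (Fin 2) (Fin 2) ℝ) (k i j : Fin 2) (x : LNum) : ℝ :=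
  (1 / 2 : ℝ) * ∑ l, (G x)⁻¹ k l *
    (pd i (fun y => G y j l) x + pd j (fun y => G y i l) x - pd l (fun y => G y i j) x)

/-- The component along `∂_l` of `R(∂_i, ∂_j) ∂_k`, where `R` is the Riemann curvature tensor of a
matrix of metric coefficients. -/
def riemann (G : LNum → Matrix (Fin 2) (Fin 2) ℝ) (l k i j : Fin 2) (x : LNum) : ℝ :=
  pd i (christoffel G l j k) x - pd j (christoffel G l i k) x +
    ∑ m, (christoffel G l i m x * christoffel G m j k x -
      christoffel G l j m x * christoffel G m i k x)

namespace LorentzianMetric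

variable [IsManifold 𝓘(ℝ, LNum) ∞ M]

/-- The matrix of metric coefficients in a chart. -/
def coeff (g : LorentzianMetric M) (e : OpenPartialHomeomorph M LNum) (x : LNum) :
    Matrix (Fin 2) (Fin 2) ℝ :=
  Matrix.of fun i j =>
    g.val (e.symm x)
      (mfderiv 𝓘(ℝ, LNum) 𝓘(ℝ, LNum) e.symm x (coordBasis i))
      (mfderiv 𝓘(ℝ, LNum) 𝓘(ℝ, LNum) e.symm x (coordBasis j))

/-- The metric is flat: its curvature tensor vanishes identically. -/
def IsFlat (g : LorentzianMetric M) : Prop :=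
  ∀ e ∈ atlas LNum M, ∀ x ∈ e.target, ∀ l k i j, riemann (g.coeff e) l k i j x = 0

/-- `F` is a (smooth) isometric immersion of `(M, g)` into the subset `Q` of `ℝ^{2,2}`. -/
structure IsIsometricImmersion (g : LorentzianMetric M) (F : M → R22) (Q : Set R22) : Prop where
  contMDiff : ContMDiff 𝓘(ℝ, LNum) 𝓘(ℝ, R22) ∞ F
  mem : ∀ p, F p ∈ Q
  immersion : ∀ p, Function.Injective (dR F p)
  isometric : ∀ p X Y, ip (dR F p X) (dR F p Y) = g.val p X Y

end LorentzianMetric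

end Surface

end LorentzSurf

end

/-!
The Lorentz numbers are isomorphic to `ℝ × ℝ` by the null coordinates `u + σ v ↦ (u + v, u - v)`,
and conjugation exchanges the two factors. A map `B` into `SL₂` of the Lorentz numbers is therefore
a pair `(B₁, B₂)` of maps into `SL₂(ℝ)`. Identify `ℝ^{2,2}` with `M₂(ℝ)` and `-det` by taking the
first null component (`toReal`). Then `F = B J B^*` becomes `F = B₁ J B₂ᵀ` (`toHerm_eq_iff`), with
`J = diag(ε, 1)`; here `ε = 1` gives `ℍ^{2,1}`, `ε = -1` gives `𝕊^{1,2}`, and both cases are treated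
at once. The condition on the diagonal of `B⁻¹ dB` says that `B₁` and `B₂` are *horizontal*: their
Maurer–Cartan forms have zero diagonal.

*From lifts to flat surfaces.* Write `θ, η` for the off-diagonal entries of `B⁻¹ dB`, and subscripts
for null components. For horizontal `B₁, B₂` one has `B₁⁻¹ dF B₂⁻ᵀ = !![0, α; β, 0]` with
`α = θ₁ + ε η₂` and `β = θ₂ + ε η₁`, so the induced metric is `α β`. The forms `α` and `β` are
independent exactly where `|θ|² ≠ |η|²`, and they are closed by the Maurer–Cartan equation, so that
the metric is flat (`riemann_product_eq_zero`, `exists_flat_of_offDiagonal`).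

*From flat surfaces to lifts.* The unit normal of `F`, translated to the Lie algebra, is a traceless
matrix of square `1`. Diagonalizing it gives locally a factorization `F = B₁ J B₂ᵀ` in which the
diagonals of the two Maurer–Cartan forms are opposite, `λ` and `-λ` (`exists_adapted`). The metric
is again `α β`, now with `dα = -2 λ ∧ α` and `dβ = 2 λ ∧ β`, and its curvature is a multiple of `dλ`
(`closed_of_riemann_eq_zero`). Flatness thus allows one to write `λ = -df` and to remove it by
the gauge transformation `diag(e^f, e^{-f})` (`exists_horizontal`). Two horizontal factorizations of
`F` differ by a locally constant map into the group of monomial matrices (`horizontal_unique`), so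
on a simply connected surface the local factorizations can be adjusted to a global one
(`exists_coboundary`, `exists_global_lift`).

*The Lorentz structure.* By the Maurer–Cartan equation the entries of the Maurer–Cartan form of a
horizontal map are proportional closed forms, hence `B₁` depends on one function `s` only, and `B₂`
on one function `t`. Where `α` and `β` are independent so are `s` and `t`, and in the chart with
null coordinates `(s, t)` the map `B` is conformal (`exists_null_chart`). The charts in which `B` is
conformal form the required Lorentz structure (`lorentzStructureOf`): their transition functions are
conformal because `B` is an immersion.
-/

noncomputable section

namespace LorentzSurf

/-! ### Null coordinates on the Lorentz numbers -/

/-- The null coordinate `u + σ v ↦ u + v`, a homomorphism of real algebras. -/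
def nullFst : LNum →L[ℝ] ℝ :=
  LinearMap.toContinuousLinearMap
    { toFun := fun a => a.re + a.im
      map_add' := fun a b => by simp; ring
      map_smul' := fun r a => by simp; ring }

/-- The null coordinate `u + σ v ↦ u - v`, a homomorphism of real algebras. -/
def nullSnd : LNum →L[ℝ] ℝ :=
  LinearMap.toContinuousLinearMap
    { toFun := fun a => a.re - a.im
      map_add' := fun a b => by simp; ring
      map_smul' := fun r a => by simp; ring }

theorem nullFst_apply (a : LNum) : nullFst a = a.re + a.im := rfl

theorem nullSnd_apply (a : LNum) : nullSnd a = a.re - a.im := rfl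

/-- The Lorentz number with prescribed null coordinates. -/
def ofNull (s t : ℝ) : LNum := ⟨(s + t) / 2, (s - t) / 2⟩

@[simp] theorem nullFst_ofNull (s t : ℝ) : nullFst (ofNull s t) = s := by
  simp only [nullFst_apply, ofNull]; ring

@[simp] theorem nullSnd_ofNull (s t : ℝ) : nullSnd (ofNull s t) = t := by
  simp only [nullSnd_apply, ofNull]; ring

theorem null_ext {a b : LNum} (h₁ : nullFst a = nullFst b) (h₂ : nullSnd a = nullSnd b) :
    a = b := by
  rw [nullFst_apply, nullFst_apply] at h₁
  rw [nullSnd_apply, nullSnd_apply] at h₂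
  ext <;> linarith

@[simp] theorem nullFst_mul (a b : LNum) : nullFst (a * b) = nullFst a * nullFst b := by
  simp only [nullFst_apply, QuadraticAlgebra.re_mul, QuadraticAlgebra.im_mul]; ring

@[simp] theorem nullSnd_mul (a b : LNum) : nullSnd (a * b) = nullSnd a * nullSnd b := by
  simp only [nullSnd_apply, QuadraticAlgebra.re_mul, QuadraticAlgebra.im_mul]; ring

@[simp] theorem nullFst_one : nullFst 1 = 1 := by
  simp [nullFst_apply, QuadraticAlgebra.re_one, QuadraticAlgebra.im_one]

@[simp] theorem nullSnd_one : nullSnd 1 = 1 := by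
  simp [nullSnd_apply, QuadraticAlgebra.re_one, QuadraticAlgebra.im_one]

@[simp] theorem nullFst_star (a : LNum) : nullFst (star a) = nullSnd a := by
  simp [nullFst_apply, nullSnd_apply]; ring

@[simp] theorem nullSnd_star (a : LNum) : nullSnd (star a) = nullFst a := by
  simp [nullFst_apply, nullSnd_apply]

/-- The null coordinates identify the Lorentz numbers with the plane. -/
def nullEquiv : LNum ≃L[ℝ] ℝ × ℝ :=
  LinearEquiv.toContinuousLinearEquiv
    { toFun := fun a => (nullFst a, nullSnd a)
      map_add' := fun a b => by simp
      map_smul' := fun r a => by simp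
      invFun := fun p => ofNull p.1 p.2
      left_inv := fun a => null_ext (by simp) (by simp)
      right_inv := fun p => by simp }

theorem coord_decomp (h : LNum) : h = h.re • coordBasis 0 + h.im • coordBasis 1 := by
  ext <;> simp [coordBasis, σ, QuadraticAlgebra.re_one, QuadraticAlgebra.im_one]

section Calculus

variable {f g : LNum → ℝ} {U : Set LNum} {x : LNum} {i j : Fin 2}

theorem contDiffOn_ofNull (hf : ContDiffOn ℝ ∞ f U) (hg : ContDiffOn ℝ ∞ g U) :
    ContDiffOn ℝ ∞ (fun x => ofNull (f x) (g x)) U :=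
  nullEquiv.symm.contDiff.comp_contDiffOn (hf.prodMk hg)

theorem fderiv_apply_eq_pd (f : LNum → ℝ) (x h : LNum) :
    fderiv ℝ f x h = h.re * pd 0 f x + h.im * pd 1 f x := by
  conv_lhs => rw [coord_decomp h, map_add, map_smul, map_smul]
  simp [pd]

theorem contDiffOn_pd (hU : IsOpen U) (hf : ContDiffOn ℝ ∞ f U) (i : Fin 2) :
    ContDiffOn ℝ ∞ (pd i f) U := by
  have h := hf.fderiv_of_isOpen hU (m := ∞) (by simp)
  exact h.clm_apply contDiffOn_const

theorem diffAt (hU : IsOpen U) (hx : x ∈ U) (hf : ContDiffOn ℝ ∞ f U) :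
    DifferentiableAt ℝ f x :=
  (hf.contDiffAt (hU.mem_nhds hx)).differentiableAt (by simp)

theorem pd_congr (hU : IsOpen U) (hx : x ∈ U) (h : ∀ y ∈ U, f y = g y) :
    pd i f x = pd i g x := by
  have : f =ᶠ[𝓝 x] g := Filter.eventually_of_mem (hU.mem_nhds hx) h
  simp only [pd, this.fderiv_eq]

theorem pd_const (c : ℝ) : pd i (fun _ => c) x = 0 := by simp [pd]

theorem pd_add (hf : DifferentiableAt ℝ f x) (hg : DifferentiableAt ℝ g x) :
    pd i (fun y => f y + g y) x = pd i f x + pd i g x := by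
  simp [pd, fderiv_fun_add hf hg]

theorem pd_sub (hf : DifferentiableAt ℝ f x) (hg : DifferentiableAt ℝ g x) :
    pd i (fun y => f y - g y) x = pd i f x - pd i g x := by
  simp [pd, fderiv_fun_sub hf hg]

theorem pd_neg : pd i (fun y => -f y) x = -pd i f x := by
  simp [pd, fderiv_fun_neg]

theorem pd_mul (hf : DifferentiableAt ℝ f x) (hg : DifferentiableAt ℝ g x) :
    pd i (fun y => f y * g y) x = pd i f x * g x + f x * pd i g x := by
  simp [pd, fderiv_fun_mul hf hg]; ring

theorem pd_const_mul (c : ℝ) (hf : DifferentiableAt ℝ f x) :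
    pd i (fun y => c * f y) x = c * pd i f x := by
  simp [pd, fderiv_const_mul hf]

theorem pd_comm (hU : IsOpen U) (hx : x ∈ U) (hf : ContDiffOn ℝ ∞ f U) :
    pd i (pd j f) x = pd j (pd i f) x := by
  have hd : DifferentiableAt ℝ (fderiv ℝ f) x :=
    ((hf.fderiv_of_isOpen hU (m := ∞) (by simp)).contDiffAt (hU.mem_nhds hx)).differentiableAt
      (by simp)
  have key : ∀ i j : Fin 2, pd i (pd j f) x =
      fderiv ℝ (fderiv ℝ f) x (coordBasis i) (coordBasis j) := by
    intro i j
    have : pd j f = fun y => fderiv ℝ f y (coordBasis j) := rfl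
    rw [this]
    simp only [pd]
    rw [fderiv_clm_apply hd (by fun_prop)]
    simp
  rw [key, key]
  have hs : IsSymmSndFDerivAt ℝ f x :=
    (hf.contDiffAt (hU.mem_nhds hx)).isSymmSndFDerivAt
      (by simpa using (WithTop.coe_le_coe.mpr le_top : ((2 : ℕ∞) : WithTop ℕ∞) ≤ ∞))
  exact hs.eq _ _

/-- On a convex open set a closed form `p du + q dv` has a primitive. -/
theorem exists_primitive {p q : LNum → ℝ} (hU : IsOpen U) (hc : Convex ℝ U)
    (hp : ContDiffOn ℝ ∞ p U) (hq : ContDiffOn ℝ ∞ q U)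
    (hpq : ∀ x ∈ U, pd 0 q x = pd 1 p x) :
    ∃ f : LNum → ℝ, ContDiffOn ℝ ∞ f U ∧ ∀ x ∈ U, pd 0 f x = p x ∧ pd 1 f x = q x := by
  let r : LNum →L[ℝ] ℝ := (1 / 2 : ℝ) • (nullFst + nullSnd)
  let s : LNum →L[ℝ] ℝ := (1 / 2 : ℝ) • (nullFst - nullSnd)
  have hr : ∀ h, r h = h.re := fun h => by simp [r, nullFst_apply, nullSnd_apply]; ring
  have hs : ∀ h, s h = h.im := fun h => by simp [s, nullFst_apply, nullSnd_apply]; ring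
  let w : LNum → LNum →L[ℝ] ℝ := fun x => p x • r + q x • s
  have hω : ContDiffOn ℝ ∞ w U := (hp.smul contDiffOn_const).add (hq.smul contDiffOn_const)
  have hdω : ∀ a ∈ U, ∀ x y, fderiv ℝ w a x y = fderiv ℝ w a y x := by
    intro a ha x y
    have hpa := diffAt hU ha hp
    have hqa := diffAt hU ha hq
    have h : HasFDerivAt w ((fderiv ℝ p a).smulRight r + (fderiv ℝ q a).smulRight s) a :=
      (hpa.hasFDerivAt.smul_const r).add (hqa.hasFDerivAt.smul_const s)
    rw [h.fderiv]
    simp only [add_apply, ContinuousLinearMap.smulRight_apply,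
      smul_apply, fderiv_apply_eq_pd, hr, hs, smul_eq_mul, hpq a ha]
    ring
  obtain ⟨f, hf⟩ := hc.exists_forall_hasFDerivAt_of_fderiv_symmetric hU
    (hω.differentiableOn (by simp)) hdω
  refine ⟨f, ?_, fun x hx => ⟨?_, ?_⟩⟩
  · have : ContDiffOn ℝ (∞ + 1) f U := by
      rw [contDiffOn_succ_iff_fderiv_of_isOpen hU]
      refine ⟨fun x hx => (hf x hx).differentiableAt.differentiableWithinAt, by simp, ?_⟩
      exact hω.congr fun x hx => (hf x hx).fderiv
    simpa using this
  · simp only [pd, (hf x hx).fderiv, w, add_apply,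
      smul_apply, hr, hs]
    simp [coordBasis, QuadraticAlgebra.re_one, QuadraticAlgebra.im_one]
  · simp only [pd, (hf x hx).fderiv, w, add_apply,
      smul_apply, hr, hs]
    simp [coordBasis, σ]

theorem const_of_pd_eq_zero (hU : IsOpen U) (hc : IsPreconnected U) (hf : ContDiffOn ℝ ∞ f U)
    (h0 : ∀ x ∈ U, ∀ i, pd i f x = 0) {x y : LNum} (hx : x ∈ U) (hy : y ∈ U) : f x = f y := by
  refine hU.is_const_of_fderiv_eq_zero hc (hf.differentiableOn (by simp)) ?_ hx hy
  intro z hz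
  ext h
  simp [fderiv_apply_eq_pd, h0 z hz]

end Calculus

/-! ### Curvature of a metric in a null coframe -/

/-- The first vector of the frame dual to the coframe `α, β` of the plane. -/
def dualVec (α β : Fin 2 → LNum → ℝ) (k : Fin 2) (x : LNum) : ℝ :=
  ![β 1 x, -β 0 x] k / (α 0 x * β 1 x - α 1 x * β 0 x)

/-- The components of the covariant derivative of `α`, when the connection form is `-c • lam`. -/
def covDer (c : ℝ) (lam α : Fin 2 → LNum → ℝ) (i j : Fin 2) (x : LNum) : ℝ :=
  pd i (α j) x + c * (lam i x * α j x)

/-- The coefficients of the metric `α β`. -/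
def nullMetric (α β : Fin 2 → LNum → ℝ) (x : LNum) : Matrix (Fin 2) (Fin 2) ℝ :=
  Matrix.of fun i j => 1 / 2 * (α i x * β j x + α j x * β i x)

section

variable {α β lam : Fin 2 → LNum → ℝ} {U : Set LNum} {G : LNum → Matrix (Fin 2) (Fin 2) ℝ}

theorem dualVec_fst {x : LNum} (h : α 0 x * β 1 x - α 1 x * β 0 x ≠ 0) :
    α 0 x * dualVec α β 0 x + α 1 x * dualVec α β 1 x = 1 := by
  simp only [dualVec, Matrix.cons_val_zero, Matrix.cons_val_one]
  rw [← mul_div_assoc, ← mul_div_assoc, ← add_div, div_eq_one_iff_eq h]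
  ring

theorem dualVec_snd (x : LNum) :
    β 0 x * dualVec α β 0 x + β 1 x * dualVec α β 1 x = 0 := by
  simp only [dualVec, Matrix.cons_val_zero, Matrix.cons_val_one]
  ring

theorem contDiffOn_dualVec (hα : ∀ i, ContDiffOn ℝ ∞ (α i) U) (hβ : ∀ i, ContDiffOn ℝ ∞ (β i) U)
    (h : ∀ x ∈ U, α 0 x * β 1 x - α 1 x * β 0 x ≠ 0) (k : Fin 2) :
    ContDiffOn ℝ ∞ (dualVec α β k) U := by
  have hd : ContDiffOn ℝ ∞ (fun x => α 0 x * β 1 x - α 1 x * β 0 x) U :=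
    ((hα 0).mul (hβ 1)).sub ((hα 1).mul (hβ 0))
  fin_cases k
  · exact (hβ 1).div hd h
  · exact (hβ 0).neg.div hd h

theorem nullMetric_inv {x : LNum} (h : α 0 x * β 1 x - α 1 x * β 0 x ≠ 0) :
    (nullMetric α β x)⁻¹ = Matrix.of fun i j =>
      2 * (dualVec α β i x * dualVec β α j x + dualVec β α i x * dualVec α β j x) := by
  have h' : β 0 x * α 1 x - β 1 x * α 0 x ≠ 0 := fun h0 => h (by linarith)
  apply Matrix.inv_eq_right_inv
  ext i j
  have key : ∀ i j, (nullMetric α β x * Matrix.of fun i j =>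
      2 * (dualVec α β i x * dualVec β α j x + dualVec β α i x * dualVec α β j x)) i j =
      β i x * dualVec β α j x + α i x * dualVec α β j x := by
    intro i j
    rw [Matrix.mul_apply, Fin.sum_univ_two]
    simp only [nullMetric, Matrix.of_apply]
    linear_combination
      (β i x * dualVec β α j x) * dualVec_fst h +
      (α i x * dualVec β α j x) * dualVec_snd (α := α) (β := β) x +
      (α i x * dualVec α β j x) * dualVec_fst h' +
      (β i x * dualVec α β j x) * dualVec_snd (α := β) (β := α) x
  rw [key]
  have hd : β 0 x * α 1 x - β 1 x * α 0 x = -(α 0 x * β 1 x - α 1 x * β 0 x) := by ring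
  obtain ⟨d, hd'⟩ : ∃ d, d = α 0 x * β 1 x - α 1 x * β 0 x := ⟨_, rfl⟩
  have hd0 : d ≠ 0 := hd' ▸ h
  simp only [dualVec, hd, ← hd']
  fin_cases i <;> fin_cases j <;> simp <;> field_simp <;> linarith

theorem covDer_symm {c : ℝ} {x : LNum}
    (h : pd 0 (α 1) x - pd 1 (α 0) x = -c * (lam 0 x * α 1 x - lam 1 x * α 0 x)) (i j : Fin 2) :
    covDer c lam α i j x = covDer c lam α j i x := by
  fin_cases i <;> fin_cases j <;> simp [covDer] <;> linarith

theorem pd_nullMetric (hU : IsOpen U) (hα : ∀ i, ContDiffOn ℝ ∞ (α i) U)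
    (hβ : ∀ i, ContDiffOn ℝ ∞ (β i) U) {x : LNum} (hx : x ∈ U)
    (hG : ∀ x ∈ U, G x = nullMetric α β x) (i j l : Fin 2) :
    pd i (fun y => G y j l) x = 1 / 2 * (pd i (α j) x * β l x + α j x * pd i (β l) x +
      (pd i (α l) x * β j x + α l x * pd i (β j) x)) := by
  have ha := fun i => diffAt hU hx (hα i)
  have hb := fun i => diffAt hU hx (hβ i)
  rw [pd_congr hU hx (g := fun y => 1 / 2 * (α j y * β l y + α l y * β j y))
    (fun y hy => by rw [hG y hy]; rfl)]
  rw [pd_const_mul _ (((ha j).fun_mul (hb l)).fun_add ((ha l).fun_mul (hb j))),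
    pd_add ((ha j).fun_mul (hb l)) ((ha l).fun_mul (hb j)), pd_mul (ha j) (hb l),
    pd_mul (ha l) (hb j)]

/-- The Christoffel symbols of the metric `α β` when `dα = -c lam ∧ α` and `dβ = c lam ∧ β`. -/
theorem christoffel_nullMetric {c : ℝ} (hU : IsOpen U) (hα : ∀ i, ContDiffOn ℝ ∞ (α i) U)
    (hβ : ∀ i, ContDiffOn ℝ ∞ (β i) U)
    (hΔ : ∀ x ∈ U, α 0 x * β 1 x - α 1 x * β 0 x ≠ 0)
    (hdα : ∀ x ∈ U, pd 0 (α 1) x - pd 1 (α 0) x = -c * (lam 0 x * α 1 x - lam 1 x * α 0 x))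
    (hdβ : ∀ x ∈ U, pd 0 (β 1) x - pd 1 (β 0) x = c * (lam 0 x * β 1 x - lam 1 x * β 0 x))
    (hG : ∀ x ∈ U, G x = nullMetric α β x) {x : LNum} (hx : x ∈ U) (k i j : Fin 2) :
    christoffel G k i j x = dualVec α β k x * covDer c lam α i j x +
      dualVec β α k x * covDer (-c) lam β i j x := by
  have h := hΔ x hx
  have h' : β 0 x * α 1 x - β 1 x * α 0 x ≠ 0 := fun h0 => h (by linarith)
  have sα := covDer_symm (hdα x hx)
  have sβ := covDer_symm (c := -c) (lam := lam) (α := β) (x := x) (by rw [hdβ x hx]; ring)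
  have key : ∀ l, pd i (fun y => G y j l) x + pd j (fun y => G y i l) x - pd l (fun y => G y i j) x
      = α l x * covDer (-c) lam β i j x + β l x * covDer c lam α i j x := by
    intro l
    simp only [pd_nullMetric hU hα hβ hx hG]
    have e1 := sα i l
    have e2 := sα j l
    have e3 := sβ i l
    have e4 := sβ j l
    have e5 := sα i j
    have e6 := sβ i j
    simp only [covDer] at e1 e2 e3 e4 e5 e6 ⊢
    linear_combination (1 / 2 * β j x) * e1 + (1 / 2 * β i x) * e2 + (1 / 2 * α j x) * e3 +
      (1 / 2 * α i x) * e4 - (1 / 2 * β l x) * e5 - (1 / 2 * α l x) * e6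
  simp only [christoffel, key, hG x hx, nullMetric_inv h, Matrix.of_apply, Fin.sum_univ_two]
  linear_combination
    (dualVec β α k x * covDer (-c) lam β i j x) * dualVec_fst h +
    (dualVec β α k x * covDer c lam α i j x) * dualVec_snd (α := α) (β := β) x +
    (dualVec α β k x * covDer c lam α i j x) * dualVec_fst h' +
    (dualVec α β k x * covDer (-c) lam β i j x) * dualVec_snd (α := β) (β := α) x

theorem contDiffOn_covDer {c : ℝ} (hU : IsOpen U) (hα : ∀ i, ContDiffOn ℝ ∞ (α i) U)
    (hl : ∀ i, ContDiffOn ℝ ∞ (lam i) U) (i j : Fin 2) :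
    ContDiffOn ℝ ∞ (covDer c lam α i j) U :=
  (contDiffOn_pd hU (hα j) i).add (contDiffOn_const.mul ((hl i).mul (hα j)))

/-- A parallel-up-to-scale covector `α` is an eigenvector of the transposed curvature operator,
the eigenvalue being the curvature `d (c • lam)` of the connection form. -/
theorem riemann_of_parallel {c : ℝ} (hU : IsOpen U) (hα : ∀ i, ContDiffOn ℝ ∞ (α i) U)
    (hl : ∀ i, ContDiffOn ℝ ∞ (lam i) U)
    (hΓ : ∀ k i j, ContDiffOn ℝ ∞ (christoffel G k i j) U)
    (hc : ∀ x ∈ U, ∀ i j, α 0 x * christoffel G 0 i j x + α 1 x * christoffel G 1 i j x =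
      covDer c lam α i j x)
    {x : LNum} (hx : x ∈ U) (k i j : Fin 2) :
    α 0 x * riemann G 0 k i j x + α 1 x * riemann G 1 k i j x =
      c * (pd i (lam j) x - pd j (lam i) x) * α k x := by
  have ha := fun i => diffAt hU hx (hα i)
  have hb := fun i => diffAt hU hx (hl i)
  have hg := fun k i j => diffAt hU hx (hΓ k i j)
  have hp := fun i j => diffAt hU hx (contDiffOn_pd hU (hα j) i)
  have key : ∀ m i j, pd m (α 0) x * christoffel G 0 i j x + α 0 x * pd m (christoffel G 0 i j) x +
      (pd m (α 1) x * christoffel G 1 i j x + α 1 x * pd m (christoffel G 1 i j) x) =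
      pd m (pd i (α j)) x + c * (pd m (lam i) x * α j x + lam i x * pd m (α j) x) := by
    intro m i j
    have h1 := pd_congr (i := m) hU hx (fun y hy => hc y hy i j)
    rw [pd_add ((ha 0).fun_mul (hg 0 i j)) ((ha 1).fun_mul (hg 1 i j)), pd_mul (ha 0) (hg 0 i j),
      pd_mul (ha 1) (hg 1 i j)] at h1
    rw [h1, show covDer c lam α i j = fun y => pd i (α j) y + c * (lam i y * α j y) from rfl,
      pd_add (hp i j) (((hb i).fun_mul (ha j)).const_mul c), pd_const_mul c ((hb i).fun_mul (ha j)),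
      pd_mul (hb i) (ha j)]
  have k1 := key i j k
  have k2 := key j i k
  have comm : pd i (pd j (α k)) x = pd j (pd i (α k)) x := pd_comm hU hx (hα k)
  have c1 := hc x hx
  simp only [riemann, Fin.sum_univ_two]
  have s1 := c1 i 0
  have s2 := c1 i 1
  have s3 := c1 j 0
  have s4 := c1 j 1
  have s5 := c1 j k
  have s6 := c1 i k
  simp only [covDer] at s1 s2 s3 s4 s5 s6
  linear_combination k1 - k2 + comm + christoffel G 0 j k x * s1 + christoffel G 1 j k x * s2 -
    christoffel G 0 i k x * s3 - christoffel G 1 i k x * s4 + c * lam i x * s5 - c * lam j x * s6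

/-- The curvature of `α β`, for `dα = -c lam ∧ α` and `dβ = c lam ∧ β`, is that of the connection
form `c • lam`. -/
theorem riemann_nullMetric {c : ℝ} (hU : IsOpen U) (hα : ∀ i, ContDiffOn ℝ ∞ (α i) U)
    (hβ : ∀ i, ContDiffOn ℝ ∞ (β i) U) (hl : ∀ i, ContDiffOn ℝ ∞ (lam i) U)
    (hΔ : ∀ x ∈ U, α 0 x * β 1 x - α 1 x * β 0 x ≠ 0)
    (hdα : ∀ x ∈ U, pd 0 (α 1) x - pd 1 (α 0) x = -c * (lam 0 x * α 1 x - lam 1 x * α 0 x))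
    (hdβ : ∀ x ∈ U, pd 0 (β 1) x - pd 1 (β 0) x = c * (lam 0 x * β 1 x - lam 1 x * β 0 x))
    (hG : ∀ x ∈ U, G x = nullMetric α β x) {x : LNum} (hx : x ∈ U) (k i j : Fin 2) :
    α 0 x * riemann G 0 k i j x + α 1 x * riemann G 1 k i j x =
      c * (pd i (lam j) x - pd j (lam i) x) * α k x ∧
    β 0 x * riemann G 0 k i j x + β 1 x * riemann G 1 k i j x =
      -c * (pd i (lam j) x - pd j (lam i) x) * β k x := by
  have hΔ' : ∀ x ∈ U, β 0 x * α 1 x - β 1 x * α 0 x ≠ 0 :=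
    fun x hx h0 => hΔ x hx (by linarith)
  have hch := fun x (hx : x ∈ U) => christoffel_nullMetric hU hα hβ hΔ hdα hdβ hG hx
  have hΓ : ∀ k i j, ContDiffOn ℝ ∞ (christoffel G k i j) U := fun k i j =>
    (((contDiffOn_dualVec hα hβ hΔ k).mul (contDiffOn_covDer hU hα hl i j)).add
      ((contDiffOn_dualVec hβ hα hΔ' k).mul (contDiffOn_covDer hU hβ hl i j))).congr
      fun x hx => hch x hx k i j
  constructor
  · refine riemann_of_parallel hU hα hl hΓ (fun x hx i j => ?_) hx k i j
    rw [hch x hx, hch x hx]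
    linear_combination covDer c lam α i j x * dualVec_fst (hΔ x hx) +
      covDer (-c) lam β i j x * dualVec_snd (α := β) (β := α) x
  · refine riemann_of_parallel hU hβ hl hΓ (fun x hx i j => ?_) hx k i j
    rw [hch x hx, hch x hx]
    linear_combination covDer (-c) lam β i j x * dualVec_fst (hΔ' x hx) +
      covDer c lam α i j x * dualVec_snd (α := α) (β := β) x

/-- A metric with a closed null coframe is flat. -/
theorem riemann_eq_zero_of_closed (hU : IsOpen U) (hα : ∀ i, ContDiffOn ℝ ∞ (α i) U)
    (hβ : ∀ i, ContDiffOn ℝ ∞ (β i) U)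
    (hΔ : ∀ x ∈ U, α 0 x * β 1 x - α 1 x * β 0 x ≠ 0)
    (hdα : ∀ x ∈ U, pd 0 (α 1) x = pd 1 (α 0) x) (hdβ : ∀ x ∈ U, pd 0 (β 1) x = pd 1 (β 0) x)
    (hG : ∀ x ∈ U, G x = nullMetric α β x) {x : LNum} (hx : x ∈ U) (l k i j : Fin 2) :
    riemann G l k i j x = 0 := by
  obtain ⟨h1, h2⟩ := riemann_nullMetric (c := 0) (lam := fun _ _ => 0) hU hα hβ
    (fun _ => contDiffOn_const) hΔ (fun x hx => by rw [hdα x hx]; ring)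
    (fun x hx => by rw [hdβ x hx]; ring) hG hx k i j
  have e0 : (α 0 x * β 1 x - α 1 x * β 0 x) * riemann G 0 k i j x = 0 := by
    linear_combination β 1 x * h1 - α 1 x * h2
  have e1 : (α 0 x * β 1 x - α 1 x * β 0 x) * riemann G 1 k i j x = 0 := by
    linear_combination α 0 x * h2 - β 0 x * h1
  fin_cases l
  · exact (mul_eq_zero.mp e0).resolve_left (hΔ x hx)
  · exact (mul_eq_zero.mp e1).resolve_left (hΔ x hx)

/-- If the metric `α β` is flat, the connection form of its null coframe is closed. -/
theorem closed_of_riemann_eq_zero (hU : IsOpen U) (hα : ∀ i, ContDiffOn ℝ ∞ (α i) U)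
    (hβ : ∀ i, ContDiffOn ℝ ∞ (β i) U) (hl : ∀ i, ContDiffOn ℝ ∞ (lam i) U)
    (hΔ : ∀ x ∈ U, α 0 x * β 1 x - α 1 x * β 0 x ≠ 0)
    (hdα : ∀ x ∈ U, pd 0 (α 1) x - pd 1 (α 0) x = -2 * (lam 0 x * α 1 x - lam 1 x * α 0 x))
    (hdβ : ∀ x ∈ U, pd 0 (β 1) x - pd 1 (β 0) x = 2 * (lam 0 x * β 1 x - lam 1 x * β 0 x))
    (hG : ∀ x ∈ U, G x = nullMetric α β x) {x : LNum} (hx : x ∈ U)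
    (hR : ∀ l k i j, riemann G l k i j x = 0) :
    pd 0 (lam 1) x = pd 1 (lam 0) x := by
  have h := fun k => (riemann_nullMetric hU hα hβ hl hΔ hdα hdβ hG hx k 0 1).1
  simp only [hR, mul_zero, add_zero] at h
  by_contra hne
  have hne' : (2 : ℝ) * (pd 0 (lam 1) x - pd 1 (lam 0) x) ≠ 0 :=
    mul_ne_zero two_ne_zero (sub_ne_zero.mpr hne)
  have e := fun k => (mul_eq_zero.mp (h k).symm).resolve_left hne'
  exact hΔ x hx (by rw [e 0, e 1]; ring)

end

/-! ### Maurer–Cartan forms of maps of the plane into `SL₂(ℝ)` -/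

/-- Real `2 × 2` matrices. -/
abbrev Mat2 : Type := Matrix (Fin 2) (Fin 2) ℝ

/-- A matrix valued map of the plane is smooth on `U` if its entries are. -/
def SmoothMat (B : LNum → Mat2) (U : Set LNum) : Prop :=
  ∀ k l, ContDiffOn ℝ ∞ (fun x => B x k l) U

/-- The entrywise partial derivative of a matrix valued map. -/
def pdMat (i : Fin 2) (B : LNum → Mat2) (x : LNum) : Mat2 :=
  Matrix.of fun k l => pd i (fun y => B y k l) x

/-- The `i`-th coefficient of the Maurer–Cartan form `B⁻¹ dB` of a map with values in `SL₂(ℝ)`;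
the adjugate stands for the inverse. -/
def mc (B : LNum → Mat2) (i : Fin 2) (x : LNum) : Mat2 :=
  (B x).adjugate * pdMat i B x

section

variable {A B : LNum → Mat2} {U V : Set LNum} {x : LNum} {i j : Fin 2}

theorem SmoothMat.mono (h : SmoothMat B U) (hV : V ⊆ U) : SmoothMat B V :=
  fun k l => (h k l).mono hV

theorem SmoothMat.mul (hA : SmoothMat A U) (hB : SmoothMat B U) :
    SmoothMat (fun x => A x * B x) U := by
  intro k l
  simp only [Matrix.mul_apply, Fin.sum_univ_two]
  exact ((hA k 0).mul (hB 0 l)).add ((hA k 1).mul (hB 1 l))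

theorem SmoothMat.transpose (hB : SmoothMat B U) : SmoothMat (fun x => (B x)ᵀ) U :=
  fun k l => hB l k

theorem SmoothMat.adjugate (hB : SmoothMat B U) : SmoothMat (fun x => (B x).adjugate) U := by
  intro k l
  simp only [Matrix.adjugate_fin_two]
  fin_cases k <;> fin_cases l
  · exact hB 1 1
  · exact (hB 0 1).neg
  · exact (hB 1 0).neg
  · exact hB 0 0

theorem SmoothMat.pdMat (hU : IsOpen U) (hB : SmoothMat B U) (i : Fin 2) :
    SmoothMat (pdMat i B) U :=
  fun k l => contDiffOn_pd hU (hB k l) i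

theorem SmoothMat.mc (hU : IsOpen U) (hB : SmoothMat B U) (i : Fin 2) : SmoothMat (mc B i) U :=
  hB.adjugate.mul (hB.pdMat hU i)

theorem smoothMat_const (C : Mat2) : SmoothMat (fun _ => C) U := fun _ _ => contDiffOn_const

theorem pdMat_const (C : Mat2) : pdMat i (fun _ => C) x = 0 := by
  ext k l; simp [pdMat, pd_const]

theorem pdMat_transpose : pdMat i (fun y => (B y)ᵀ) x = (pdMat i B x)ᵀ := rfl

theorem pdMat_congr (hU : IsOpen U) (hx : x ∈ U) (h : ∀ y ∈ U, A y = B y) :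
    pdMat i A x = pdMat i B x := by
  ext k l
  exact pd_congr hU hx fun y hy => by rw [h y hy]

theorem pdMat_mul (hU : IsOpen U) (hx : x ∈ U) (hA : SmoothMat A U) (hB : SmoothMat B U) :
    pdMat i (fun y => A y * B y) x = pdMat i A x * B x + A x * pdMat i B x := by
  have ha := fun k l => diffAt hU hx (hA k l)
  have hb := fun k l => diffAt hU hx (hB k l)
  ext k l
  simp only [pdMat, Matrix.of_apply, Matrix.add_apply, Matrix.mul_apply, Fin.sum_univ_two]
  rw [pd_add ((ha k 0).fun_mul (hb 0 l)) ((ha k 1).fun_mul (hb 1 l)), pd_mul (ha k 0) (hb 0 l),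
    pd_mul (ha k 1) (hb 1 l)]
  ring

theorem pdMat_comm (hU : IsOpen U) (hx : x ∈ U) (hB : SmoothMat B U) :
    pdMat i (pdMat j B) x = pdMat j (pdMat i B) x := by
  ext k l
  exact pd_comm hU hx (hB k l)

theorem adj_mul {C : Mat2} (h : C.det = 1) : C.adjugate * C = 1 := by
  rw [Matrix.adjugate_mul, h, one_smul]

theorem mul_adj {C : Mat2} (h : C.det = 1) : C * C.adjugate = 1 := by
  rw [Matrix.mul_adjugate, h, one_smul]

theorem pdMat_eq_mul_mc (hd : (B x).det = 1) : pdMat i B x = B x * mc B i x := by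
  rw [mc, ← mul_assoc, mul_adj hd, one_mul]

/-- The Maurer–Cartan equation. -/
theorem maurerCartan (hU : IsOpen U) (hB : SmoothMat B U) (hd : ∀ x ∈ U, (B x).det = 1)
    (hx : x ∈ U) :
    pdMat 0 (mc B 1) x - pdMat 1 (mc B 0) x = mc B 1 x * mc B 0 x - mc B 0 x * mc B 1 x := by
  have hadj : ∀ i, pdMat i (fun y => (B y).adjugate) x = -(mc B i x * (B x).adjugate) := by
    intro i
    have h := pdMat_congr (i := i) hU hx (fun y hy => adj_mul (hd y hy))
    rw [pdMat_mul hU hx hB.adjugate hB, pdMat_const] at h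
    have h2 := congrArg (· * (B x).adjugate) h
    simp only [add_mul, mul_assoc, zero_mul] at h2
    rw [mul_adj (hd x hx), mul_one] at h2
    rw [eq_neg_of_add_eq_zero_left h2, mc, mul_assoc]
  have hmc : ∀ i j, pdMat i (mc B j) x =
      -(mc B i x * mc B j x) + (B x).adjugate * pdMat i (pdMat j B) x := by
    intro i j
    rw [show mc B j = fun y => (B y).adjugate * pdMat j B y from rfl,
      pdMat_mul hU hx hB.adjugate (hB.pdMat hU j), hadj, neg_mul, mul_assoc]
  rw [hmc, hmc, pdMat_comm hU hx hB]
  abel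

theorem trace_mc (hU : IsOpen U) (hB : SmoothMat B U) {c : ℝ} (hd : ∀ x ∈ U, (B x).det = c)
    (hx : x ∈ U) : mc B i x 1 1 = -mc B i x 0 0 := by
  have hb := fun k l => diffAt hU hx (hB k l)
  have h := pd_congr (i := i) hU hx (fun y hy => (Matrix.det_fin_two (B y)).symm.trans (hd y hy))
  rw [pd_sub ((hb 0 0).fun_mul (hb 1 1)) ((hb 0 1).fun_mul (hb 1 0)), pd_mul (hb 0 0) (hb 1 1),
    pd_mul (hb 0 1) (hb 1 0), pd_const] at h
  simp [mc, pdMat, Matrix.mul_apply, Matrix.adjugate_fin_two, Fin.sum_univ_two]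
  linarith

theorem mc_mul (hU : IsOpen U) (hx : x ∈ U) (hA : SmoothMat A U) (hB : SmoothMat B U)
    (hd : (A x).det = 1) :
    mc (fun y => A y * B y) i x = (B x).adjugate * mc A i x * B x + mc B i x := by
  rw [mc, pdMat_mul hU hx hA hB, Matrix.adjugate_mul_distrib, mul_add, mc, mc]
  have h := adj_mul hd
  calc _ = (B x).adjugate * ((A x).adjugate * pdMat i A x) * B x +
        (B x).adjugate * ((A x).adjugate * A x) * pdMat i B x := by simp only [mul_assoc]
    _ = _ := by rw [h, mul_one]

/-- The entries of the Maurer–Cartan equation. -/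
theorem maurerCartan_entries (hU : IsOpen U) (hB : SmoothMat B U) (hd : ∀ x ∈ U, (B x).det = 1)
    (hx : x ∈ U) :
    pd 0 (fun y => mc B 1 y 0 0) x - pd 1 (fun y => mc B 0 y 0 0) x =
      -(mc B 0 x 0 1 * mc B 1 x 1 0 - mc B 1 x 0 1 * mc B 0 x 1 0) ∧
    pd 0 (fun y => mc B 1 y 0 1) x - pd 1 (fun y => mc B 0 y 0 1) x =
      -2 * (mc B 0 x 0 0 * mc B 1 x 0 1 - mc B 1 x 0 0 * mc B 0 x 0 1) ∧
    pd 0 (fun y => mc B 1 y 1 0) x - pd 1 (fun y => mc B 0 y 1 0) x =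
      2 * (mc B 0 x 0 0 * mc B 1 x 1 0 - mc B 1 x 0 0 * mc B 0 x 1 0) := by
  have h := fun k l => congrFun (congrFun (maurerCartan hU hB hd hx) k) l
  have t := fun i => trace_mc (i := i) hU hB hd hx
  simp only [Matrix.sub_apply, Matrix.mul_apply, Fin.sum_univ_two] at h
  refine ⟨(h 0 0).trans ?_, (h 0 1).trans ?_, (h 1 0).trans ?_⟩
  · ring
  · linear_combination mc B 1 x 0 1 * t 0 - mc B 0 x 0 1 * t 1
  · linear_combination mc B 0 x 1 0 * t 1 - mc B 1 x 1 0 * t 0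

end

/-! ### Adapted lifts of maps into `M₂(ℝ)` -/

/-- The matrix `diag(ε, 1)`. -/
def sgnMat (ε : ℝ) : Mat2 := !![ε, 0; 0, 1]

/-- The polarization of the quadratic form `-det`. -/
def negDet (X Y : Mat2) : ℝ :=
  -(1 / 2) * (X 0 0 * Y 1 1 + X 1 1 * Y 0 0 - X 0 1 * Y 1 0 - X 1 0 * Y 0 1)

theorem negDet_mul_mul (P Q X Y : Mat2) :
    negDet (P * X * Q) (P * Y * Q) = P.det * Q.det * negDet X Y := by
  simp only [negDet, Matrix.mul_apply, Fin.sum_univ_two, Matrix.det_fin_two]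
  ring

/-- The first null form of the pair `(B₁, B₂)`: the upper right entry of
`B₁⁻¹ dB₁ J + J (B₂⁻¹ dB₂)ᵀ` for `J = diag(ε, 1)`. -/
def nullForm₁ (ε : ℝ) (B₁ B₂ : LNum → Mat2) (i : Fin 2) (x : LNum) : ℝ :=
  mc B₁ i x 0 1 + ε * mc B₂ i x 1 0

/-- The second null form of the pair `(B₁, B₂)`: the lower left entry of
`B₁⁻¹ dB₁ J + J (B₂⁻¹ dB₂)ᵀ` for `J = diag(ε, 1)`. -/
def nullForm₂ (ε : ℝ) (B₁ B₂ : LNum → Mat2) (i : Fin 2) (x : LNum) : ℝ :=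
  mc B₂ i x 0 1 + ε * mc B₁ i x 1 0

/-- The area form of the two null forms. -/
def nullArea (ε : ℝ) (B₁ B₂ : LNum → Mat2) (x : LNum) : ℝ :=
  nullForm₁ ε B₁ B₂ 0 x * nullForm₂ ε B₁ B₂ 1 x - nullForm₁ ε B₁ B₂ 1 x * nullForm₂ ε B₁ B₂ 0 x

/-- The matrix of coefficients of the pull back of `-det` by a map into the real matrices. -/
def pullback (F : LNum → Mat2) (x : LNum) : Mat2 :=
  Matrix.of fun i j => negDet (pdMat i F x) (pdMat j F x)

/-- A pair of maps into `SL₂(ℝ)` is adapted if the diagonal of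
`B₁⁻¹ dB₁ J + J (B₂⁻¹ dB₂)ᵀ` vanishes. Equivalently `B₁ diag(-ε, 1) B₂ᵀ` is normal to the map
`B₁ diag(ε, 1) B₂ᵀ`. -/
structure IsAdapted (B₁ B₂ : LNum → Mat2) (U : Set LNum) : Prop where
  smooth₁ : SmoothMat B₁ U
  smooth₂ : SmoothMat B₂ U
  det₁ : ∀ x ∈ U, (B₁ x).det = 1
  det₂ : ∀ x ∈ U, (B₂ x).det = 1
  diag : ∀ x ∈ U, ∀ i, mc B₁ i x 0 0 + mc B₂ i x 0 0 = 0

/-- A map into `SL₂(ℝ)` is horizontal if the diagonal of its Maurer–Cartan form vanishes. -/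
structure IsHorizontal (B : LNum → Mat2) (U : Set LNum) : Prop where
  smooth : SmoothMat B U
  det : ∀ x ∈ U, (B x).det = 1
  diag : ∀ x ∈ U, ∀ i, mc B i x 0 0 = 0

section

variable {ε : ℝ} {B B₁ B₂ F : LNum → Mat2} {U V : Set LNum} {x : LNum}

theorem IsHorizontal.isAdapted (h₁ : IsHorizontal B₁ U) (h₂ : IsHorizontal B₂ U) :
    IsAdapted B₁ B₂ U :=
  ⟨h₁.smooth, h₂.smooth, h₁.det, h₂.det, fun x hx i => by
    rw [h₁.diag x hx, h₂.diag x hx, add_zero]⟩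

theorem IsAdapted.mono (h : IsAdapted B₁ B₂ U) (hV : V ⊆ U) : IsAdapted B₁ B₂ V :=
  ⟨h.smooth₁.mono hV, h.smooth₂.mono hV, fun x hx => h.det₁ x (hV hx),
    fun x hx => h.det₂ x (hV hx), fun x hx => h.diag x (hV hx)⟩

theorem contDiffOn_nullForm₁ (hU : IsOpen U) (h₁ : SmoothMat B₁ U) (h₂ : SmoothMat B₂ U)
    (i : Fin 2) : ContDiffOn ℝ ∞ (nullForm₁ ε B₁ B₂ i) U :=
  (h₁.mc hU i 0 1).add (contDiffOn_const.mul (h₂.mc hU i 1 0))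

theorem contDiffOn_nullForm₂ (hU : IsOpen U) (h₁ : SmoothMat B₁ U) (h₂ : SmoothMat B₂ U)
    (i : Fin 2) : ContDiffOn ℝ ∞ (nullForm₂ ε B₁ B₂ i) U :=
  (h₂.mc hU i 0 1).add (contDiffOn_const.mul (h₁.mc hU i 1 0))

theorem pdMat_product (hU : IsOpen U) (hx : x ∈ U) (h₁ : SmoothMat B₁ U) (h₂ : SmoothMat B₂ U)
    (d₁ : (B₁ x).det = 1) (d₂ : (B₂ x).det = 1) (i : Fin 2) :
    pdMat i (fun y => B₁ y * sgnMat ε * (B₂ y)ᵀ) x =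
      B₁ x * (mc B₁ i x * sgnMat ε + sgnMat ε * (mc B₂ i x)ᵀ) * (B₂ x)ᵀ := by
  rw [pdMat_mul hU hx (h₁.mul (smoothMat_const _)) h₂.transpose,
    pdMat_mul hU hx h₁ (smoothMat_const _), pdMat_const, pdMat_transpose, pdMat_eq_mul_mc d₁,
    pdMat_eq_mul_mc d₂, Matrix.transpose_mul]
  simp only [mul_zero, add_zero, mul_add, add_mul, mul_assoc]

theorem IsAdapted.pdMat_product (hU : IsOpen U) (h : IsAdapted B₁ B₂ U) (hx : x ∈ U) (i : Fin 2) :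
    pdMat i (fun y => B₁ y * sgnMat ε * (B₂ y)ᵀ) x =
      B₁ x * !![0, nullForm₁ ε B₁ B₂ i x; nullForm₂ ε B₁ B₂ i x, 0] * (B₂ x)ᵀ := by
  rw [LorentzSurf.pdMat_product hU hx h.smooth₁ h.smooth₂ (h.det₁ x hx) (h.det₂ x hx)]
  congr 2
  have t₁ := trace_mc (i := i) hU h.smooth₁ h.det₁ hx
  have t₂ := trace_mc (i := i) hU h.smooth₂ h.det₂ hx
  have hd := h.diag x hx i
  ext k l
  fin_cases k <;> fin_cases l <;>
    simp [sgnMat, Matrix.mul_apply, Fin.sum_univ_two, nullForm₁, nullForm₂, Matrix.vecMul,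
      dotProduct]
  · linear_combination ε * hd
  · ring
  · linear_combination t₁ + t₂ - hd

theorem IsAdapted.pullback_eq (hU : IsOpen U) (h : IsAdapted B₁ B₂ U)
    (hF : ∀ x ∈ U, F x = B₁ x * sgnMat ε * (B₂ x)ᵀ) (hx : x ∈ U) :
    pullback F x = nullMetric (nullForm₁ ε B₁ B₂) (nullForm₂ ε B₁ B₂) x := by
  ext i j
  simp only [pullback, Matrix.of_apply]
  rw [pdMat_congr hU hx hF, pdMat_congr hU hx hF, h.pdMat_product hU hx, h.pdMat_product hU hx,
    negDet_mul_mul, h.det₁ x hx, Matrix.det_transpose, h.det₂ x hx]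
  simp [negDet, nullMetric]
  ring

theorem IsAdapted.d_nullForm (hU : IsOpen U) (h : IsAdapted B₁ B₂ U) (hx : x ∈ U) :
    pd 0 (nullForm₁ ε B₁ B₂ 1) x - pd 1 (nullForm₁ ε B₁ B₂ 0) x =
      -2 * (mc B₁ 0 x 0 0 * nullForm₁ ε B₁ B₂ 1 x - mc B₁ 1 x 0 0 * nullForm₁ ε B₁ B₂ 0 x) ∧
    pd 0 (nullForm₂ ε B₁ B₂ 1) x - pd 1 (nullForm₂ ε B₁ B₂ 0) x =
      2 * (mc B₁ 0 x 0 0 * nullForm₂ ε B₁ B₂ 1 x - mc B₁ 1 x 0 0 * nullForm₂ ε B₁ B₂ 0 x) := by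
  have d₁ := fun i k l => diffAt hU hx (h.smooth₁.mc hU i k l)
  have d₂ := fun i k l => diffAt hU hx (h.smooth₂.mc hU i k l)
  obtain ⟨-, a₁, b₁⟩ := maurerCartan_entries hU h.smooth₁ h.det₁ hx
  obtain ⟨-, a₂, b₂⟩ := maurerCartan_entries hU h.smooth₂ h.det₂ hx
  have l := h.diag x hx
  have e₁ : ∀ i j, pd i (nullForm₁ ε B₁ B₂ j) x =
      pd i (fun y => mc B₁ j y 0 1) x + ε * pd i (fun y => mc B₂ j y 1 0) x := fun i j => by
    rw [show nullForm₁ ε B₁ B₂ j = fun y => mc B₁ j y 0 1 + ε * mc B₂ j y 1 0 from rfl,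
      pd_add (d₁ j 0 1) ((d₂ j 1 0).const_mul ε), pd_const_mul ε (d₂ j 1 0)]
  have e₂ : ∀ i j, pd i (nullForm₂ ε B₁ B₂ j) x =
      pd i (fun y => mc B₂ j y 0 1) x + ε * pd i (fun y => mc B₁ j y 1 0) x := fun i j => by
    rw [show nullForm₂ ε B₁ B₂ j = fun y => mc B₂ j y 0 1 + ε * mc B₁ j y 1 0 from rfl,
      pd_add (d₂ j 0 1) ((d₁ j 1 0).const_mul ε), pd_const_mul ε (d₁ j 1 0)]
  rw [e₁, e₁, e₂, e₂]
  simp only [nullForm₁, nullForm₂]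
  constructor
  · linear_combination a₁ + ε * b₂ + 2 * ε * mc B₂ 1 x 1 0 * l 0 - 2 * ε * mc B₂ 0 x 1 0 * l 1
  · linear_combination a₂ + ε * b₁ - 2 * mc B₂ 1 x 0 1 * l 0 + 2 * mc B₂ 0 x 0 1 * l 1

/-- The metric induced by a product of horizontal maps is flat. -/
theorem riemann_product_eq_zero (hU : IsOpen U) (h₁ : IsHorizontal B₁ U) (h₂ : IsHorizontal B₂ U)
    {G : LNum → Mat2} (hG : ∀ x ∈ U, G x = pullback (fun y => B₁ y * sgnMat ε * (B₂ y)ᵀ) x)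
    (hA : ∀ x ∈ U, nullArea ε B₁ B₂ x ≠ 0) (hx : x ∈ U) (l k i j : Fin 2) :
    riemann G l k i j x = 0 := by
  have h := h₁.isAdapted h₂
  refine riemann_eq_zero_of_closed hU (contDiffOn_nullForm₁ (ε := ε) hU h.smooth₁ h.smooth₂)
    (contDiffOn_nullForm₂ (ε := ε) hU h.smooth₁ h.smooth₂) hA (fun y hy => ?_) (fun y hy => ?_)
    (fun y hy => ?_) hx l k i j
  · have := (h.d_nullForm (ε := ε) hU hy).1
    rw [h₁.diag y hy, h₁.diag y hy] at this
    linarith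
  · have := (h.d_nullForm (ε := ε) hU hy).2
    rw [h₁.diag y hy, h₁.diag y hy] at this
    linarith
  · rw [hG y hy, h.pullback_eq hU (fun _ _ => rfl) hy]

end

/-! ### Local existence of horizontal lifts -/

section

variable {ε : ℝ} {B B₁ B₂ C₁ C₂ F n : LNum → Mat2} {U V : Set LNum} {x x₀ : LNum}

theorem isOpen_inter_ne {f : LNum → ℝ} (hU : IsOpen U) (hf : ContDiffOn ℝ ∞ f U) (c : ℝ) :
    IsOpen (U ∩ {x | f x ≠ c}) :=
  hf.continuousOn.isOpen_inter_preimage hU isOpen_ne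

/-- A smooth field of traceless matrices of square `1` is locally smoothly conjugate to the
constant `diag(1, -1)`. -/
theorem exists_smooth_diagonalization (hU : IsOpen U) (hn : SmoothMat n U)
    (ht : ∀ x ∈ U, n x 1 1 = -n x 0 0)
    (hd : ∀ x ∈ U, n x 0 0 * n x 0 0 + n x 0 1 * n x 1 0 = 1) (hx₀ : x₀ ∈ U) :
    ∃ V, IsOpen V ∧ x₀ ∈ V ∧ V ⊆ U ∧ ∃ C : LNum → Mat2, SmoothMat C V ∧
      (∀ x ∈ V, (C x).det = 1) ∧ ∀ x ∈ V, n x = C x * !![1, 0; 0, -1] * (C x).adjugate := by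
  -- the columns of `C` are columns of `1 + n` and `1 - n`; which ones depends on `x₀`
  by_cases h : n x₀ 0 0 = -1
  · have hs := fun k l => (hn k l).mono (Set.inter_subset_left : U ∩ {x | n x 0 0 ≠ 1} ⊆ U)
    have hne : ∀ x ∈ U ∩ {x | n x 0 0 ≠ 1}, 1 - n x 0 0 ≠ 0 := fun x hx h0 => hx.2 (by linarith)
    refine ⟨U ∩ {x | n x 0 0 ≠ 1}, isOpen_inter_ne hU (hn 0 0) 1, ⟨hx₀, ?_⟩,
      Set.inter_subset_left, fun x => !![-n x 0 1 / (2 * (1 - n x 0 0)), 1 - n x 0 0;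
        -(1 / 2), -n x 1 0], ?_, ?_, ?_⟩
    · simp [h]; norm_num
    · intro k l
      fin_cases k <;> fin_cases l
      · exact (hs 0 1).neg.div (contDiffOn_const.mul (contDiffOn_const.sub (hs 0 0)))
          fun x hx => mul_ne_zero two_ne_zero (hne x hx)
      · exact contDiffOn_const.sub (hs 0 0)
      · exact contDiffOn_const
      · exact (hs 1 0).neg
    · intro x hx
      have := hne x hx
      rw [Matrix.det_fin_two]
      simp
      field_simp
      linear_combination hd x hx.1
    · intro x hx
      have := hne x hx
      have h1 := hd x hx.1
      have h2 := ht x hx.1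
      rw [Matrix.adjugate_fin_two]
      ext k l
      fin_cases k <;> fin_cases l <;> simp [h2] <;> field_simp
      · linear_combination -h1
      · ring
      · ring
      · linear_combination h1
  · have hs := fun k l => (hn k l).mono (Set.inter_subset_left : U ∩ {x | n x 0 0 ≠ -1} ⊆ U)
    have hne : ∀ x ∈ U ∩ {x | n x 0 0 ≠ -1}, 1 + n x 0 0 ≠ 0 := fun x hx h0 => hx.2 (by linarith)
    refine ⟨U ∩ {x | n x 0 0 ≠ -1}, isOpen_inter_ne hU (hn 0 0) (-1), ⟨hx₀, h⟩,
      Set.inter_subset_left, fun x => !![1 / 2, -n x 0 1;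
        n x 1 0 / (2 * (1 + n x 0 0)), 1 + n x 0 0], ?_, ?_, ?_⟩
    · intro k l
      fin_cases k <;> fin_cases l
      · exact contDiffOn_const
      · exact (hs 0 1).neg
      · exact (hs 1 0).div (contDiffOn_const.mul (contDiffOn_const.add (hs 0 0)))
          fun x hx => mul_ne_zero two_ne_zero (hne x hx)
      · exact contDiffOn_const.add (hs 0 0)
    · intro x hx
      have := hne x hx
      rw [Matrix.det_fin_two]
      simp
      field_simp
      linear_combination hd x hx.1
    · intro x hx
      have := hne x hx
      have h1 := hd x hx.1
      have h2 := ht x hx.1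
      rw [Matrix.adjugate_fin_two]
      ext k l
      fin_cases k <;> fin_cases l <;> simp [h2] <;> field_simp
      · linear_combination h1
      · ring
      · ring
      · linear_combination -h1

/-- The unit normal of a surface with Lorentzian first fundamental form in
`{det = ε} ⊆ M₂(ℝ)`, translated to the Lie algebra `𝔰𝔩₂`. -/
theorem exists_normal (hε : ε * ε = 1) (hU : IsOpen U) (hF : SmoothMat F U)
    (hdet : ∀ x ∈ U, (F x).det = ε) (hG : ∀ x ∈ U, (pullback F x).det < 0) :
    ∃ n : LNum → Mat2, SmoothMat n U ∧ (∀ x ∈ U, n x 1 1 = -n x 0 0) ∧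
      (∀ x ∈ U, n x 0 0 * n x 0 0 + n x 0 1 * n x 1 0 = 1) ∧
      ∀ x ∈ U, ∀ i, 2 * n x 0 0 * mc F i x 0 0 + n x 0 1 * mc F i x 1 0 +
        n x 1 0 * mc F i x 0 1 = 0 := by
  -- the commutator is the cross product of `𝔰𝔩₂`
  let n₀ : LNum → Mat2 := fun x => mc F 0 x * mc F 1 x - mc F 1 x * mc F 0 x
  let D : LNum → ℝ := fun x => n₀ x 0 0 * n₀ x 0 0 + n₀ x 0 1 * n₀ x 1 0
  have t := fun x hx i => trace_mc (i := i) hU hF hdet (x := x) hx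
  have hn₀ : SmoothMat n₀ U := fun k l =>
    (((hF.mc hU 0).mul (hF.mc hU 1)) k l).sub (((hF.mc hU 1).mul (hF.mc hU 0)) k l)
  have entries : ∀ x ∈ U, n₀ x 0 0 = mc F 0 x 0 1 * mc F 1 x 1 0 - mc F 1 x 0 1 * mc F 0 x 1 0 ∧
      n₀ x 0 1 = 2 * (mc F 0 x 0 0 * mc F 1 x 0 1 - mc F 1 x 0 0 * mc F 0 x 0 1) ∧
      n₀ x 1 0 = 2 * (mc F 0 x 1 0 * mc F 1 x 0 0 - mc F 1 x 1 0 * mc F 0 x 0 0) ∧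
      n₀ x 1 1 = -(mc F 0 x 0 1 * mc F 1 x 1 0 - mc F 1 x 0 1 * mc F 0 x 1 0) := by
    intro x hx
    simp only [n₀, Matrix.sub_apply, Matrix.mul_apply, Fin.sum_univ_two, t x hx]
    refine ⟨?_, ?_, ?_, ?_⟩ <;> ring
  have hD : ∀ x ∈ U, 0 < D x := by
    intro x hx
    have hg : ∀ i j, negDet (mc F i x) (mc F j x) = ε * pullback F x i j := by
      intro i j
      have h := negDet_mul_mul (F x).adjugate 1 (pdMat i F x) (pdMat j F x)
      rw [mul_one, mul_one, Matrix.det_one, mul_one] at h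
      rw [mc, mc, h, Matrix.det_adjugate, hdet x hx]
      simp [pullback]
    have h := hG x hx
    rw [Matrix.det_fin_two] at h
    obtain ⟨e1, e2, e3, -⟩ := entries x hx
    have h4 : D x = -4 * (negDet (mc F 0 x) (mc F 0 x) * negDet (mc F 1 x) (mc F 1 x) -
        negDet (mc F 0 x) (mc F 1 x) * negDet (mc F 1 x) (mc F 0 x)) := by
      simp only [D, e1, e2, e3, negDet, t x hx]
      ring
    have h5 : D x = -4 * (pullback F x 0 0 * pullback F x 1 1 -
        pullback F x 0 1 * pullback F x 1 0) := by
      rw [h4]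
      simp only [hg]
      linear_combination (-4 * (pullback F x 0 0 * pullback F x 1 1 -
        pullback F x 0 1 * pullback F x 1 0)) * hε
    linarith
  have hDs : ContDiffOn ℝ ∞ D U := ((hn₀ 0 0).mul (hn₀ 0 0)).add ((hn₀ 0 1).mul (hn₀ 1 0))
  have hsq : ContDiffOn ℝ ∞ (fun x => Real.sqrt (D x)) U :=
    hDs.sqrt fun x hx => (hD x hx).ne'
  have hpos : ∀ x ∈ U, Real.sqrt (D x) ≠ 0 := fun x hx => (Real.sqrt_pos.mpr (hD x hx)).ne'
  refine ⟨fun x => Matrix.of fun k l => n₀ x k l / Real.sqrt (D x),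
    fun k l => (hn₀ k l).div hsq hpos, ?_, ?_, ?_⟩
  · intro x hx
    obtain ⟨e1, -, -, e4⟩ := entries x hx
    simp only [Matrix.of_apply, e1, e4]
    ring
  · intro x hx
    simp only [Matrix.of_apply, div_mul_div_comm, ← add_div]
    rw [Real.mul_self_sqrt (hD x hx).le]
    exact div_self (hD x hx).ne'
  · intro x hx i
    obtain ⟨e1, e2, e3, -⟩ := entries x hx
    simp only [Matrix.of_apply, e1, e2, e3]
    fin_cases i <;> simp <;> ring

theorem sgnMat_mul_self (hε : ε * ε = 1) : sgnMat ε * sgnMat ε = 1 := by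
  ext i j
  fin_cases i <;> fin_cases j <;> simp [sgnMat, hε]

theorem det_sgnMat : (sgnMat ε).det = ε := by simp [sgnMat, Matrix.det_fin_two]

/-- A surface with Lorentzian first fundamental form in `{det = ε}` has local adapted lifts. -/
theorem exists_adapted (hε : ε * ε = 1) (hU : IsOpen U) (hF : SmoothMat F U)
    (hdet : ∀ x ∈ U, (F x).det = ε) (hG : ∀ x ∈ U, (pullback F x).det < 0) (hx₀ : x₀ ∈ U) :
    ∃ V, IsOpen V ∧ x₀ ∈ V ∧ V ⊆ U ∧ ∃ B₁ B₂ : LNum → Mat2, IsAdapted B₁ B₂ V ∧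
      ∀ x ∈ V, F x = B₁ x * sgnMat ε * (B₂ x)ᵀ := by
  obtain ⟨n, hn, ht, hd, ho⟩ := exists_normal hε hU hF hdet hG
  obtain ⟨V, hV, hxV, hVU, C, hC, hC1, hCn⟩ := exists_smooth_diagonalization hU hn ht hd hx₀
  have hε0 : ε ≠ 0 := fun h => by simp [h] at hε
  have s₁ : SmoothMat (fun x => F x * C x * sgnMat ε) V :=
    ((hF.mono hVU).mul hC).mul (smoothMat_const _)
  have s₂ : SmoothMat (fun x => (C x).adjugateᵀ) V := hC.adjugate.transpose
  have d₁ : ∀ x ∈ V, (F x * C x * sgnMat ε).det = 1 := fun x hx => by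
    rw [Matrix.det_mul, Matrix.det_mul, hdet x (hVU hx), hC1 x hx, det_sgnMat, mul_one, hε]
  have d₂ : ∀ x ∈ V, ((C x).adjugateᵀ).det = 1 := fun x hx => by
    rw [Matrix.det_transpose, Matrix.det_adjugate, hC1 x hx, one_pow]
  have hprod : ∀ x ∈ V, F x = F x * C x * sgnMat ε * sgnMat ε * ((C x).adjugateᵀ)ᵀ := by
    intro x hx
    rw [mul_assoc (F x * C x), sgnMat_mul_self hε, mul_one, Matrix.transpose_transpose, mul_assoc,
      mul_adj (hC1 x hx), mul_one]
  refine ⟨V, hV, hxV, hVU, _, _, ⟨s₁, s₂, d₁, d₂, fun x hx i => ?_⟩, hprod⟩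
  have h := pdMat_product (ε := ε) hV hx s₁ s₂ (d₁ x hx) (d₂ x hx) i
  rw [← pdMat_congr (i := i) hV hx hprod, Matrix.transpose_transpose] at h
  have h2 : (sgnMat ε).adjugate * ((C x).adjugate * mc F i x * C x) =
      mc (fun x => F x * C x * sgnMat ε) i x * sgnMat ε +
        sgnMat ε * (mc (fun x => (C x).adjugateᵀ) i x)ᵀ := by
    have h3 := congrArg (fun X => (F x * C x * sgnMat ε).adjugate * X * C x) h
    rw [← mul_assoc, ← mul_assoc (F x * C x * sgnMat ε).adjugate, adj_mul (d₁ x hx), one_mul,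
      mul_assoc _ (C x).adjugate, adj_mul (hC1 x hx), mul_one] at h3
    rw [← h3, Matrix.adjugate_mul_distrib, Matrix.adjugate_mul_distrib, mc]
    simp only [mul_assoc]
  have h4 := congrFun (congrFun h2 0) 0
  have h5 : ((C x).adjugate * mc F i x * C x) 0 0 = 0 := by
    have e := ho x (hVU hx) i
    have t := trace_mc (i := i) hU hF hdet (hVU hx)
    rw [hCn x hx] at e
    simp [Matrix.mul_apply, Matrix.adjugate_fin_two, Fin.sum_univ_two, Matrix.vecMul,
      dotProduct] at e ⊢
    rw [t]
    have e1 := hC1 x hx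
    rw [Matrix.det_fin_two] at e1
    linear_combination 1 / 2 * e
  rw [Matrix.add_apply, Matrix.mul_apply, Matrix.mul_apply, Matrix.mul_apply, Fin.sum_univ_two,
    Fin.sum_univ_two, Fin.sum_univ_two, h5, Matrix.adjugate_fin_two] at h4
  simp [sgnMat] at h4
  have h6 : ε * (mc (fun x => F x * C x * !![ε, 0; 0, 1]) i x 0 0 +
      mc (fun x => (C x).adjugateᵀ) i x 0 0) = 0 := by linarith
  exact (mul_eq_zero.mp h6).resolve_left hε0

theorem pd_exp {f : LNum → ℝ} (hf : DifferentiableAt ℝ f x) (i : Fin 2) :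
    pd i (fun y => Real.exp (f y)) x = Real.exp (f x) * pd i f x := by
  simp [pd, fderiv_exp hf]

/-- The diagonal matrix `diag(e^f, e^{-f})`. -/
def expDiag (f : LNum → ℝ) (x : LNum) : Mat2 := !![Real.exp (f x), 0; 0, Real.exp (-f x)]

theorem smoothMat_expDiag {f : LNum → ℝ} (hf : ContDiffOn ℝ ∞ f U) : SmoothMat (expDiag f) U := by
  intro k l
  fin_cases k <;> fin_cases l
  · exact hf.exp
  · exact contDiffOn_const
  · exact contDiffOn_const
  · exact hf.neg.exp

theorem det_expDiag (f : LNum → ℝ) (x : LNum) : (expDiag f x).det = 1 := by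
  simp [expDiag, Matrix.det_fin_two, ← Real.exp_add]

/-- Right multiplication by `diag(e^f, e^{-f})` adds `df` to the diagonal entry of the
Maurer–Cartan form. -/
theorem mc_mul_expDiag {f : LNum → ℝ} (hU : IsOpen U) (hB : SmoothMat B U)
    (hd : ∀ x ∈ U, (B x).det = 1) (hf : ContDiffOn ℝ ∞ f U) (hx : x ∈ U) (i : Fin 2) :
    mc (fun y => B y * expDiag f y) i x 0 0 = mc B i x 0 0 + pd i f x := by
  rw [mc_mul hU hx hB (smoothMat_expDiag hf) (hd x hx), Matrix.add_apply]
  have h1 : ((expDiag f x).adjugate * mc B i x * expDiag f x) 0 0 = mc B i x 0 0 := by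
    have : Real.exp (-f x) * Real.exp (f x) = 1 := by simp [← Real.exp_add]
    simp [Matrix.mul_apply, Matrix.adjugate_fin_two, Fin.sum_univ_two, expDiag, Matrix.vecMul,
      dotProduct]
    linear_combination mc B i x 0 0 * this
  have h2 : mc (expDiag f) i x 0 0 = pd i f x := by
    have : Real.exp (-f x) * Real.exp (f x) = 1 := by simp [← Real.exp_add]
    simp [mc, pdMat, Matrix.mul_apply, Matrix.adjugate_fin_two, Fin.sum_univ_two, expDiag,
      pd_exp (diffAt hU hx hf)]
    linear_combination pd i f x * this
  rw [h1, h2]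

theorem det_nullMetric (α β : Fin 2 → LNum → ℝ) (x : LNum) :
    (nullMetric α β x).det = -(1 / 4) * (α 0 x * β 1 x - α 1 x * β 0 x) ^ 2 := by
  simp [Matrix.det_fin_two, nullMetric]
  ring

/-- A flat Lorentzian surface in `{det = ε}` is locally a product of horizontal maps. -/
theorem exists_horizontal (hε : ε * ε = 1) (hU : IsOpen U) (hF : SmoothMat F U)
    (hdet : ∀ x ∈ U, (F x).det = ε) (hG : ∀ x ∈ U, (pullback F x).det < 0)
    {G : LNum → Mat2} (hGF : ∀ x ∈ U, G x = pullback F x)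
    (hR : ∀ x ∈ U, ∀ l k i j, riemann G l k i j x = 0) (hx₀ : x₀ ∈ U) :
    ∃ V, IsOpen V ∧ x₀ ∈ V ∧ V ⊆ U ∧ ∃ B₁ B₂ : LNum → Mat2, IsHorizontal B₁ V ∧
      IsHorizontal B₂ V ∧ (∀ x ∈ V, F x = B₁ x * sgnMat ε * (B₂ x)ᵀ) := by
  obtain ⟨W, hW, hxW, hWU, B₁, B₂, hB, hFB⟩ := exists_adapted hε hU hF hdet hG hx₀
  obtain ⟨r, hr, hball⟩ := Metric.isOpen_iff.mp hW x₀ hxW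
  have hV : IsOpen (Metric.ball x₀ r) := Metric.isOpen_ball
  have hB' := hB.mono hball
  have hm : ∀ x ∈ Metric.ball x₀ r, G x = nullMetric (nullForm₁ ε B₁ B₂) (nullForm₂ ε B₁ B₂) x :=
    fun x hx => by rw [hGF x (hWU (hball hx)), hB.pullback_eq hW hFB (hball hx)]
  have hclosed : ∀ x ∈ Metric.ball x₀ r,
      pd 0 (fun y => mc B₁ 1 y 0 0) x = pd 1 (fun y => mc B₁ 0 y 0 0) x := by
    intro x hx
    refine closed_of_riemann_eq_zero (lam := fun i y => mc B₁ i y 0 0) hV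
      (contDiffOn_nullForm₁ (ε := ε) hV hB'.smooth₁ hB'.smooth₂)
      (contDiffOn_nullForm₂ (ε := ε) hV hB'.smooth₁ hB'.smooth₂)
      (fun i => hB'.smooth₁.mc hV i 0 0) (fun y hy h0 => ?_)
      (fun y hy => (hB'.d_nullForm hV hy).1) (fun y hy => (hB'.d_nullForm hV hy).2) hm hx
      (hR x (hWU (hball hx)))
    have h := hG y (hWU (hball hy))
    rw [hB.pullback_eq hW hFB (hball hy), det_nullMetric, h0] at h
    simp at h
  obtain ⟨f, hf, hfd⟩ := exists_primitive hV (convex_ball x₀ r)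
    (hB'.smooth₁.mc hV 0 0 0).neg (hB'.smooth₁.mc hV 1 0 0).neg
    (fun x hx => by
      show pd 0 (fun y => -mc B₁ 1 y 0 0) x = pd 1 (fun y => -mc B₁ 0 y 0 0) x
      rw [pd_neg, pd_neg, hclosed x hx])
  have hfd' : ∀ x ∈ Metric.ball x₀ r, ∀ i, pd i f x = -mc B₁ i x 0 0 := by
    intro x hx i
    fin_cases i
    · exact (hfd x hx).1
    · exact (hfd x hx).2
  refine ⟨Metric.ball x₀ r, hV, Metric.mem_ball_self hr, hball.trans hWU,
    fun x => B₁ x * expDiag f x, fun x => B₂ x * expDiag (fun y => -f y) x,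
    ⟨hB'.smooth₁.mul (smoothMat_expDiag hf), fun x hx => ?_, fun x hx i => ?_⟩,
    ⟨hB'.smooth₂.mul (smoothMat_expDiag hf.neg), fun x hx => ?_, fun x hx i => ?_⟩,
    fun x hx => ?_⟩
  · rw [Matrix.det_mul, hB'.det₁ x hx, det_expDiag, mul_one]
  · rw [mc_mul_expDiag hV hB'.smooth₁ hB'.det₁ hf hx, hfd' x hx, add_neg_cancel]
  · rw [Matrix.det_mul, hB'.det₂ x hx, det_expDiag, mul_one]
  · rw [mc_mul_expDiag hV hB'.smooth₂ hB'.det₂ hf.neg hx, pd_neg, hfd' x hx, neg_neg, add_comm,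
      hB'.diag x hx]
  · have hE : expDiag f x * sgnMat ε * (expDiag (fun y => -f y) x)ᵀ = sgnMat ε := by
      have h1 : Real.exp (f x) * Real.exp (-f x) = 1 := by simp [← Real.exp_add]
      ext k l
      fin_cases k <;> fin_cases l <;>
        simp [expDiag, sgnMat, Matrix.mul_apply, Fin.sum_univ_two]
      · linear_combination ε * h1
      · linear_combination h1
    rw [hFB x (hball hx), Matrix.transpose_mul]
    calc B₁ x * sgnMat ε * (B₂ x)ᵀ
        = B₁ x * (expDiag f x * sgnMat ε * (expDiag (fun y => -f y) x)ᵀ) * (B₂ x)ᵀ := by rw [hE]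
      _ = _ := by simp only [mul_assoc]

/-! ### Uniqueness of horizontal lifts -/

theorem eq_of_offDiag_conj {a b c d : ℝ} (hdet : a * d - b * c = 1) (h₁ : c * d = 0)
    (h₂ : a * b = 0) : (b = 0 ∧ c = 0) ∨ (a = 0 ∧ d = 0) := by
  rcases mul_eq_zero.mp h₁ with hc | hd
  · left
    refine ⟨(mul_eq_zero.mp h₂).resolve_left fun ha => ?_, hc⟩
    simp [ha, hc] at hdet
  · right
    refine ⟨(mul_eq_zero.mp h₂).resolve_right fun hb => ?_, hd⟩
    simp [hb, hd] at hdet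

/-- The matrices which are diagonal or antidiagonal. -/
def IsMonomial (g : Mat2) : Prop := (g 0 1 = 0 ∧ g 1 0 = 0) ∨ (g 0 0 = 0 ∧ g 1 1 = 0)

/-- Two horizontal factorizations of the same surface differ by a locally constant map into the
normalizer of the diagonal subgroup. -/
theorem horizontal_unique (hε : ε * ε = 1) (hU : IsOpen U) (h₁ : IsHorizontal B₁ U)
    (h₂ : IsHorizontal B₂ U) (k₁ : IsHorizontal C₁ U) (k₂ : IsHorizontal C₂ U)
    (hA : ∀ x ∈ U, nullArea ε B₁ B₂ x ≠ 0)
    (heq : ∀ x ∈ U, B₁ x * sgnMat ε * (B₂ x)ᵀ = C₁ x * sgnMat ε * (C₂ x)ᵀ) :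
    (∀ x ∈ U, IsMonomial ((B₁ x).adjugate * C₁ x)) ∧
      ∀ x ∈ U, ∀ i, pdMat i (fun y => (B₁ y).adjugate * C₁ y) x = 0 := by
  obtain ⟨g, hgdef⟩ : ∃ g : LNum → Mat2, ∀ y, g y = (B₁ y).adjugate * C₁ y := ⟨_, fun _ => rfl⟩
  simp only [← hgdef]
  have hgs : SmoothMat g U := by
    have := h₁.smooth.adjugate.mul k₁.smooth
    simpa only [← hgdef] using this
  have hg : ∀ x ∈ U, C₁ x = B₁ x * g x := fun x hx => by
    rw [hgdef, ← mul_assoc, mul_adj (h₁.det x hx), one_mul]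
  have hgd : ∀ x ∈ U, (g x).det = 1 := fun x hx => by
    rw [hgdef, Matrix.det_mul, Matrix.det_adjugate, h₁.det x hx, k₁.det x hx]; simp
  let N : Fin 2 → LNum → Mat2 := fun i x =>
    !![0, nullForm₁ ε B₁ B₂ i x; nullForm₂ ε B₁ B₂ i x, 0]
  let N' : Fin 2 → LNum → Mat2 := fun i x =>
    !![0, nullForm₁ ε C₁ C₂ i x; nullForm₂ ε C₁ C₂ i x, 0]
  have hconj : ∀ x ∈ U, ∀ i, (g x).adjugate * (N i x * sgnMat ε) * g x = N' i x * sgnMat ε := by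
    intro x hx i
    have e := pdMat_congr (i := i) hU hx heq
    rw [(h₁.isAdapted h₂).pdMat_product hU hx, (k₁.isAdapted k₂).pdMat_product hU hx] at e
    have h3 : (C₂ x)ᵀ = sgnMat ε * (g x).adjugate * sgnMat ε * (B₂ x)ᵀ := by
      have h4 := heq x hx
      rw [hg x hx] at h4
      have h5 := congrArg (fun X => sgnMat ε * ((g x).adjugate * ((B₁ x).adjugate * X))) h4
      simp only [mul_assoc] at h5
      rw [← mul_assoc (B₁ x).adjugate (B₁ x), ← mul_assoc (B₁ x).adjugate (B₁ x),
        adj_mul (h₁.det x hx), one_mul, one_mul, ← mul_assoc (g x).adjugate (g x),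
        adj_mul (hgd x hx), one_mul, ← mul_assoc (sgnMat ε) (sgnMat ε) (C₂ x)ᵀ,
        sgnMat_mul_self hε, one_mul] at h5
      rw [← h5]
      simp only [mul_assoc]
    have hB2 : (B₂ x)ᵀ * (B₂ x)ᵀ.adjugate = 1 :=
      mul_adj (by rw [Matrix.det_transpose, h₂.det x hx])
    rw [h3, hg x hx] at e
    have e2 := congrArg (fun X => (g x).adjugate * ((B₁ x).adjugate * (X * (B₂ x)ᵀ.adjugate)) *
      sgnMat ε * g x) e
    simp only [mul_assoc] at e2
    rw [← mul_assoc (B₂ x)ᵀ (B₂ x)ᵀ.adjugate, hB2, one_mul,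
      ← mul_assoc (B₁ x).adjugate (B₁ x), ← mul_assoc (B₁ x).adjugate (B₁ x),
      adj_mul (h₁.det x hx), one_mul, one_mul, ← mul_assoc (g x).adjugate (g x),
      adj_mul (hgd x hx), one_mul] at e2
    rw [← mul_assoc (sgnMat ε) (sgnMat ε), sgnMat_mul_self hε, one_mul, adj_mul (hgd x hx),
      mul_one] at e2
    simpa only [mul_assoc] using e2
  have hmon : ∀ x ∈ U, g x 1 0 * g x 1 1 = 0 ∧ g x 0 0 * g x 0 1 = 0 := by
    intro x hx
    have e : ∀ i, nullForm₁ ε B₁ B₂ i x * (g x 1 0 * g x 1 1) -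
        nullForm₂ ε B₁ B₂ i x * ε * (g x 0 0 * g x 0 1) = 0 := by
      intro i
      have e1 := congrFun (congrFun (hconj x hx i) 0) 0
      simp [N, N', sgnMat, Matrix.mul_apply, Matrix.adjugate_fin_two, Fin.sum_univ_two]
        at e1
      linear_combination e1
    have e0 := e 0
    have e1 := e 1
    have hne := hA x hx
    constructor
    · refine (mul_eq_zero.mp ?_).resolve_left hne
      simp only [nullArea]
      linear_combination nullForm₂ ε B₁ B₂ 1 x * e0 - nullForm₂ ε B₁ B₂ 0 x * e1
    · refine (mul_eq_zero.mp ?_).resolve_left hne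
      simp only [nullArea]
      linear_combination ε * nullForm₁ ε B₁ B₂ 1 x * e0 - ε * nullForm₁ ε B₁ B₂ 0 x * e1 -
        (g x 0 0 * g x 0 1) * (nullForm₁ ε B₁ B₂ 0 x * nullForm₂ ε B₁ B₂ 1 x -
          nullForm₁ ε B₁ B₂ 1 x * nullForm₂ ε B₁ B₂ 0 x) * hε
  have hcases : ∀ x ∈ U, IsMonomial (g x) := fun x hx => by
    have := hgd x hx
    rw [Matrix.det_fin_two] at this
    exact eq_of_offDiag_conj this (hmon x hx).1 (hmon x hx).2
  refine ⟨hcases, fun x hx i => ?_⟩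
  have hg' := fun k l => diffAt hU hx (hgs k l)
  have p1 := pd_congr (i := i) hU hx fun y hy => (hmon y hy).1
  have p2 := pd_congr (i := i) hU hx fun y hy => (hmon y hy).2
  rw [pd_mul (hg' 1 0) (hg' 1 1), pd_const] at p1
  rw [pd_mul (hg' 0 0) (hg' 0 1), pd_const] at p2
  have t₁ := trace_mc (i := i) hU h₁.smooth h₁.det hx
  have t₂ := trace_mc (i := i) hU k₁.smooth k₁.det hx
  have l₁ := h₁.diag x hx i
  have l₂ := k₁.diag x hx i
  have hdg : pdMat i g x = g x * mc C₁ i x - mc B₁ i x * g x := by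
    have h3 := mc_mul (i := i) hU hx h₁.smooth hgs (h₁.det x hx)
    have h4 : mc (fun y => B₁ y * g y) i x = mc C₁ i x := by
      rw [mc, mc, ← hg x hx, pdMat_congr hU hx (fun y hy => (hg y hy).symm)]
    rw [h4] at h3
    rw [h3, mul_add, ← mul_assoc, ← mul_assoc, mul_adj (hgd x hx), one_mul,
      ← pdMat_eq_mul_mc (hgd x hx), add_sub_cancel_left]
  have entries := fun k l => congrFun (congrFun hdg k) l
  simp only [Matrix.sub_apply, Matrix.mul_apply, Fin.sum_univ_two] at entries
  have hdet := hgd x hx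
  rw [Matrix.det_fin_two] at hdet
  have q00 := entries 0 0
  have q01 := entries 0 1
  have q10 := entries 1 0
  have q11 := entries 1 1
  rw [t₁, l₁, neg_zero] at q10 q11
  rw [l₁] at q00 q01
  rw [t₂, l₂, neg_zero] at q01 q11
  rw [l₂] at q00 q10
  simp only [pdMat, Matrix.of_apply] at q00 q01 q10 q11
  rcases hcases x hx with ⟨hb, hc⟩ | ⟨ha, hd⟩
  · rw [hb, hc] at hdet q00 q11
    have ha0 : g x 0 0 ≠ 0 := fun h => by simp [h] at hdet
    have hd0 : g x 1 1 ≠ 0 := fun h => by simp [h] at hdet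
    rw [hb, mul_zero, zero_add] at p2
    rw [hc, zero_mul, add_zero] at p1
    ext k l
    fin_cases k <;> fin_cases l
    · simpa [pdMat] using q00
    · exact (mul_eq_zero.mp p2).resolve_left ha0
    · exact (mul_eq_zero.mp p1).resolve_right hd0
    · simpa [pdMat] using q11
  · rw [ha, hd] at hdet q01 q10
    have hb0 : g x 0 1 ≠ 0 := fun h => by simp [h] at hdet
    have hc0 : g x 1 0 ≠ 0 := fun h => by simp [h] at hdet
    rw [ha, zero_mul, add_zero] at p2
    rw [hd, mul_zero, zero_add] at p1
    ext k l
    fin_cases k <;> fin_cases l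
    · exact (mul_eq_zero.mp p2).resolve_right hb0
    · simpa [pdMat] using q01
    · simpa [pdMat] using q10
    · exact (mul_eq_zero.mp p1).resolve_left hc0

end

/-! ### Null coordinates of a pair of horizontal maps -/

section

variable {ε : ℝ} {B B₁ B₂ : LNum → Mat2} {U V : Set LNum} {x x₀ : LNum}

theorem IsHorizontal.wedge_eq_zero (hU : IsOpen U) (h : IsHorizontal B U) (hx : x ∈ U) :
    mc B 0 x 0 1 * mc B 1 x 1 0 - mc B 1 x 0 1 * mc B 0 x 1 0 = 0 := by
  have e := (maurerCartan_entries hU h.smooth h.det hx).1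
  have h0 : ∀ i j, pd i (fun y => mc B j y 0 0) x = 0 := fun i j => by
    rw [pd_congr hU hx (g := fun _ => 0) fun y hy => h.diag y hy j, pd_const]
  rw [h0, h0] at e
  linarith

theorem IsHorizontal.closed (hU : IsOpen U) (h : IsHorizontal B U) (hx : x ∈ U) :
    pd 0 (fun y => mc B 1 y 0 1) x = pd 1 (fun y => mc B 0 y 0 1) x ∧
    pd 0 (fun y => mc B 1 y 1 0) x = pd 1 (fun y => mc B 0 y 1 0) x := by
  have e := (maurerCartan_entries hU h.smooth h.det hx).2
  rw [h.diag x hx, h.diag x hx] at e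
  constructor <;> linarith [e.1, e.2]

/-- A horizontal immersion depends on one function only: its Maurer–Cartan form is a multiple of
the differential of a function `s`. -/
theorem IsHorizontal.exists_parameter (hU : IsOpen U) (h : IsHorizontal B U) (hx₀ : x₀ ∈ U)
    (hne : ∃ i, mc B i x₀ 0 1 ≠ 0 ∨ mc B i x₀ 1 0 ≠ 0) :
    ∃ V, IsOpen V ∧ x₀ ∈ V ∧ V ⊆ U ∧ ∃ s : LNum → ℝ, ContDiffOn ℝ ∞ s V ∧
      (∃ i, pd i s x₀ ≠ 0) ∧
      ∀ x ∈ V, mc B 0 x 0 1 * pd 1 s x - mc B 1 x 0 1 * pd 0 s x = 0 ∧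
        mc B 0 x 1 0 * pd 1 s x - mc B 1 x 1 0 * pd 0 s x = 0 := by
  obtain ⟨r, hr, hball⟩ := Metric.isOpen_iff.mp hU x₀ hx₀
  have hV : IsOpen (Metric.ball x₀ r) := Metric.isOpen_ball
  have hm := fun i k l => (h.smooth.mc hU i k l).mono hball
  obtain ⟨i, hi | hi⟩ := hne
  · obtain ⟨s, hs, hsd⟩ := exists_primitive hV (convex_ball x₀ r) (hm 0 0 1) (hm 1 0 1)
      fun x hx => (h.closed hU (hball hx)).1
    refine ⟨_, hV, Metric.mem_ball_self hr, hball, s, hs, ⟨i, ?_⟩, fun x hx => ?_⟩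
    · obtain ⟨e0, e1⟩ := hsd x₀ (Metric.mem_ball_self hr)
      fin_cases i
      · simpa [e0] using hi
      · simpa [e1] using hi
    · rw [(hsd x hx).1, (hsd x hx).2]
      exact ⟨by ring, by linarith [h.wedge_eq_zero hU (hball hx)]⟩
  · obtain ⟨s, hs, hsd⟩ := exists_primitive hV (convex_ball x₀ r) (hm 0 1 0) (hm 1 1 0)
      fun x hx => (h.closed hU (hball hx)).2
    refine ⟨_, hV, Metric.mem_ball_self hr, hball, s, hs, ⟨i, ?_⟩, fun x hx => ?_⟩
    · obtain ⟨e0, e1⟩ := hsd x₀ (Metric.mem_ball_self hr)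
      fin_cases i
      · simpa [e0] using hi
      · simpa [e1] using hi
    · rw [(hsd x hx).1, (hsd x hx).2]
      exact ⟨by linarith [h.wedge_eq_zero hU (hball hx)], by ring⟩

/-- Multiples of two linearly dependent covectors of the plane are linearly dependent. -/
theorem wedge_mul_eq_zero {a b c d s₀ s₁ t₀ t₁ : ℝ} (h₁ : a * s₁ - b * s₀ = 0)
    (h₂ : c * t₁ - d * t₀ = 0) (hst : s₀ * t₁ - s₁ * t₀ = 0) (hs : s₀ ≠ 0 ∨ s₁ ≠ 0)
    (ht : t₀ ≠ 0 ∨ t₁ ≠ 0) : a * d - b * c = 0 := by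
  rcases hs with hs | hs <;> rcases ht with ht | ht
  · have hb : b = a * s₁ / s₀ := by field_simp; linarith
    have hd : d = c * t₁ / t₀ := by field_simp; linarith
    rw [hb, hd]; field_simp; linear_combination a * c * hst
  · have hb : b = a * s₁ / s₀ := by field_simp; linarith
    have hd : c = d * t₀ / t₁ := by field_simp; linarith
    rw [hb, hd]; field_simp; linear_combination a * d * hst
  · have hb : a = b * s₀ / s₁ := by field_simp; linarith
    have hd : d = c * t₁ / t₀ := by field_simp; linarith
    rw [hb, hd]; field_simp; linear_combination b * c * hst
  · have hb : a = b * s₀ / s₁ := by field_simp; linarith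
    have hd : c = d * t₀ / t₁ := by field_simp; linarith
    rw [hb, hd]; field_simp; linear_combination b * d * hst

/-- Near a point of nonzero null area, `B₁` is a function of `s` and `B₂` is a function of `t` for
independent functions `s` and `t`; the dependence is expressed by the vanishing of `dB₁ ∧ ds` and
`dB₂ ∧ dt`. -/
theorem exists_null_functions (hU : IsOpen U) (h₁ : IsHorizontal B₁ U) (h₂ : IsHorizontal B₂ U)
    (hx₀ : x₀ ∈ U) (hA : nullArea ε B₁ B₂ x₀ ≠ 0) :
    ∃ V, IsOpen V ∧ x₀ ∈ V ∧ V ⊆ U ∧ ∃ s t : LNum → ℝ, ContDiffOn ℝ ∞ s V ∧ ContDiffOn ℝ ∞ t V ∧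
      pd 0 s x₀ * pd 1 t x₀ - pd 1 s x₀ * pd 0 t x₀ ≠ 0 ∧
      ∀ x ∈ V, ∀ k l, pd 0 (fun y => B₁ y k l) x * pd 1 s x -
          pd 1 (fun y => B₁ y k l) x * pd 0 s x = 0 ∧
        pd 0 (fun y => B₂ y k l) x * pd 1 t x - pd 1 (fun y => B₂ y k l) x * pd 0 t x = 0 := by
  have w₁ := h₁.wedge_eq_zero hU hx₀
  have w₂ := h₂.wedge_eq_zero hU hx₀
  have n₁ : ∃ i, mc B₁ i x₀ 0 1 ≠ 0 ∨ mc B₁ i x₀ 1 0 ≠ 0 := by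
    by_contra! hc
    refine hA ?_
    simp only [nullArea, nullForm₁, nullForm₂, (hc 0).1, (hc 0).2, (hc 1).1, (hc 1).2]
    linear_combination -ε * w₂
  have n₂ : ∃ i, mc B₂ i x₀ 0 1 ≠ 0 ∨ mc B₂ i x₀ 1 0 ≠ 0 := by
    by_contra! hc
    refine hA ?_
    simp only [nullArea, nullForm₁, nullForm₂, (hc 0).1, (hc 0).2, (hc 1).1, (hc 1).2]
    linear_combination ε * w₁
  obtain ⟨V, hV, hxV, hVU, s, hs, ⟨i, hi⟩, hsB⟩ := h₁.exists_parameter hU hx₀ n₁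
  obtain ⟨W, hW, hxW, hWU, t, ht, ⟨j, hj⟩, htB⟩ := h₂.exists_parameter hU hx₀ n₂
  have key : ∀ {B : LNum → Mat2} (_ : IsHorizontal B U) {x : LNum} (_ : x ∈ U) {p q : ℝ}
      (_ : mc B 0 x 0 1 * q - mc B 1 x 0 1 * p = 0) (_ : mc B 0 x 1 0 * q - mc B 1 x 1 0 * p = 0)
      (k l : Fin 2), pd 0 (fun y => B y k l) x * q - pd 1 (fun y => B y k l) x * p = 0 := by
    intro B h x hx p q e1 e2 k l
    have hp : ∀ i, pd i (fun y => B y k l) x = B x k 0 * mc B i x 0 l + B x k 1 * mc B i x 1 l := by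
      intro i
      have := congrFun (congrFun (pdMat_eq_mul_mc (i := i) (h.det x hx)) k) l
      simpa [pdMat, Matrix.mul_apply, Fin.sum_univ_two] using this
    have t := fun i => trace_mc (i := i) hU h.smooth h.det hx
    have d := h.diag x hx
    rw [hp, hp]
    fin_cases l
    · simp [d]; linear_combination B x k 1 * e2
    · simp [t, d]; linear_combination B x k 0 * e1
  refine ⟨V ∩ W, hV.inter hW, ⟨hxV, hxW⟩, Set.inter_subset_left.trans hVU, s, t,
    hs.mono Set.inter_subset_left, ht.mono Set.inter_subset_right, fun h0 => hA ?_,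
    fun x hx k l => ⟨key h₁ (hVU hx.1) (hsB x hx.1).1 (hsB x hx.1).2 k l,
      key h₂ (hWU hx.2) (htB x hx.2).1 (htB x hx.2).2 k l⟩⟩
  have hs0 : pd 0 s x₀ ≠ 0 ∨ pd 1 s x₀ ≠ 0 := by
    fin_cases i
    · exact Or.inl hi
    · exact Or.inr hi
  have ht0 : pd 0 t x₀ ≠ 0 ∨ pd 1 t x₀ ≠ 0 := by
    fin_cases j
    · exact Or.inl hj
    · exact Or.inr hj
  obtain ⟨a1, a2⟩ := hsB x₀ hxV
  obtain ⟨b1, b2⟩ := htB x₀ hxW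
  have e1 := wedge_mul_eq_zero a1 b1 h0 hs0 ht0
  have e2 := wedge_mul_eq_zero a2 b2 h0 hs0 ht0
  simp only [nullArea, nullForm₁, nullForm₂]
  linear_combination e1 + ε * w₁ - ε * w₂ - ε ^ 2 * e2

/-- The matrix of Lorentz numbers with null components `B₁` and `B₂`, entry by entry. -/
def nullEntry (B₁ B₂ : Mat2) (k l : Fin 2) : LNum := ofNull (B₁ k l) (B₂ k l)

theorem hasFDerivAt_ofNull {f g : LNum → ℝ} (hf : DifferentiableAt ℝ f x)
    (hg : DifferentiableAt ℝ g x) :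
    HasFDerivAt (fun y => ofNull (f y) (g y))
      ((nullEquiv.symm : ℝ × ℝ →L[ℝ] LNum).comp ((fderiv ℝ f x).prod (fderiv ℝ g x))) x :=
  (nullEquiv.symm : ℝ × ℝ →L[ℝ] LNum).hasFDerivAt.comp x
    (hf.hasFDerivAt.prodMk hg.hasFDerivAt)

theorem fderiv_ofNull {f g : LNum → ℝ} (hf : DifferentiableAt ℝ f x)
    (hg : DifferentiableAt ℝ g x) (h : LNum) :
    fderiv ℝ (fun y => ofNull (f y) (g y)) x h = ofNull (fderiv ℝ f x h) (fderiv ℝ g x h) := by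
  rw [(hasFDerivAt_ofNull hf hg).fderiv]; rfl

/-- Null coordinates: near a point of nonzero null area there is a local diffeomorphism of the
plane with respect to which the pair `(B₁, B₂)` is conformal. -/
theorem exists_null_chart (hU : IsOpen U) (h₁ : IsHorizontal B₁ U) (h₂ : IsHorizontal B₂ U)
    (hx₀ : x₀ ∈ U) (hA : nullArea ε B₁ B₂ x₀ ≠ 0) :
    ∃ ψ : OpenPartialHomeomorph LNum LNum, x₀ ∈ ψ.source ∧ ψ.source ⊆ U ∧
      ContDiffOn ℝ ∞ ψ ψ.source ∧ ContDiffOn ℝ ∞ ψ.symm ψ.target ∧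
      ∀ x ∈ ψ.source, ∀ k l, ∃ P : LNum, ∀ h,
        fderiv ℝ (fun y => nullEntry (B₁ y) (B₂ y) k l) x h = P * fderiv ℝ ψ x h := by
  obtain ⟨V, hV, hxV, hVU, s, t, hs, ht, hst, hB⟩ := exists_null_functions hU h₁ h₂ hx₀ hA
  let J : LNum → ℝ := fun x => pd 0 s x * pd 1 t x - pd 1 s x * pd 0 t x
  have hJ : ContDiffOn ℝ ∞ J V :=
    ((contDiffOn_pd hV hs 0).mul (contDiffOn_pd hV ht 1)).sub
      ((contDiffOn_pd hV hs 1).mul (contDiffOn_pd hV ht 0))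
  let W := V ∩ {x | J x ≠ 0}
  have hW : IsOpen W := isOpen_inter_ne hV hJ 0
  have hxW : x₀ ∈ W := ⟨hxV, hst⟩
  let Φ : LNum → LNum := fun x => ofNull (s x) (t x)
  have hΦ : ContDiffOn ℝ ∞ Φ V := contDiffOn_ofNull hs ht
  have hd : ∀ x ∈ W, ∃ e : LNum ≃L[ℝ] LNum, HasFDerivAt Φ (e : LNum →L[ℝ] LNum) x := by
    intro x hx
    have hf := hasFDerivAt_ofNull (diffAt hV hx.1 hs) (diffAt hV hx.1 ht)
    have hinj : Function.Injective (((nullEquiv.symm : ℝ × ℝ →L[ℝ] LNum).comp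
        ((fderiv ℝ s x).prod (fderiv ℝ t x)) : LNum →L[ℝ] LNum) : LNum →ₗ[ℝ] LNum) := by
      rw [injective_iff_map_eq_zero]
      intro h hh
      have hh' : ((fderiv ℝ s x).prod (fderiv ℝ t x)) h = 0 :=
        nullEquiv.symm.injective (by simpa using hh)
      have e1 : fderiv ℝ s x h = 0 := congrArg Prod.fst hh'
      have e2 : fderiv ℝ t x h = 0 := congrArg Prod.snd hh'
      rw [fderiv_apply_eq_pd] at e1 e2
      have r0 : J x * h.re = 0 := by simp only [J]; linear_combination pd 1 t x * e1 - pd 1 s x * e2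
      have r1 : J x * h.im = 0 := by simp only [J]; linear_combination pd 0 s x * e2 - pd 0 t x * e1
      exact QuadraticAlgebra.ext ((mul_eq_zero.mp r0).resolve_left hx.2)
        ((mul_eq_zero.mp r1).resolve_left hx.2)
    refine ⟨(LinearEquiv.ofInjectiveEndo _ hinj).toContinuousLinearEquiv, ?_⟩
    convert hf using 1
    ext h <;> rfl
  obtain ⟨e₀, he₀⟩ := hd x₀ hxW
  have hΦ₀ : ContDiffAt ℝ ∞ Φ x₀ := hΦ.contDiffAt (hV.mem_nhds hxV)
  let ψ₀ := hΦ₀.toOpenPartialHomeomorph Φ he₀ (by simp)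
  let ψ := ψ₀.restrOpen W hW
  have hsrc : ∀ x ∈ ψ.source, x ∈ W := fun x hx => by
    simp only [ψ, OpenPartialHomeomorph.restrOpen_source] at hx
    exact hx.2
  have hcoe : ∀ x, ψ x = Φ x := fun x => rfl
  refine ⟨ψ, ?_, fun x hx => hVU (hsrc x hx).1, ?_, ?_, ?_⟩
  · simp only [ψ, OpenPartialHomeomorph.restrOpen_source]
    exact ⟨hΦ₀.mem_toOpenPartialHomeomorph_source he₀ (by simp), hxW⟩
  · exact hΦ.mono fun x hx => (hsrc x hx).1
  · intro y hy
    have hyW := hsrc _ (ψ.map_target hy)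
    obtain ⟨e, he⟩ := hd _ hyW
    exact (ψ.contDiffAt_symm hy he (hΦ.contDiffAt (hV.mem_nhds hyW.1))).contDiffWithinAt
  · intro x hx k l
    have hxV' := (hsrc x hx).1
    have hJx : J x ≠ 0 := (hsrc x hx).2
    have hprop : ∀ {f s : LNum → ℝ}, pd 0 f x * pd 1 s x - pd 1 f x * pd 0 s x = 0 →
        (pd 0 s x ≠ 0 ∨ pd 1 s x ≠ 0) → ∃ P : ℝ, ∀ h, fderiv ℝ f x h = P * fderiv ℝ s x h := by
      intro f s hw hs
      rcases hs with hs | hs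
      · refine ⟨pd 0 f x / pd 0 s x, fun h => ?_⟩
        rw [fderiv_apply_eq_pd, fderiv_apply_eq_pd]
        field_simp
        linear_combination -h.im * hw
      · refine ⟨pd 1 f x / pd 1 s x, fun h => ?_⟩
        rw [fderiv_apply_eq_pd, fderiv_apply_eq_pd]
        field_simp
        linear_combination h.re * hw
    have hs0 : pd 0 s x ≠ 0 ∨ pd 1 s x ≠ 0 := by
      by_contra! hc; exact hJx (by simp [J, hc.1, hc.2])
    have ht0 : pd 0 t x ≠ 0 ∨ pd 1 t x ≠ 0 := by
      by_contra! hc; exact hJx (by simp [J, hc.1, hc.2])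
    obtain ⟨P, hP⟩ := hprop (hB x hxV' k l).1 hs0
    obtain ⟨Q, hQ⟩ := hprop (hB x hxV' k l).2 ht0
    refine ⟨ofNull P Q, fun h => ?_⟩
    have f1 := fderiv_ofNull (diffAt hU (hVU hxV') (h₁.smooth k l))
      (diffAt hU (hVU hxV') (h₂.smooth k l)) h
    have f2 := fderiv_ofNull (diffAt hV hxV' hs) (diffAt hV hxV' ht) h
    have f3 : fderiv ℝ ψ x h = ofNull (fderiv ℝ s x h) (fderiv ℝ t x h) := f2
    rw [f3]
    simp only [nullEntry]
    rw [f1, hP, hQ]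
    apply null_ext <;> simp

end

/-! ### Locally constant cocycles on simply connected spaces -/

/-- A locally constant `1`-cocycle of a group on a simply connected space is a coboundary: it
defines a covering space, which has a global section. -/
theorem exists_coboundary {X ι Γ : Type*} [TopologicalSpace X] [SimplyConnectedSpace X]
    [LocallyPathConnectedSpace X] [Group Γ] (U : ι → Set X) (hU : ∀ i, IsOpen (U i)) (idx : X → ι)
    (hidx : ∀ x, x ∈ U (idx x)) (g : ι → ι → X → Γ)
    (hloc : ∀ i j, ∀ x ∈ U i ∩ U j, ∀ᶠ y in 𝓝 x, g i j y = g i j x)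
    (hcoc : ∀ i j k x, x ∈ U i → x ∈ U j → x ∈ U k → g i j x * g j k x = g i k x) :
    ∃ h : ι → X → Γ, (∀ i, ∀ x ∈ U i, ∀ᶠ y in 𝓝 x, h i y = h i x) ∧
      ∀ i j x, x ∈ U i → x ∈ U j → h i x = g i j x * h j x := by
  let _ : TopologicalSpace Γ := ⊥
  have _ : DiscreteTopology Γ := ⟨rfl⟩
  have hone : ∀ i x, x ∈ U i → g i i x = 1 := fun i x hx => by
    simpa using hcoc i i i x hx hx hx
  let Z : FiberBundleCore ι X Γ :=
    { baseSet := U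
      isOpen_baseSet := hU
      indexAt := idx
      mem_baseSet_at := hidx
      coordChange := fun i j x v => g j i x * v
      coordChange_self := fun i x hx v => by rw [hone i x hx, one_mul]
      continuousOn_coordChange := fun i j => by
        rintro ⟨x, v⟩ ⟨hx, -⟩
        have h1 : ∀ᶠ p : X × Γ in 𝓝 (x, v), g j i p.1 * p.2 = g j i x * v := by
          have e1 : ∀ᶠ p : X × Γ in 𝓝 (x, v), g j i p.1 = g j i x :=
            (continuous_fst.tendsto (x, v)).eventually (hloc j i x ⟨hx.2, hx.1⟩)
          have e2 : ∀ᶠ p : X × Γ in 𝓝 (x, v), p.2 = v :=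
            (continuous_snd.tendsto (x, v)).eventually
              (show ∀ᶠ w in 𝓝 v, w = v by simp [nhds_discrete])
          filter_upwards [e1, e2] with p h1 h2
          rw [h1, h2]
        exact (continuousAt_const.congr (h1.mono fun p hp => hp.symm)).continuousWithinAt
      coordChange_comp := fun i j k x hx v => by
        rw [← mul_assoc, hcoc k j i x hx.2 hx.1.2 hx.1.1] }
  have cov : IsCoveringMap (Bundle.TotalSpace.proj : Bundle.TotalSpace Γ Z.Fiber → X) :=
    FiberBundle.isCoveringMap
  obtain ⟨x₀⟩ : Nonempty X := inferInstance
  obtain ⟨S, ⟨-, hS⟩, -⟩ := cov.existsUnique_continuousMap_lifts (ContinuousMap.id X) x₀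
    (⟨x₀, (1 : Γ)⟩ : Bundle.TotalSpace Γ Z.Fiber) rfl
  have hSp : ∀ x, (S x).proj = x := fun x => congrFun hS x
  let v : X → Γ := fun x => (S x).snd
  have happ : ∀ i x, (Z.localTriv i (S x)).2 = g i (idx x) x * v x := fun i x => by
    show g i (idx (S x).proj) (S x).proj * v x = _
    rw [hSp x]
  refine ⟨fun i x => (Z.localTriv i (S x)).2, fun i x hx => ?_, fun i j x hi hj => ?_⟩
  · have hc : ContinuousAt (fun y => (Z.localTriv i (S y)).2) x := by
      have h1 : ContinuousAt (Z.localTriv i) (S x) :=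
        (Z.localTriv i).continuousAt (by
          rw [(Z.localTriv i).mem_source]
          show (S x).proj ∈ U i
          rw [hSp x]; exact hx)
      exact (continuous_snd.continuousAt.comp h1).comp S.continuous.continuousAt
    have : {(Z.localTriv i (S x)).2} ∈ 𝓝 ((Z.localTriv i (S x)).2) := by simp [nhds_discrete]
    exact hc this
  · show (Z.localTriv i (S x)).2 = g i j x * (Z.localTriv j (S x)).2
    rw [happ, happ, ← mul_assoc, hcoc i j (idx x) x hi hj (hidx x)]

/-! ### Differentials on a surface in charts -/

section

variable {M : Type*} [TopologicalSpace M] [ChartedSpace LNum M]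
variable {N N' : Type*} [NormedAddCommGroup N] [NormedSpace ℝ N] [NormedAddCommGroup N']
  [NormedSpace ℝ N']

/-- The differential at `p` of a function on a surface with values in a vector space. -/
def dV (f : M → N) (p : M) : TangentSpace 𝓘(ℝ, LNum) p →L[ℝ] N :=
  mfderiv 𝓘(ℝ, LNum) 𝓘(ℝ, N) f p

/-- The differential of the parametrization `e.symm`. -/
def chartVec (e : OpenPartialHomeomorph M LNum) (x : LNum) :
    LNum →L[ℝ] TangentSpace 𝓘(ℝ, LNum) (e.symm x) :=
  mfderiv 𝓘(ℝ, LNum) 𝓘(ℝ, LNum) e.symm x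

variable {e : OpenPartialHomeomorph M LNum} {x : LNum} {U : Set M}

theorem contDiffOn_comp_symm (he : e ∈ IsManifold.maximalAtlas 𝓘(ℝ, LNum) ∞ M) {f : M → N}
    (hf : ContMDiffOn 𝓘(ℝ, LNum) 𝓘(ℝ, N) ∞ f U) :
    ContDiffOn ℝ ∞ (f ∘ e.symm) (e.target ∩ e.symm ⁻¹' U) := by
  rw [← contMDiffOn_iff_contDiffOn]
  exact hf.comp ((contMDiffOn_symm_of_mem_maximalAtlas he).mono Set.inter_subset_left)
    Set.inter_subset_right

theorem contMDiffOn_comp_chart (he : e ∈ IsManifold.maximalAtlas 𝓘(ℝ, LNum) ∞ M) {f : LNum → N}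
    {V : Set LNum} (hf : ContDiffOn ℝ ∞ f V) :
    ContMDiffOn 𝓘(ℝ, LNum) 𝓘(ℝ, N) ∞ (f ∘ e) (e.source ∩ e ⁻¹' V) :=
  (contMDiffOn_iff_contDiffOn.mpr hf).comp
    ((contMDiffOn_of_mem_maximalAtlas he).mono Set.inter_subset_left) Set.inter_subset_right

theorem mdiffAt {f : M → N} (hU : IsOpen U) (hf : ContMDiffOn 𝓘(ℝ, LNum) 𝓘(ℝ, N) ∞ f U) {p : M}
    (hp : p ∈ U) : MDifferentiableAt 𝓘(ℝ, LNum) 𝓘(ℝ, N) f p :=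
  (hf.contMDiffAt (hU.mem_nhds hp)).mdifferentiableAt (by simp)

theorem dV_clm_comp (ℓ : N →L[ℝ] N') {f : M → N} {p : M}
    (hf : MDifferentiableAt 𝓘(ℝ, LNum) 𝓘(ℝ, N) f p) (X : TangentSpace 𝓘(ℝ, LNum) p) :
    dV (fun q => ℓ (f q)) p X = ℓ (dV f p X) := by
  have h := mfderiv_comp_apply (g := ℓ) p ℓ.differentiableAt.mdifferentiableAt hf X
  rw [mfderiv_eq_fderiv, ℓ.fderiv] at h
  exact h

theorem mdifferentiable_of_mem_maximalAtlas
    (he : e ∈ IsManifold.maximalAtlas 𝓘(ℝ, LNum) ∞ M) :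
    e.MDifferentiable 𝓘(ℝ, LNum) 𝓘(ℝ, LNum) :=
  ⟨(contMDiffOn_of_mem_maximalAtlas he).mdifferentiableOn (by simp),
    (contMDiffOn_symm_of_mem_maximalAtlas he).mdifferentiableOn (by simp)⟩

theorem dV_chartVec (he : e ∈ IsManifold.maximalAtlas 𝓘(ℝ, LNum) ∞ M) (hx : x ∈ e.target)
    {f : M → N} (hf : MDifferentiableAt 𝓘(ℝ, LNum) 𝓘(ℝ, N) f (e.symm x)) (h : LNum) :
    dV f (e.symm x) (chartVec e x h) = fderiv ℝ (f ∘ e.symm) x h := by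
  rw [← mfderiv_eq_fderiv]
  exact (mfderiv_comp_apply x hf
    ((mdifferentiable_of_mem_maximalAtlas he).mdifferentiableAt_symm hx) h).symm

theorem dV_chart_chartVec (he : e ∈ IsManifold.maximalAtlas 𝓘(ℝ, LNum) ∞ M) (hx : x ∈ e.target)
    (h : LNum) : dV e (e.symm x) (chartVec e x h) = h := by
  have := (mdifferentiable_of_mem_maximalAtlas he).comp_symm_deriv hx
  exact DFunLike.congr_fun this h

theorem chartVec_dV_chart (he : e ∈ IsManifold.maximalAtlas 𝓘(ℝ, LNum) ∞ M) (hx : x ∈ e.target)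
    (X : TangentSpace 𝓘(ℝ, LNum) (e.symm x)) : chartVec e x (dV e (e.symm x) X) = X := by
  have := (mdifferentiable_of_mem_maximalAtlas he).symm_comp_deriv (e.map_target hx)
  have h2 := DFunLike.congr_fun this X
  rw [e.right_inv hx] at h2
  exact h2

/-! ### Horizontal maps on a surface -/

/-- The entrywise differential of a real matrix valued map on a surface. -/
def dMat2 (B : M → Mat2) (p : M) (X : TangentSpace 𝓘(ℝ, LNum) p) : Mat2 :=
  Matrix.of fun k l => dV (fun q => B q k l) p X

/-- The Maurer–Cartan form `B⁻¹ dB` of a map from a surface to `SL₂(ℝ)`. -/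
def mcForm (B : M → Mat2) (p : M) (X : TangentSpace 𝓘(ℝ, LNum) p) : Mat2 :=
  (B p).adjugate * dMat2 B p X

/-- Horizontality of a map from a surface to `SL₂(ℝ)`. -/
structure IsHorizontalOn (B : M → Mat2) (U : Set M) : Prop where
  smooth : ∀ k l, ContMDiffOn 𝓘(ℝ, LNum) 𝓘(ℝ, ℝ) ∞ (fun p => B p k l) U
  det : ∀ p ∈ U, (B p).det = 1
  diag : ∀ p ∈ U, ∀ X, mcForm B p X 0 0 = 0

variable {ε : ℝ} {B B₁ B₂ : M → Mat2}

theorem mcForm_chartVec (he : e ∈ IsManifold.maximalAtlas 𝓘(ℝ, LNum) ∞ M) (hx : x ∈ e.target)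
    (hB : ∀ k l, MDifferentiableAt 𝓘(ℝ, LNum) 𝓘(ℝ, ℝ) (fun p => B p k l) (e.symm x)) (h : LNum) :
    mcForm B (e.symm x) (chartVec e x h) =
      h.re • mc (fun y => B (e.symm y)) 0 x + h.im • mc (fun y => B (e.symm y)) 1 x := by
  have hd : dMat2 B (e.symm x) (chartVec e x h) =
      h.re • pdMat 0 (fun y => B (e.symm y)) x + h.im • pdMat 1 (fun y => B (e.symm y)) x := by
    ext k l
    simp only [dMat2, Matrix.of_apply]
    rw [dV_chartVec he hx (hB k l), fderiv_apply_eq_pd]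
    rfl
  rw [mcForm, hd, mul_add, mul_smul_comm, mul_smul_comm]
  rfl

theorem mcForm_coordBasis (he : e ∈ IsManifold.maximalAtlas 𝓘(ℝ, LNum) ∞ M) (hx : x ∈ e.target)
    (hB : ∀ k l, MDifferentiableAt 𝓘(ℝ, LNum) 𝓘(ℝ, ℝ) (fun p => B p k l) (e.symm x)) (i : Fin 2) :
    mcForm B (e.symm x) (chartVec e x (coordBasis i)) = mc (fun y => B (e.symm y)) i x := by
  rw [mcForm_chartVec he hx hB]
  fin_cases i <;> simp [coordBasis, σ, QuadraticAlgebra.re_one, QuadraticAlgebra.im_one]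

theorem IsHorizontalOn.isHorizontal (he : e ∈ IsManifold.maximalAtlas 𝓘(ℝ, LNum) ∞ M)
    (hU : IsOpen U) (h : IsHorizontalOn B U) :
    IsHorizontal (fun y => B (e.symm y)) (e.target ∩ e.symm ⁻¹' U) :=
  ⟨fun k l => contDiffOn_comp_symm he (h.smooth k l), fun x hx => h.det _ hx.2, fun x hx i => by
    rw [← mcForm_coordBasis he hx.1 (fun k l => mdiffAt hU (h.smooth k l) hx.2)]
    exact h.diag _ hx.2 _⟩

theorem IsHorizontal.isHorizontalOn (he : e ∈ IsManifold.maximalAtlas 𝓘(ℝ, LNum) ∞ M)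
    {C : LNum → Mat2} {V : Set LNum} (hV : IsOpen V) (h : IsHorizontal C V) :
    IsHorizontalOn (fun p => C (e p)) (e.source ∩ e ⁻¹' V) := by
  have hs : ∀ k l, ContMDiffOn 𝓘(ℝ, LNum) 𝓘(ℝ, ℝ) ∞ (fun p => C (e p) k l)
      (e.source ∩ e ⁻¹' V) := fun k l => contMDiffOn_comp_chart he (h.smooth k l)
  refine ⟨hs, fun p hp => h.det _ hp.2, fun p hp X => ?_⟩
  obtain ⟨x, hx, rfl⟩ : ∃ x ∈ e.target, e.symm x = p :=
    ⟨e p, e.map_source hp.1, e.left_inv hp.1⟩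
  have hxV : x ∈ V := by simpa [e.right_inv hx] using hp.2
  have hopen := e.isOpen_inter_preimage hV
  have hmc : ∀ i, mc (fun y => C (e (e.symm y))) i x = mc C i x := fun i => by
    have : ∀ y ∈ e.target, C (e (e.symm y)) = C y := fun y hy => by rw [e.right_inv hy]
    rw [mc, mc, pdMat_congr e.open_target hx this, this x hx]
  rw [← chartVec_dV_chart he hx X, mcForm_chartVec he hx fun k l => mdiffAt hopen (hs k l) hp,
    hmc, hmc]
  simp [h.diag x hxV]

/-- The first null form of the pair `(B₁, B₂)` on a surface. -/
def nullFormOn₁ (ε : ℝ) (B₁ B₂ : M → Mat2) (p : M) (X : TangentSpace 𝓘(ℝ, LNum) p) : ℝ :=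
  mcForm B₁ p X 0 1 + ε * mcForm B₂ p X 1 0

/-- The second null form of the pair `(B₁, B₂)` on a surface. -/
def nullFormOn₂ (ε : ℝ) (B₁ B₂ : M → Mat2) (p : M) (X : TangentSpace 𝓘(ℝ, LNum) p) : ℝ :=
  mcForm B₂ p X 0 1 + ε * mcForm B₁ p X 1 0

/-- The two null forms of `(B₁, B₂)` are linearly independent at `p`. -/
def NullIndep (ε : ℝ) (B₁ B₂ : M → Mat2) (p : M) : Prop :=
  ∀ X, nullFormOn₁ ε B₁ B₂ p X = 0 → nullFormOn₂ ε B₁ B₂ p X = 0 → X = 0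

theorem nullFormOn_chartVec (he : e ∈ IsManifold.maximalAtlas 𝓘(ℝ, LNum) ∞ M)
    (hx : x ∈ e.target)
    (h₁ : ∀ k l, MDifferentiableAt 𝓘(ℝ, LNum) 𝓘(ℝ, ℝ) (fun p => B₁ p k l) (e.symm x))
    (h₂ : ∀ k l, MDifferentiableAt 𝓘(ℝ, LNum) 𝓘(ℝ, ℝ) (fun p => B₂ p k l) (e.symm x)) (h : LNum) :
    nullFormOn₁ ε B₁ B₂ (e.symm x) (chartVec e x h) =
        h.re * nullForm₁ ε (fun y => B₁ (e.symm y)) (fun y => B₂ (e.symm y)) 0 x +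
          h.im * nullForm₁ ε (fun y => B₁ (e.symm y)) (fun y => B₂ (e.symm y)) 1 x ∧
      nullFormOn₂ ε B₁ B₂ (e.symm x) (chartVec e x h) =
        h.re * nullForm₂ ε (fun y => B₁ (e.symm y)) (fun y => B₂ (e.symm y)) 0 x +
          h.im * nullForm₂ ε (fun y => B₁ (e.symm y)) (fun y => B₂ (e.symm y)) 1 x := by
  rw [nullFormOn₁, nullFormOn₂, mcForm_chartVec he hx h₁, mcForm_chartVec he hx h₂]
  simp only [nullForm₁, nullForm₂, Matrix.add_apply, Matrix.smul_apply, smul_eq_mul]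
  constructor <;> ring

theorem nullIndep_iff (he : e ∈ IsManifold.maximalAtlas 𝓘(ℝ, LNum) ∞ M) (hx : x ∈ e.target)
    (h₁ : ∀ k l, MDifferentiableAt 𝓘(ℝ, LNum) 𝓘(ℝ, ℝ) (fun p => B₁ p k l) (e.symm x))
    (h₂ : ∀ k l, MDifferentiableAt 𝓘(ℝ, LNum) 𝓘(ℝ, ℝ) (fun p => B₂ p k l) (e.symm x)) :
    NullIndep ε B₁ B₂ (e.symm x) ↔
      nullArea ε (fun y => B₁ (e.symm y)) (fun y => B₂ (e.symm y)) x ≠ 0 := by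
  have hval := nullFormOn_chartVec (ε := ε) he hx h₁ h₂
  set α := nullForm₁ ε (fun y => B₁ (e.symm y)) (fun y => B₂ (e.symm y)) with hα
  set β := nullForm₂ ε (fun y => B₁ (e.symm y)) (fun y => B₂ (e.symm y)) with hβ
  have hA : nullArea ε (fun y => B₁ (e.symm y)) (fun y => B₂ (e.symm y)) x =
    α 0 x * β 1 x - α 1 x * β 0 x := rfl
  rw [hA]
  constructor
  · intro hN h0
    have hz : ∀ h : LNum, h.re * α 0 x + h.im * α 1 x = 0 → h.re * β 0 x + h.im * β 1 x = 0 →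
        h = 0 := by
      intro h e1 e2
      have := hN (chartVec e x h) ((hval h).1.trans e1) ((hval h).2.trans e2)
      rw [← dV_chart_chartVec he hx h, this, map_zero]
    have z1 := hz ⟨α 1 x, -α 0 x⟩ (by simp; ring) (by simp; linarith)
    have z2 := hz ⟨β 1 x, -β 0 x⟩ (by simp; linarith) (by simp; ring)
    have a1 : α 1 x = 0 := congrArg QuadraticAlgebra.re z1
    have a0 : -α 0 x = 0 := congrArg QuadraticAlgebra.im z1
    have z3 := hz 1 (by simp [QuadraticAlgebra.re_one, QuadraticAlgebra.im_one]; linarith)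
      (by
        have b0 : -β 0 x = 0 := congrArg QuadraticAlgebra.im z2
        simp [QuadraticAlgebra.re_one, QuadraticAlgebra.im_one]; linarith)
    have := congrArg QuadraticAlgebra.re z3
    simp [QuadraticAlgebra.re_one] at this
  · intro hne X e1 e2
    rw [← chartVec_dV_chart he hx X] at e1 e2 ⊢
    set h := dV e (e.symm x) X with hh
    rw [(hval _).1] at e1
    rw [(hval _).2] at e2
    have r0 : h.re = 0 := (mul_eq_zero.mp (show (α 0 x * β 1 x - α 1 x * β 0 x) * h.re = 0 by
      linear_combination β 1 x * e1 - α 1 x * e2)).resolve_left hne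
    have r1 : h.im = 0 := (mul_eq_zero.mp (show (α 0 x * β 1 x - α 1 x * β 0 x) * h.im = 0 by
      linear_combination α 0 x * e2 - β 0 x * e1)).resolve_left hne
    have : h = 0 := QuadraticAlgebra.ext r0 r1
    rw [this, map_zero]

end

/-! ### The real matrix model of `ℝ^{2,2}` -/

/-- The first null component of `toHerm x`; the second one is its transpose. -/
def toReal (x : R22) : Mat2 := !![-x 1 - x 0, -x 3 - x 2; -x 3 + x 2, x 1 - x 0]

/-- The inverse of `toReal`. -/
def ofReal (C : Mat2) : R22 :=
  ![-(C 0 0 + C 1 1) / 2, (C 1 1 - C 0 0) / 2, (C 1 0 - C 0 1) / 2, -(C 0 1 + C 1 0) / 2]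

/-- The entries of `toReal` as linear forms. -/
def toRealEntry (k l : Fin 2) : R22 →L[ℝ] ℝ :=
  LinearMap.toContinuousLinearMap
    { toFun := fun x => toReal x k l
      map_add' := fun x y => by fin_cases k <;> fin_cases l <;> simp [toReal] <;> ring
      map_smul' := fun r x => by fin_cases k <;> fin_cases l <;> simp [toReal] <;> ring }

theorem toRealEntry_apply (k l : Fin 2) (x : R22) : toRealEntry k l x = toReal x k l := rfl

theorem toReal_ofReal (C : Mat2) : toReal (ofReal C) = C := by
  ext k l
  fin_cases k <;> fin_cases l <;> simp [toReal, ofReal] <;> ring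

theorem toReal_zero : toReal 0 = 0 := by
  ext k l
  fin_cases k <;> fin_cases l <;> simp [toReal]

theorem toReal_injective : Function.Injective toReal := by
  intro x y h
  have h00 := congrFun (congrFun h 0) 0
  have h01 := congrFun (congrFun h 0) 1
  have h10 := congrFun (congrFun h 1) 0
  have h11 := congrFun (congrFun h 1) 1
  simp [toReal] at h00 h01 h10 h11
  funext i
  fin_cases i <;> simp <;> linarith

theorem ip_eq_negDet (x y : R22) : ip x y = negDet (toReal x) (toReal y) := by
  simp [ip, negDet, toReal]; ring

theorem det_toReal (x : R22) : (toReal x).det = -ip x x := by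
  simp [ip, toReal, Matrix.det_fin_two]; ring

theorem nullFst_toHerm (x : R22) (k l : Fin 2) : nullFst (toHerm x k l) = toReal x k l := by
  fin_cases k <;> fin_cases l <;> simp [toHerm, toReal, nullFst_apply]; ring

theorem nullSnd_toHerm (x : R22) (k l : Fin 2) : nullSnd (toHerm x k l) = toReal x l k := by
  fin_cases k <;> fin_cases l <;> simp [toHerm, toReal, nullSnd_apply]

/-- The entrywise first null component of a matrix of Lorentz numbers. -/
def fstMat (A : Matrix (Fin 2) (Fin 2) LNum) : Mat2 := Matrix.of fun k l => nullFst (A k l)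

/-- The entrywise second null component of a matrix of Lorentz numbers. -/
def sndMat (A : Matrix (Fin 2) (Fin 2) LNum) : Mat2 := Matrix.of fun k l => nullSnd (A k l)

theorem fstMat_mul (A C : Matrix (Fin 2) (Fin 2) LNum) :
    fstMat (A * C) = fstMat A * fstMat C := by
  ext k l; simp [fstMat, Matrix.mul_apply]

theorem sndMat_mul (A C : Matrix (Fin 2) (Fin 2) LNum) :
    sndMat (A * C) = sndMat A * sndMat C := by
  ext k l; simp [sndMat, Matrix.mul_apply]

theorem fstMat_conjTranspose (A : Matrix (Fin 2) (Fin 2) LNum) : fstMat Aᴴ = (sndMat A)ᵀ := by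
  ext k l; simp [fstMat, sndMat, Matrix.conjTranspose_apply]

theorem sndMat_conjTranspose (A : Matrix (Fin 2) (Fin 2) LNum) : sndMat Aᴴ = (fstMat A)ᵀ := by
  ext k l; simp [fstMat, sndMat, Matrix.conjTranspose_apply]

theorem det_fstMat (A : Matrix (Fin 2) (Fin 2) LNum) : (fstMat A).det = nullFst A.det := by
  simp [Matrix.det_fin_two, fstMat]

theorem det_sndMat (A : Matrix (Fin 2) (Fin 2) LNum) : (sndMat A).det = nullSnd A.det := by
  simp [Matrix.det_fin_two, sndMat]

theorem fstMat_adjugate (A : Matrix (Fin 2) (Fin 2) LNum) :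
    fstMat A.adjugate = (fstMat A).adjugate := by
  ext k l
  fin_cases k <;> fin_cases l <;> simp [Matrix.adjugate_fin_two, fstMat]

theorem sndMat_adjugate (A : Matrix (Fin 2) (Fin 2) LNum) :
    sndMat A.adjugate = (sndMat A).adjugate := by
  ext k l
  fin_cases k <;> fin_cases l <;> simp [Matrix.adjugate_fin_two, sndMat]

/-- The matrix `diag(ε, 1)` over the Lorentz numbers. -/
def sgnL (ε : ℝ) : Matrix (Fin 2) (Fin 2) LNum := !![ofNull ε ε, 0; 0, 1]

theorem fstMat_sgnL (ε : ℝ) : fstMat (sgnL ε) = sgnMat ε := by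
  ext k l; fin_cases k <;> fin_cases l <;> simp [fstMat, sgnL, sgnMat]

theorem sndMat_sgnL (ε : ℝ) : sndMat (sgnL ε) = sgnMat ε := by
  ext k l; fin_cases k <;> fin_cases l <;> simp [sndMat, sgnL, sgnMat]

theorem sgnL_one : sgnL 1 = 1 := by
  have : ofNull 1 1 = 1 := null_ext (by simp) (by simp)
  rw [sgnL, this, Matrix.one_fin_two]

theorem sgnL_neg_one : sgnL (-1) = !![-1, 0; 0, 1] := by
  have : ofNull (-1) (-1) = -1 := null_ext (by simp) (by simp)
  rw [sgnL, this]

theorem sgnMat_transpose (ε : ℝ) : (sgnMat ε)ᵀ = sgnMat ε := by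
  ext k l; fin_cases k <;> fin_cases l <;> simp [sgnMat]

/-- In null components the equation `C = A J A^*` is `C₁ = A₁ J A₂ᵀ`. -/
theorem toHerm_eq_iff (ε : ℝ) (x : R22) (A : Matrix (Fin 2) (Fin 2) LNum) :
    toHerm x = A * sgnL ε * Aᴴ ↔ toReal x = fstMat A * sgnMat ε * (sndMat A)ᵀ := by
  have h₁ : fstMat (toHerm x) = toReal x := by ext k l; exact nullFst_toHerm x k l
  have h₂ : sndMat (toHerm x) = (toReal x)ᵀ := by ext k l; exact nullSnd_toHerm x k l
  have k₁ : fstMat (A * sgnL ε * Aᴴ) = fstMat A * sgnMat ε * (sndMat A)ᵀ := by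
    rw [fstMat_mul, fstMat_mul, fstMat_sgnL, fstMat_conjTranspose]
  have k₂ : sndMat (A * sgnL ε * Aᴴ) = (fstMat A * sgnMat ε * (sndMat A)ᵀ)ᵀ := by
    rw [sndMat_mul, sndMat_mul, sndMat_sgnL, sndMat_conjTranspose, Matrix.transpose_mul,
      Matrix.transpose_mul, Matrix.transpose_transpose, sgnMat_transpose, mul_assoc]
  constructor
  · intro h
    rw [← h₁, h, k₁]
  · intro h
    ext1 k l
    refine null_ext ?_ ?_
    · exact congrFun (congrFun (h₁.trans (h.trans k₁.symm)) k) l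
    · exact congrFun (congrFun (h₂.trans ((congrArg Matrix.transpose h).trans k₂.symm)) k) l

section

variable {M : Type*} [TopologicalSpace M] [ChartedSpace LNum M]
variable {e : OpenPartialHomeomorph M LNum} {x : LNum} {ε : ℝ} {F : M → R22} {B₁ B₂ : M → Mat2}

/-! ### The metric induced by a map into `ℝ^{2,2}` -/

theorem smoothMat_toReal (he : e ∈ IsManifold.maximalAtlas 𝓘(ℝ, LNum) ∞ M)
    (hF : ContMDiff 𝓘(ℝ, LNum) 𝓘(ℝ, R22) ∞ F) :
    SmoothMat (fun y => toReal (F (e.symm y))) e.target := by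
  have := contDiffOn_comp_symm he (hF.contMDiffOn (s := Set.univ))
  rw [Set.preimage_univ, Set.inter_univ] at this
  exact fun k l => (toRealEntry k l).contDiff.comp_contDiffOn this

/-- A coordinate of the differential of a map into `ℝ^{2,2}`. -/
def dCoord (F : M → R22) (i : Fin 4) (p : M) : TangentSpace 𝓘(ℝ, LNum) p →L[ℝ] ℝ :=
  (ContinuousLinearMap.proj i : R22 →L[ℝ] ℝ).comp (dR F p)

/-- The pull back of the scalar product of `ℝ^{2,2}` by a smooth map. -/
def inducedForm (F : M → R22) (p : M) :
    TangentSpace 𝓘(ℝ, LNum) p →L[ℝ] TangentSpace 𝓘(ℝ, LNum) p →L[ℝ] ℝ :=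
  -((dCoord F 0 p).smulRight (dCoord F 0 p)) + (dCoord F 1 p).smulRight (dCoord F 1 p) -
    (dCoord F 2 p).smulRight (dCoord F 2 p) + (dCoord F 3 p).smulRight (dCoord F 3 p)

theorem inducedForm_apply (F : M → R22) (p : M) (X Y : TangentSpace 𝓘(ℝ, LNum) p) :
    inducedForm F p X Y = ip (dR F p X) (dR F p Y) := rfl

theorem toReal_dR_chartVec (he : e ∈ IsManifold.maximalAtlas 𝓘(ℝ, LNum) ∞ M) (hx : x ∈ e.target)
    (hF : ContMDiff 𝓘(ℝ, LNum) 𝓘(ℝ, R22) ∞ F) (h : LNum) :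
    toReal (dR F (e.symm x) (chartVec e x h)) =
      h.re • pdMat 0 (fun y => toReal (F (e.symm y))) x +
        h.im • pdMat 1 (fun y => toReal (F (e.symm y))) x := by
  have h0 : dR F (e.symm x) (chartVec e x h) = fderiv ℝ (F ∘ e.symm) x h :=
    dV_chartVec he hx (hF.mdifferentiableAt (by simp)) h
  have hd : DifferentiableAt ℝ (F ∘ e.symm) x := by
    have := contDiffOn_comp_symm he (hF.contMDiffOn (s := Set.univ))
    rw [Set.preimage_univ, Set.inter_univ] at this
    exact (this.contDiffAt (e.open_target.mem_nhds hx)).differentiableAt (by simp)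
  ext k l
  rw [h0, ← toRealEntry_apply]
  have h1 : fderiv ℝ (fun y => toReal (F (e.symm y)) k l) x =
      (toRealEntry k l).comp (fderiv ℝ (F ∘ e.symm) x) :=
    ((toRealEntry k l).hasFDerivAt.comp x hd.hasFDerivAt).fderiv
  have h2 := DFunLike.congr_fun h1 h
  rw [fderiv_apply_eq_pd] at h2
  exact h2.symm

theorem toReal_dR_coordBasis (he : e ∈ IsManifold.maximalAtlas 𝓘(ℝ, LNum) ∞ M) (hx : x ∈ e.target)
    (hF : ContMDiff 𝓘(ℝ, LNum) 𝓘(ℝ, R22) ∞ F) (i : Fin 2) :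
    toReal (dR F (e.symm x) (chartVec e x (coordBasis i))) =
      pdMat i (fun y => toReal (F (e.symm y))) x := by
  rw [toReal_dR_chartVec he hx hF]
  fin_cases i <;> simp [coordBasis, σ, QuadraticAlgebra.re_one, QuadraticAlgebra.im_one]

variable [IsManifold 𝓘(ℝ, LNum) ∞ M]

/-- The coefficients in a chart of the first fundamental form. -/
theorem coeff_eq_pullback {g : LorentzianMetric M}
    (he : e ∈ IsManifold.maximalAtlas 𝓘(ℝ, LNum) ∞ M) (hx : x ∈ e.target)
    (hF : ContMDiff 𝓘(ℝ, LNum) 𝓘(ℝ, R22) ∞ F)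
    (hg : ∀ p X Y, ip (dR F p X) (dR F p Y) = g.val p X Y) :
    g.coeff e x = pullback (fun y => toReal (F (e.symm y))) x := by
  ext i j
  rw [pullback, Matrix.of_apply, ← toReal_dR_coordBasis he hx hF, ← toReal_dR_coordBasis he hx hF,
    ← ip_eq_negDet, hg]
  rfl

/-- A coordinate of the derivative of a map from the plane into `ℝ^{2,2}`. -/
def fderivCoord (F : LNum → R22) (i : Fin 4) (x : LNum) : LNum →L[ℝ] ℝ :=
  (ContinuousLinearMap.proj i : R22 →L[ℝ] ℝ).comp (fderiv ℝ F x)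

/-- The representation of `inducedForm` in a chart. -/
def chartForm (F : LNum → R22) (x : LNum) : LNum →L[ℝ] LNum →L[ℝ] ℝ :=
  -((fderivCoord F 0 x).smulRight (fderivCoord F 0 x)) +
    (fderivCoord F 1 x).smulRight (fderivCoord F 1 x) -
    (fderivCoord F 2 x).smulRight (fderivCoord F 2 x) +
    (fderivCoord F 3 x).smulRight (fderivCoord F 3 x)

theorem chartForm_apply (F : LNum → R22) (x h k : LNum) :
    chartForm F x h k = ip (fderiv ℝ F x h) (fderiv ℝ F x k) := rfl

theorem contDiffOn_chartForm {F : LNum → R22} {U : Set LNum} (hU : IsOpen U)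
    (hF : ContDiffOn ℝ ∞ F U) : ContDiffOn ℝ ∞ (chartForm F) U := by
  have hd := hF.fderiv_of_isOpen hU (m := ∞) (by simp)
  have hw : ∀ i : Fin 4, ContDiffOn ℝ ∞ (fderivCoord F i) U := fun i =>
    contDiffOn_const.clm_comp hd
  have hs := fun i => (hw i).smulRight (hw i)
  exact (((hs 0).neg.add (hs 1)).sub (hs 2)).add (hs 3)

theorem contMDiff_inducedForm (hF : ContMDiff 𝓘(ℝ, LNum) 𝓘(ℝ, R22) ∞ F) :
    ContMDiff 𝓘(ℝ, LNum) (𝓘(ℝ, LNum).prod 𝓘(ℝ, LNum →L[ℝ] LNum →L[ℝ] ℝ)) ∞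
      (fun p ↦ Bundle.TotalSpace.mk' (LNum →L[ℝ] LNum →L[ℝ] ℝ)
        (E := fun q : M =>
          TangentSpace 𝓘(ℝ, LNum) q →L[ℝ] TangentSpace 𝓘(ℝ, LNum) q →L[ℝ] ℝ) p
          (inducedForm F p)) := by
  intro p₀
  refine (contMDiffAt_hom_bundle _).2 ⟨contMDiffAt_id, ?_⟩
  set e := chartAt LNum p₀ with he'
  have he : e ∈ IsManifold.maximalAtlas 𝓘(ℝ, LNum) ∞ M := IsManifold.chart_mem_maximalAtlas p₀
  have hFe : ContDiffOn ℝ ∞ (F ∘ e.symm) e.target := by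
    have := contDiffOn_comp_symm he (hF.contMDiffOn (s := Set.univ))
    rwa [Set.preimage_univ, Set.inter_univ] at this
  have hs := contMDiffOn_comp_chart he (contDiffOn_chartForm e.open_target hFe)
  have hp₀ : p₀ ∈ e.source := mem_chart_source LNum p₀
  have hset : e.source ∩ e ⁻¹' e.target = e.source :=
    Set.inter_eq_left.mpr fun p hp => e.map_source hp
  rw [hset] at hs
  refine (hs.contMDiffAt (e.open_source.mem_nhds hp₀)).congr_of_eventuallyEq ?_
  filter_upwards [e.open_source.mem_nhds hp₀] with p hp
  ext v w
  rw [inCoordinates_apply_eq₂ (by simpa using hp) (by simpa using hp) (by simp)]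
  have hsymm : ∀ v : LNum, dR F p ((trivializationAt LNum (TangentSpace 𝓘(ℝ, LNum)) p₀).symm p v) =
      fderiv ℝ (F ∘ e.symm) (e p) v := by
    intro v
    have h1 : (trivializationAt LNum (TangentSpace 𝓘(ℝ, LNum)) p₀).symm p v =
        (trivializationAt LNum (TangentSpace 𝓘(ℝ, LNum)) p₀).symmL ℝ p v :=
      (Bundle.Trivialization.symmL_apply (R := ℝ) _ (by simpa using hp) v).symm
    rw [h1, TangentBundle.symmL_trivializationAt hp]
    have h2 := dV_chartVec he (e.map_source hp) (f := F) (hF.mdifferentiableAt (by simp)) v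
    rw [← h2]
    have h3 : ∀ q, q = p → (mfderiv 𝓘(ℝ, LNum) 𝓘(ℝ, R22) F p : LNum →L[ℝ] R22) =
        mfderiv 𝓘(ℝ, LNum) 𝓘(ℝ, R22) F q := by
      rintro q rfl; rfl
    simp only [chartVec, dV, dR]
    simp only [mfld_simps, mfderivWithin_univ]
    exact DFunLike.congr_fun (h3 (e.symm (e p)) (e.left_inv hp)) _
  simp [inducedForm_apply, hsymm, chartForm_apply]

end

section

variable {M : Type*} [TopologicalSpace M] [ChartedSpace LNum M]
variable {e : OpenPartialHomeomorph M LNum} {x : LNum} {ε : ℝ} {F : M → R22} {B₁ B₂ : M → Mat2}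

/-! ### Null components of maps into `SL₂` of the Lorentz numbers -/

variable {B : M → Matrix.SpecialLinearGroup (Fin 2) LNum}

/-- The first null component of a map into `SL₂` of the Lorentz numbers. -/
def fstComp (B : M → Matrix.SpecialLinearGroup (Fin 2) LNum) (p : M) : Mat2 := fstMat (toMat (B p))

/-- The second null component of a map into `SL₂` of the Lorentz numbers. -/
def sndComp (B : M → Matrix.SpecialLinearGroup (Fin 2) LNum) (p : M) : Mat2 := sndMat (toMat (B p))

theorem mcForm_fstComp {p : M}
    (hB : ∀ k l, MDifferentiableAt 𝓘(ℝ, LNum) 𝓘(ℝ, LNum) (fun q => toMat (B q) k l) p)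
    (X : TangentSpace 𝓘(ℝ, LNum) p) :
    mcForm (fstComp B) p X = fstMat (toMat (B p)⁻¹ * dMat B p X) := by
  have h1 : toMat (B p)⁻¹ = (toMat (B p)).adjugate := Matrix.SpecialLinearGroup.coe_inv _
  rw [fstMat_mul, h1, fstMat_adjugate, mcForm]
  congr 1
  ext k l
  exact dV_clm_comp nullFst (hB k l) X

theorem mcForm_sndComp {p : M}
    (hB : ∀ k l, MDifferentiableAt 𝓘(ℝ, LNum) 𝓘(ℝ, LNum) (fun q => toMat (B q) k l) p)
    (X : TangentSpace 𝓘(ℝ, LNum) p) :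
    mcForm (sndComp B) p X = sndMat (toMat (B p)⁻¹ * dMat B p X) := by
  have h1 : toMat (B p)⁻¹ = (toMat (B p)).adjugate := Matrix.SpecialLinearGroup.coe_inv _
  rw [sndMat_mul, h1, sndMat_adjugate, mcForm]
  congr 1
  ext k l
  exact dV_clm_comp nullSnd (hB k l) X

theorem isHorizontalOn_comp
    (hB : ∀ k l, ContMDiff 𝓘(ℝ, LNum) 𝓘(ℝ, LNum) ∞ (fun q => toMat (B q) k l))
    (hd : ∀ p X, (toMat (B p)⁻¹ * dMat B p X) 0 0 = 0) :
    IsHorizontalOn (fstComp B) Set.univ ∧ IsHorizontalOn (sndComp B) Set.univ := by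
  have hm := fun p k l => (hB k l).mdifferentiableAt (x := p) (by simp)
  refine ⟨⟨fun k l => (nullFst.contDiff.contMDiff.comp (hB k l)).contMDiffOn, fun p _ => ?_,
    fun p _ X => ?_⟩, ⟨fun k l => (nullSnd.contDiff.contMDiff.comp (hB k l)).contMDiffOn,
    fun p _ => ?_, fun p _ X => ?_⟩⟩
  · rw [fstComp, det_fstMat, (B p).det_coe, nullFst_one]
  · rw [mcForm_fstComp (hm p), fstMat, Matrix.of_apply, hd, map_zero]
  · rw [sndComp, det_sndMat, (B p).det_coe, nullSnd_one]
  · rw [mcForm_sndComp (hm p), sndMat, Matrix.of_apply, hd, map_zero]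

/-- In null components: for `θ = P a` and `η = Q a`, the equations `θ₁ + ε η₂ = 0` and
`θ₂ + ε η₁ = 0` have determinant `|P|² - |Q|²` in the unknown `a`. -/
theorem null_system {ε P₁ P₂ Q₁ Q₂ a₁ a₂ : ℝ} (hε : ε * ε = 1) (h : P₁ * P₂ ≠ Q₁ * Q₂)
    (e₁ : P₁ * a₁ + ε * (Q₂ * a₂) = 0) (e₂ : P₂ * a₂ + ε * (Q₁ * a₁) = 0) : a₁ = 0 ∧ a₂ = 0 := by
  have h' := sub_ne_zero.mpr h
  constructor
  · refine (mul_eq_zero.mp ?_).resolve_left h'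
    linear_combination P₂ * e₁ - ε * Q₂ * e₂ + Q₁ * Q₂ * a₁ * hε
  · refine (mul_eq_zero.mp ?_).resolve_left h'
    linear_combination P₁ * e₂ - ε * Q₁ * e₁ + Q₁ * Q₂ * a₂ * hε

theorem nullIndep_of_offDiagonal (hε : ε * ε = 1) {L : LorentzStructure M} {θ η : LForm M}
    (h : L.IsOffDiagonal B θ η) (hne : NormSqNe θ η) (p : M) :
    NullIndep ε (fstComp B) (sndComp B) p := by
  intro X h₁ h₂
  have hm := fun k l => (h.conformal k l).1.mdifferentiableAt (x := p) (by simp)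
  rw [nullFormOn₁, mcForm_fstComp hm, mcForm_sndComp hm, h.inv_mul_d] at h₁
  rw [nullFormOn₂, mcForm_fstComp hm, mcForm_sndComp hm, h.inv_mul_d] at h₂
  simp only [fstMat, sndMat, Matrix.of_apply, Matrix.cons_val', Matrix.cons_val_zero,
    Matrix.cons_val_one, Matrix.cons_val_fin_one] at h₁ h₂
  obtain ⟨φ, hφ, hp⟩ := L.cover p
  obtain ⟨P, -, hP⟩ := h.conformal_left φ hφ
  obtain ⟨Q, -, hQ⟩ := h.conformal_right φ hφ
  obtain ⟨Y, hY⟩ := hne p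
  rw [hP p hp, hQ p hp] at h₁ h₂ hY
  have hPQ : nullFst (P (φ p)) * nullSnd (P (φ p)) ≠ nullFst (Q (φ p)) * nullSnd (Q (φ p)) := by
    intro h0
    apply hY
    apply null_ext
    · simp only [nullFst_mul, nullFst_star, nullSnd_mul]
      linear_combination (nullFst (dL φ p Y) * nullSnd (dL φ p Y)) * h0
    · simp only [nullSnd_mul, nullSnd_star, nullFst_mul]
      linear_combination (nullFst (dL φ p Y) * nullSnd (dL φ p Y)) * h0
  simp only [nullFst_mul, nullSnd_mul] at h₁ h₂
  obtain ⟨a₁, a₂⟩ := null_system hε hPQ h₁ h₂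
  have h0 : dL φ p X = 0 := null_ext (by rw [a₁, map_zero]) (by rw [a₂, map_zero])
  have hinj := (mdifferentiable_of_mem_maximalAtlas (L.smooth φ hφ)).mfderiv_injective hp
  exact hinj (h0.trans (map_zero (dL φ p)).symm)

/-! ### Products of horizontal maps are flat surfaces -/

theorem IsHorizontalOn.mdifferentiableAt {B : M → Mat2} (h : IsHorizontalOn B Set.univ)
    (k l : Fin 2) (p : M) :
    MDifferentiableAt 𝓘(ℝ, LNum) 𝓘(ℝ, ℝ) (fun p => B p k l) p :=
  mdiffAt isOpen_univ (h.smooth k l) (Set.mem_univ p)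

theorem IsHorizontalOn.isHorizontal_univ {B : M → Mat2}
    (he : e ∈ IsManifold.maximalAtlas 𝓘(ℝ, LNum) ∞ M) (h : IsHorizontalOn B Set.univ) :
    IsHorizontal (fun y => B (e.symm y)) e.target := by
  have := h.isHorizontal he isOpen_univ
  rwa [Set.preimage_univ, Set.inter_univ] at this

theorem contMDiff_of_toReal
    (hF : ∀ k l, ContMDiff 𝓘(ℝ, LNum) 𝓘(ℝ, ℝ) ∞ (fun p => toReal (F p) k l)) :
    ContMDiff 𝓘(ℝ, LNum) 𝓘(ℝ, R22) ∞ F := by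
  have hof : ContDiff ℝ ∞ (fun q : (ℝ × ℝ) × (ℝ × ℝ) =>
      ofReal !![q.1.1, q.1.2; q.2.1, q.2.2]) := by
    rw [contDiff_pi]
    intro i
    fin_cases i <;> simp [ofReal] <;> fun_prop
  have h := hof.contMDiff.comp
    (((hF 0 0).prodMk_space (hF 0 1)).prodMk_space ((hF 1 0).prodMk_space (hF 1 1)))
  have hFe : F = (fun q : (ℝ × ℝ) × (ℝ × ℝ) => ofReal !![q.1.1, q.1.2; q.2.1, q.2.2]) ∘ fun p =>
      ((toReal (F p) 0 0, toReal (F p) 0 1), (toReal (F p) 1 0, toReal (F p) 1 1)) := by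
    funext p
    refine toReal_injective ?_
    rw [Function.comp_apply, toReal_ofReal]
    ext k l
    fin_cases k <;> fin_cases l <;> rfl
  rw [hFe]
  exact h

theorem contMDiff_product (h₁ : IsHorizontalOn B₁ Set.univ) (h₂ : IsHorizontalOn B₂ Set.univ)
    (hF : ∀ p, toReal (F p) = B₁ p * sgnMat ε * (B₂ p)ᵀ) :
    ContMDiff 𝓘(ℝ, LNum) 𝓘(ℝ, R22) ∞ F := by
  refine contMDiff_of_toReal fun k l => ?_
  have s₁ := fun k l => contMDiffOn_univ.mp (h₁.smooth k l)
  have s₂ := fun k l => contMDiffOn_univ.mp (h₂.smooth k l)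
  have : (fun p => toReal (F p) k l) =
      fun p => ε * (B₁ p k 0 * B₂ p l 0) + B₁ p k 1 * B₂ p l 1 := by
    funext p
    rw [hF]
    simp [Matrix.mul_apply, Fin.sum_univ_two, sgnMat]
    ring
  rw [this]
  exact (contMDiff_const.mul ((s₁ k 0).mul (s₂ l 0))).add ((s₁ k 1).mul (s₂ l 1))

variable [IsManifold 𝓘(ℝ, LNum) ∞ M]

theorem exists_chart (p : M) : ∃ e ∈ IsManifold.maximalAtlas 𝓘(ℝ, LNum) ∞ M,
    ∃ x ∈ e.target, e.symm x = p :=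
  ⟨chartAt LNum p, IsManifold.chart_mem_maximalAtlas p, chartAt LNum p p,
    mem_chart_target LNum p, (chartAt LNum p).left_inv (mem_chart_source LNum p)⟩

/-- The differential of a product of horizontal maps in terms of its null forms. -/
theorem toReal_dR_product {U : Set M} (hU : IsOpen U) (h₁ : IsHorizontalOn B₁ U)
    (h₂ : IsHorizontalOn B₂ U) (hFs : ContMDiff 𝓘(ℝ, LNum) 𝓘(ℝ, R22) ∞ F)
    (hF : ∀ p ∈ U, toReal (F p) = B₁ p * sgnMat ε * (B₂ p)ᵀ) {p : M} (hp : p ∈ U)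
    (X : TangentSpace 𝓘(ℝ, LNum) p) :
    toReal (dR F p X) =
      B₁ p * !![0, nullFormOn₁ ε B₁ B₂ p X; nullFormOn₂ ε B₁ B₂ p X, 0] * (B₂ p)ᵀ := by
  obtain ⟨e, he, x, hx, rfl⟩ := exists_chart p
  rw [← chartVec_dV_chart he hx X]
  obtain ⟨n₁, n₂⟩ := nullFormOn_chartVec (ε := ε) he hx (fun k l => mdiffAt hU (h₁.smooth k l) hp)
    (fun k l => mdiffAt hU (h₂.smooth k l) hp) (dV e (e.symm x) X)
  have hW : IsOpen (e.target ∩ e.symm ⁻¹' U) := e.isOpen_inter_preimage_symm hU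
  have hprod := fun i => ((h₁.isHorizontal he hU).isAdapted
    (h₂.isHorizontal he hU)).pdMat_product (ε := ε) hW ⟨hx, hp⟩ i
  rw [toReal_dR_chartVec he hx hFs, n₁, n₂]
  have hc := fun i => pdMat_congr (i := i) hW ⟨hx, hp⟩
    (A := fun y => toReal (F (e.symm y))) fun y hy => hF (e.symm y) hy.2
  rw [hc, hc, hprod, hprod]
  have hlin : ∀ r s a b c d : ℝ, !![0, r * a + s * b; r * c + s * d, 0] =
      r • !![0, a; c, 0] + s • !![0, b; d, 0] := by
    intro r s a b c d
    ext k l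
    fin_cases k <;> fin_cases l <;> simp
  rw [hlin, mul_add, add_mul, mul_smul_comm, mul_smul_comm, smul_mul_assoc, smul_mul_assoc]

theorem ip_dR_product (h₁ : IsHorizontalOn B₁ Set.univ) (h₂ : IsHorizontalOn B₂ Set.univ)
    (hF : ∀ p, toReal (F p) = B₁ p * sgnMat ε * (B₂ p)ᵀ) (p : M)
    (X Y : TangentSpace 𝓘(ℝ, LNum) p) :
    ip (dR F p X) (dR F p Y) = 1 / 2 *
      (nullFormOn₁ ε B₁ B₂ p X * nullFormOn₂ ε B₁ B₂ p Y +
        nullFormOn₁ ε B₁ B₂ p Y * nullFormOn₂ ε B₁ B₂ p X) := by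
  have hd := toReal_dR_product isOpen_univ h₁ h₂ (contMDiff_product h₁ h₂ hF) (fun p _ => hF p)
    (Set.mem_univ p)
  rw [ip_eq_negDet, hd, hd, negDet_mul_mul,
    Matrix.det_transpose, h₁.det p trivial, h₂.det p trivial]
  simp [negDet]
  ring

theorem exists_nullFormOn_eq (h₁ : IsHorizontalOn B₁ Set.univ) (h₂ : IsHorizontalOn B₂ Set.univ)
    {p : M} (hN : NullIndep ε B₁ B₂ p) (a b : ℝ) :
    ∃ X, nullFormOn₁ ε B₁ B₂ p X = a ∧ nullFormOn₂ ε B₁ B₂ p X = b := by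
  obtain ⟨e, he, x, hx, rfl⟩ := exists_chart p
  have d₁ := fun k l => h₁.mdifferentiableAt k l (e.symm x)
  have d₂ := fun k l => h₂.mdifferentiableAt k l (e.symm x)
  have hA := (nullIndep_iff he hx d₁ d₂).mp hN
  have hval := nullFormOn_chartVec (ε := ε) he hx d₁ d₂
  rw [nullArea] at hA
  set α := nullForm₁ ε (fun y => B₁ (e.symm y)) (fun y => B₂ (e.symm y))
  set β := nullForm₂ ε (fun y => B₁ (e.symm y)) (fun y => B₂ (e.symm y))
  refine ⟨chartVec e x ⟨(a * β 1 x - b * α 1 x) / (α 0 x * β 1 x - α 1 x * β 0 x),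
    (b * α 0 x - a * β 0 x) / (α 0 x * β 1 x - α 1 x * β 0 x)⟩, ?_, ?_⟩
  · rw [(hval _).1, div_mul_eq_mul_div, div_mul_eq_mul_div, ← add_div, div_eq_iff hA]; ring
  · rw [(hval _).2, div_mul_eq_mul_div, div_mul_eq_mul_div, ← add_div, div_eq_iff hA]; ring

/-- A product of horizontal maps with independent null forms is a flat Lorentzian surface. -/
theorem exists_flat_metric (h₁ : IsHorizontalOn B₁ Set.univ) (h₂ : IsHorizontalOn B₂ Set.univ)
    (hN : ∀ p, NullIndep ε B₁ B₂ p) (hF : ∀ p, toReal (F p) = B₁ p * sgnMat ε * (B₂ p)ᵀ) :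
    ∃ g : LorentzianMetric M, g.IsFlat ∧ g.IsIsometricImmersion F {x | ip x x = -ε} := by
  have hFs := contMDiff_product h₁ h₂ hF
  have hip := ip_dR_product h₁ h₂ hF
  let g : LorentzianMetric M :=
    { val := inducedForm F
      symm := fun p X Y => by rw [inducedForm_apply, inducedForm_apply, hip, hip]; ring
      signature := fun p => by
        obtain ⟨X, hX₁, hX₂⟩ := exists_nullFormOn_eq h₁ h₂ (hN p) 1 (-1)
        obtain ⟨Y, hY₁, hY₂⟩ := exists_nullFormOn_eq h₁ h₂ (hN p) 1 1
        refine ⟨X, Y, ?_, ?_, ?_⟩ <;> rw [inducedForm_apply, hip] <;>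
          simp only [hX₁, hX₂, hY₁, hY₂] <;> norm_num
      contMDiff := contMDiff_inducedForm hFs }
  refine ⟨g, fun e he x hx l k i j => ?_, hFs, fun p => ?_, fun p => ?_, fun p X Y => rfl⟩
  · have he' : e ∈ IsManifold.maximalAtlas 𝓘(ℝ, LNum) ∞ M := IsManifold.subset_maximalAtlas he
    refine riemann_product_eq_zero (ε := ε) e.open_target (h₁.isHorizontal_univ he')
      (h₂.isHorizontal_univ he') (fun y hy => ?_) (fun y hy => ?_) hx l k i j
    · rw [coeff_eq_pullback he' hy hFs (fun p X Y => rfl)]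
      simp only [hF]
    · exact (nullIndep_iff he' hy (fun k l => h₁.mdifferentiableAt k l _)
        (fun k l => h₂.mdifferentiableAt k l _)).mp (hN _)
  · have h := det_toReal (F p)
    rw [hF, Matrix.det_mul, Matrix.det_mul, Matrix.det_transpose, h₁.det p trivial,
      h₂.det p trivial, det_sgnMat] at h
    show ip (F p) (F p) = -ε
    linarith
  · rw [injective_iff_map_eq_zero]
    intro X hX
    have hz : ∀ Y, nullFormOn₁ ε B₁ B₂ p X * nullFormOn₂ ε B₁ B₂ p Y +
        nullFormOn₁ ε B₁ B₂ p Y * nullFormOn₂ ε B₁ B₂ p X = 0 := by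
      intro Y
      have h := hip p X Y
      rw [hX] at h
      have h0 : ip (0 : R22) (dR F p Y) = 0 := by simp [ip]
      rw [h0] at h
      linarith
    obtain ⟨Y₁, a₁, a₂⟩ := exists_nullFormOn_eq h₁ h₂ (hN p) 1 0
    obtain ⟨Y₂, b₁, b₂⟩ := exists_nullFormOn_eq h₁ h₂ (hN p) 0 1
    have e₁ := hz Y₁
    have e₂ := hz Y₂
    rw [a₁, a₂] at e₁
    rw [b₁, b₂] at e₂
    exact hN p X (by linarith) (by linarith)

/-- The direct part of the theorem, for both signs. -/
theorem exists_flat_of_offDiagonal (hε : ε * ε = 1) {L : LorentzStructure M} {θ η : LForm M}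
    (h : L.IsOffDiagonal B θ η) (hne : NormSqNe θ η) :
    ∃ F : M → R22, (∀ p, toHerm (F p) = toMat (B p) * sgnL ε * (toMat (B p))ᴴ) ∧
      ∃ g : LorentzianMetric M, g.IsFlat ∧ g.IsIsometricImmersion F {x | ip x x = -ε} := by
  obtain ⟨h₁, h₂⟩ := isHorizontalOn_comp (fun k l => (h.conformal k l).1)
    (fun p X => by rw [h.inv_mul_d]; simp)
  have hF : ∀ p, toReal (ofReal (fstComp B p * sgnMat ε * (sndComp B p)ᵀ)) =
      fstComp B p * sgnMat ε * (sndComp B p)ᵀ := fun p => toReal_ofReal _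
  exact ⟨fun p => ofReal (fstComp B p * sgnMat ε * (sndComp B p)ᵀ),
    fun p => (toHerm_eq_iff ε _ _).mpr (hF p),
    exists_flat_metric h₁ h₂ (nullIndep_of_offDiagonal hε h hne) hF⟩

end

/-! ### Flat surfaces are globally products of horizontal maps -/

/-- The group of diagonal or antidiagonal matrices of determinant `1`. -/
def monomialGroup : Subgroup (Matrix.SpecialLinearGroup (Fin 2) ℝ) where
  carrier := {g | IsMonomial (g : Mat2)}
  one_mem' := by simp [IsMonomial]
  mul_mem' := by
    rintro g h (⟨a, b⟩ | ⟨a, b⟩) (⟨c, d⟩ | ⟨c, d⟩) <;>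
      simp [IsMonomial, Matrix.mul_apply, Fin.sum_univ_two, a, b, c, d]
  inv_mem' := by
    rintro g (⟨a, b⟩ | ⟨a, b⟩) <;>
      simp [IsMonomial, Matrix.SpecialLinearGroup.coe_inv, Matrix.adjugate_fin_two, a, b]

/-- The matrix of an element of `monomialGroup`. -/
def monMat (g : monomialGroup) : Mat2 := ((g : Matrix.SpecialLinearGroup (Fin 2) ℝ) : Mat2)

theorem isMonomial_monMat (g : monomialGroup) : IsMonomial (monMat g) := g.2

theorem det_monMat (g : monomialGroup) : (monMat g).det = 1 := g.1.2

theorem monMat_mul (g h : monomialGroup) : monMat (g * h) = monMat g * monMat h := by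
  simp [monMat]

theorem monMat_injective : Function.Injective monMat := fun _ _ h =>
  Subtype.ext (Subtype.ext h)

/-- For a monomial `g` the inverse transpose of `J g J` is monomial as well. -/
theorem isMonomial_dual {ε : ℝ} {g : Mat2} (h : IsMonomial g) :
    IsMonomial (sgnMat ε * g.adjugate * sgnMat ε)ᵀ := by
  rcases h with ⟨a, b⟩ | ⟨a, b⟩ <;>
    simp [IsMonomial, sgnMat, Matrix.adjugate_fin_two, a, b]

theorem det_dual {ε : ℝ} (hε : ε * ε = 1) {g : Mat2} (h : g.det = 1) :
    (sgnMat ε * g.adjugate * sgnMat ε)ᵀ.det = 1 := by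
  rw [Matrix.det_transpose, Matrix.det_mul, Matrix.det_mul, Matrix.det_adjugate, h, det_sgnMat]
  simp [hε]

/-- Horizontality is preserved by right multiplication with constant monomial matrices. -/
theorem IsHorizontal.mul_const {B : LNum → Mat2} {V : Set LNum} (hV : IsOpen V)
    (h : IsHorizontal B V) {g : Mat2} (hd : g.det = 1) (hg : IsMonomial g) :
    IsHorizontal (fun y => B y * g) V := by
  refine ⟨h.smooth.mul (smoothMat_const g), fun x hx => ?_, fun x hx i => ?_⟩
  · rw [Matrix.det_mul, h.det x hx, hd, mul_one]
  · have t := trace_mc (i := i) hV h.smooth h.det hx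
    rw [h.diag x hx, neg_zero] at t
    have hz : mc (fun _ => g) i x = 0 := by rw [mc, pdMat_const, mul_zero]
    rw [mc_mul hV hx h.smooth (smoothMat_const g) (h.det x hx), hz, add_zero]
    have hd0 := h.diag x hx i
    rcases hg with ⟨a, b⟩ | ⟨a, b⟩ <;>
      simp [Matrix.mul_apply, Fin.sum_univ_two, Matrix.adjugate_fin_two, Matrix.vecMul, dotProduct,
        a, b, t, hd0]

section

variable {M : Type*} [TopologicalSpace M] [ChartedSpace LNum M]
variable {ε : ℝ} {F : M → R22} {B B₁ B₂ C₁ C₂ : M → Mat2} {U V : Set M}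

theorem IsHorizontalOn.mono (h : IsHorizontalOn B U) (hV : V ⊆ U) : IsHorizontalOn B V :=
  ⟨fun k l => (h.smooth k l).mono hV, fun p hp => h.det p (hV hp), fun p hp => h.diag p (hV hp)⟩

theorem IsHorizontalOn.congr (hU : IsOpen U) (h : IsHorizontalOn B U) {C : M → Mat2}
    (hC : ∀ p ∈ U, C p = B p) : IsHorizontalOn C U := by
  refine ⟨fun k l => (h.smooth k l).congr fun p hp => by rw [hC p hp], fun p hp => ?_,
    fun p hp X => ?_⟩
  · rw [hC p hp, h.det p hp]
  · have hd : dMat2 C p X = dMat2 B p X := by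
      ext k l
      have : (fun q => C q k l) =ᶠ[𝓝 p] fun q => B q k l := by
        filter_upwards [hU.mem_nhds hp] with q hq
        rw [hC q hq]
      simp only [dMat2, Matrix.of_apply, dV]
      rw [this.mfderiv_eq]
    rw [mcForm, hC p hp, hd]
    exact h.diag p hp X

theorem isHorizontalOn_univ_of_local (h : ∀ p, ∃ V, IsOpen V ∧ p ∈ V ∧ IsHorizontalOn B V) :
    IsHorizontalOn B Set.univ := by
  refine ⟨fun k l p _ => ?_, fun p _ => ?_, fun p _ X => ?_⟩ <;>
    obtain ⟨V, hV, hp, hB⟩ := h p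
  · exact ((hB.smooth k l).contMDiffAt (hV.mem_nhds hp)).contMDiffWithinAt
  · exact hB.det p hp
  · exact hB.diag p hp X

variable [IsManifold 𝓘(ℝ, LNum) ∞ M]

theorem IsHorizontalOn.exists_mul_const (hU : IsOpen U) (h : IsHorizontalOn B U) {g : Mat2}
    (hd : g.det = 1) (hg : IsMonomial g) {p : M} (hp : p ∈ U) :
    ∃ V, IsOpen V ∧ p ∈ V ∧ IsHorizontalOn (fun q => B q * g) V := by
  have he := IsManifold.chart_mem_maximalAtlas (I := 𝓘(ℝ, LNum)) (n := ∞) p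
  set e := chartAt LNum p
  have hW : IsOpen (e.target ∩ e.symm ⁻¹' U) := e.isOpen_inter_preimage_symm hU
  have hp' : p ∈ e.source := mem_chart_source LNum p
  refine ⟨_, e.isOpen_inter_preimage hW, ⟨hp', e.map_source hp', ?_⟩,
    ((((h.isHorizontal he hU).mul_const hW hd hg).isHorizontalOn he hW).congr
      (e.isOpen_inter_preimage hW) fun q hq => by rw [e.left_inv hq.1])⟩
  rwa [Set.mem_preimage, e.left_inv hp']

/-- Two horizontal factorizations of an immersed surface differ by a locally constant map into the
monomial group. -/
theorem horizontal_transition (hε : ε * ε = 1) (hU : IsOpen U) (h₁ : IsHorizontalOn B₁ U)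
    (h₂ : IsHorizontalOn B₂ U) (k₁ : IsHorizontalOn C₁ U) (k₂ : IsHorizontalOn C₂ U)
    (hN : ∀ p ∈ U, NullIndep ε B₁ B₂ p)
    (heq : ∀ p ∈ U, B₁ p * sgnMat ε * (B₂ p)ᵀ = C₁ p * sgnMat ε * (C₂ p)ᵀ) {p : M} (hp : p ∈ U) :
    IsMonomial ((B₁ p).adjugate * C₁ p) ∧
      ∀ᶠ q in 𝓝 p, (B₁ q).adjugate * C₁ q = (B₁ p).adjugate * C₁ p := by
  have he := IsManifold.chart_mem_maximalAtlas (I := 𝓘(ℝ, LNum)) (n := ∞) p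
  set e := chartAt LNum p
  have hW : IsOpen (e.target ∩ e.symm ⁻¹' U) := e.isOpen_inter_preimage_symm hU
  have hp' : p ∈ e.source := mem_chart_source LNum p
  have hpW : e p ∈ e.target ∩ e.symm ⁻¹' U :=
    ⟨e.map_source hp', by rwa [Set.mem_preimage, e.left_inv hp']⟩
  have H₁ := h₁.isHorizontal he hU
  have K₁ := k₁.isHorizontal he hU
  obtain ⟨hmon, hpd⟩ := horizontal_unique hε hW H₁ (h₂.isHorizontal he hU) K₁
    (k₂.isHorizontal he hU)
    (fun x hx => (nullIndep_iff he hx.1 (fun k l => mdiffAt hU (h₁.smooth k l) hx.2)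
      (fun k l => mdiffAt hU (h₂.smooth k l) hx.2)).mp (hN _ hx.2)) (fun x hx => heq _ hx.2)
  refine ⟨by simpa only [e.left_inv hp'] using hmon _ hpW, ?_⟩
  obtain ⟨r, hr, hball⟩ := Metric.isOpen_iff.mp hW _ hpW
  have hs := (H₁.smooth.adjugate.mul K₁.smooth).mono hball
  filter_upwards [e.open_source.mem_nhds hp', (e.continuousAt hp').preimage_mem_nhds
    (Metric.ball_mem_nhds (e p) hr)] with q hq hqr
  have h := fun k l => const_of_pd_eq_zero Metric.isOpen_ball
    (convex_ball (e p) r).isPreconnected (hs k l)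
    (fun x hx i => congrFun (congrFun (hpd x (hball hx) i) k) l) hqr (Metric.mem_ball_self hr)
  ext k l
  simpa only [e.left_inv hp', e.left_inv hq] using h k l

/-- The null forms of a factorization of an immersion are independent. -/
theorem nullIndep_of_immersion (hU : IsOpen U) (h₁ : IsHorizontalOn B₁ U)
    (h₂ : IsHorizontalOn B₂ U) (hFs : ContMDiff 𝓘(ℝ, LNum) 𝓘(ℝ, R22) ∞ F)
    (hF : ∀ p ∈ U, toReal (F p) = B₁ p * sgnMat ε * (B₂ p)ᵀ) {p : M} (hp : p ∈ U)
    (hinj : Function.Injective (dR F p)) : NullIndep ε B₁ B₂ p := by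
  intro X e₁ e₂
  have h := toReal_dR_product hU h₁ h₂ hFs hF hp X
  have h0 : !![(0 : ℝ), 0; 0, 0] = 0 := by ext k l; fin_cases k <;> fin_cases l <;> rfl
  rw [e₁, e₂, h0, mul_zero, zero_mul, ← toReal_zero] at h
  exact hinj ((toReal_injective h).trans (map_zero (dR F p)).symm)

theorem det_coeff_neg (g : LorentzianMetric M) {e : OpenPartialHomeomorph M LNum}
    (he : e ∈ IsManifold.maximalAtlas 𝓘(ℝ, LNum) ∞ M) {x : LNum} (hx : x ∈ e.target) :
    (g.coeff e x).det < 0 := by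
  obtain ⟨X, Y, hX, hY, hXY⟩ := g.signature (e.symm x)
  have hG : ∀ h k : LNum, g.val (e.symm x) (chartVec e x h) (chartVec e x k) =
      h.re * k.re * g.coeff e x 0 0 + (h.re * k.im + h.im * k.re) * g.coeff e x 0 1 +
        h.im * k.im * g.coeff e x 1 1 := by
    intro h k
    have hs : g.coeff e x 1 0 = g.coeff e x 0 1 := g.symm _ _ _
    have e1 : ∀ i j, g.val (e.symm x) (chartVec e x (coordBasis i)) (chartVec e x (coordBasis j)) =
      g.coeff e x i j := fun i j => rfl
    conv_lhs => rw [coord_decomp h, coord_decomp k]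
    simp only [map_add, map_smul, add_apply, smul_apply,
      smul_eq_mul, e1, hs]
    ring
  rw [← chartVec_dV_chart he hx X] at hX hXY
  rw [← chartVec_dV_chart he hx Y] at hY hXY
  rw [hG] at hX hY hXY
  set h := dV e (e.symm x) X
  set k := dV e (e.symm x) Y
  have hs : g.coeff e x 1 0 = g.coeff e x 0 1 := g.symm _ _ _
  rw [Matrix.det_fin_two, hs]
  have hkey : (g.coeff e x 0 0 * g.coeff e x 1 1 - g.coeff e x 0 1 * g.coeff e x 0 1) *
      (h.re * k.im - h.im * k.re) ^ 2 = -1 := by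
    linear_combination (k.re * k.re * g.coeff e x 0 0 +
      (k.re * k.im + k.im * k.re) * g.coeff e x 0 1 + k.im * k.im * g.coeff e x 1 1) * hX - hY -
      (h.re * k.re * g.coeff e x 0 0 + (h.re * k.im + h.im * k.re) * g.coeff e x 0 1 +
        h.im * k.im * g.coeff e x 1 1) * hXY
  by_contra hcon
  have := mul_nonneg (not_lt.mp hcon) (sq_nonneg (h.re * k.im - h.im * k.re))
  linarith

/-- A flat isometric immersion is locally a product of horizontal maps. -/
theorem exists_local_lift (hε : ε * ε = 1) {g : LorentzianMetric M} (hg : g.IsFlat)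
    (hF : g.IsIsometricImmersion F {x | ip x x = -ε}) (p : M) :
    ∃ U, IsOpen U ∧ p ∈ U ∧ ∃ B₁ B₂ : M → Mat2, IsHorizontalOn B₁ U ∧ IsHorizontalOn B₂ U ∧
      ∀ q ∈ U, toReal (F q) = B₁ q * sgnMat ε * (B₂ q)ᵀ := by
  have he := IsManifold.chart_mem_maximalAtlas (I := 𝓘(ℝ, LNum)) (n := ∞) p
  have hatlas : chartAt LNum p ∈ atlas LNum M := chart_mem_atlas LNum p
  have hp : p ∈ (chartAt LNum p).source := mem_chart_source LNum p
  set e := chartAt LNum p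
  have hcoeff : ∀ x ∈ e.target, g.coeff e x = pullback (fun y => toReal (F (e.symm y))) x :=
    fun x hx => coeff_eq_pullback he hx hF.contMDiff hF.isometric
  obtain ⟨V, hV, hpV, hVU, B₁, B₂, h₁, h₂, hFB⟩ := exists_horizontal hε e.open_target
    (smoothMat_toReal he hF.contMDiff)
    (fun x _ => by
      have h : ip (F (e.symm x)) (F (e.symm x)) = -ε := hF.mem _
      rw [det_toReal, h, neg_neg])
    (fun x hx => by rw [← hcoeff x hx]; exact det_coeff_neg g he hx) hcoeff
    (fun x hx => hg e hatlas x hx) (e.map_source hp)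
  refine ⟨e.source ∩ e ⁻¹' V, e.isOpen_inter_preimage hV, ⟨hp, hpV⟩, fun q => B₁ (e q),
    fun q => B₂ (e q), h₁.isHorizontalOn he hV, h₂.isHorizontalOn he hV, fun q hq => ?_⟩
  rw [← hFB _ hq.2, e.left_inv hq.1]

/-- On a simply connected surface the local factorizations can be adjusted by constant monomial
matrices so as to agree on overlaps. -/
theorem exists_global_lift [SimplyConnectedSpace M] (hε : ε * ε = 1) {g : LorentzianMetric M}
    (hg : g.IsFlat) (hF : g.IsIsometricImmersion F {x | ip x x = -ε}) :
    ∃ B₁ B₂ : M → Mat2, IsHorizontalOn B₁ Set.univ ∧ IsHorizontalOn B₂ Set.univ ∧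
      ∀ p, toReal (F p) = B₁ p * sgnMat ε * (B₂ p)ᵀ := by
  have : LocallyPathConnectedSpace M := ChartedSpace.locallyPathConnectedSpace LNum M
  choose U hU hpU B₁ B₂ h₁ h₂ hFB using exists_local_lift hε hg hF
  have htrans : ∀ p q x, x ∈ U p ∩ U q → IsMonomial ((B₁ p x).adjugate * B₁ q x) ∧
      ∀ᶠ y in 𝓝 x, (B₁ p y).adjugate * B₁ q y = (B₁ p x).adjugate * B₁ q x := by
    intro p q x hx
    refine horizontal_transition hε ((hU p).inter (hU q)) ((h₁ p).mono Set.inter_subset_left)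
      ((h₂ p).mono Set.inter_subset_left) ((h₁ q).mono Set.inter_subset_right)
      ((h₂ q).mono Set.inter_subset_right) (fun y hy => ?_) (fun y hy => ?_) hx
    · exact nullIndep_of_immersion (hU p) (h₁ p) (h₂ p) hF.contMDiff (hFB p) hy.1 (hF.immersion y)
    · rw [← hFB p y hy.1, ← hFB q y hy.2]
  have hdet : ∀ p q x, x ∈ U p ∩ U q → ((B₁ p x).adjugate * B₁ q x).det = 1 := by
    intro p q x hx
    rw [Matrix.det_mul, Matrix.det_adjugate, (h₁ p).det x hx.1, (h₁ q).det x hx.2]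
    simp
  have hγ : ∀ p q x, ∃ γ : monomialGroup, x ∈ U p ∩ U q →
      monMat γ = (B₁ p x).adjugate * B₁ q x := by
    intro p q x
    by_cases hx : x ∈ U p ∩ U q
    · exact ⟨⟨⟨_, hdet p q x hx⟩, (htrans p q x hx).1⟩, fun _ => rfl⟩
    · exact ⟨1, fun h => absurd h hx⟩
  choose γ hγ using hγ
  obtain ⟨h, hloc, hh⟩ := exists_coboundary U hU id hpU γ
    (fun p q x hx => by
      filter_upwards [(htrans p q x hx).2, ((hU p).inter (hU q)).mem_nhds hx] with y hy hyU
      exact monMat_injective (by rw [hγ p q y hyU, hγ p q x hx, hy]))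
    (fun p q r x hp hq hr => monMat_injective (by
      rw [monMat_mul, hγ p q x ⟨hp, hq⟩, hγ q r x ⟨hq, hr⟩, hγ p r x ⟨hp, hr⟩, mul_assoc,
        ← mul_assoc (B₁ q x), mul_adj ((h₁ q).det x hq), one_mul]))
  have hB₁ : ∀ p, ∀ x ∈ U p, B₁ x x * monMat (h x x) = B₁ p x * monMat (h p x) := by
    intro p x hx
    rw [hh p x x hx (hpU x), monMat_mul, hγ p x x ⟨hx, hpU x⟩, ← mul_assoc, ← mul_assoc,
      mul_adj ((h₁ p).det x hx), one_mul]
  have hB₂ : ∀ p, ∀ x ∈ U p,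
      (sgnMat ε * (B₁ x x * monMat (h x x)).adjugate * toReal (F x))ᵀ =
        B₂ p x * (sgnMat ε * (monMat (h p x)).adjugate * sgnMat ε)ᵀ := by
    intro p x hx
    rw [hB₁ p x hx, hFB p x hx, ← Matrix.transpose_transpose (B₂ p x), ← Matrix.transpose_mul,
      Matrix.transpose_transpose, Matrix.adjugate_mul_distrib]
    congr 1
    simp only [mul_assoc]
    rw [← mul_assoc (B₁ p x).adjugate (B₁ p x), adj_mul ((h₁ p).det x hx), one_mul]
  -- near a point the correction factors are constant, so the corrected lifts remain horizontal
  have hlocal : ∀ p, ∃ V, IsOpen V ∧ p ∈ V ∧ V ⊆ U p ∧ ∀ x ∈ V, h p x = h p p := by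
    intro p
    obtain ⟨V, hV, hVo, hpV⟩ := mem_nhds_iff.mp ((hloc p p (hpU p)).and ((hU p).mem_nhds (hpU p)))
    exact ⟨V, hVo, hpV, fun x hx => (hV hx).2, fun x hx => (hV hx).1⟩
  refine ⟨fun x => B₁ x x * monMat (h x x),
    fun x => (sgnMat ε * (B₁ x x * monMat (h x x)).adjugate * toReal (F x))ᵀ,
    isHorizontalOn_univ_of_local fun p => ?_, isHorizontalOn_univ_of_local fun p => ?_,
    fun p => ?_⟩
  · obtain ⟨V, hV, hpV, hVU, hc⟩ := hlocal p
    obtain ⟨W, hW, hpW, hBW⟩ := (h₁ p).exists_mul_const (hU p) (det_monMat (h p p))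
      (isMonomial_monMat _) (hpU p)
    refine ⟨V ∩ W, hV.inter hW, ⟨hpV, hpW⟩, (hBW.mono Set.inter_subset_right).congr
      (hV.inter hW) fun x hx => ?_⟩
    rw [hB₁ p x (hVU hx.1), hc x hx.1]
  · obtain ⟨V, hV, hpV, hVU, hc⟩ := hlocal p
    obtain ⟨W, hW, hpW, hBW⟩ := (h₂ p).exists_mul_const (hU p)
      (det_dual hε (det_monMat (h p p))) (isMonomial_dual (isMonomial_monMat _)) (hpU p)
    refine ⟨V ∩ W, hV.inter hW, ⟨hpV, hpW⟩, (hBW.mono Set.inter_subset_right).congr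
      (hV.inter hW) fun x hx => ?_⟩
    rw [hB₂ p x (hVU hx.1), hc x hx.1]
  · have hd : (B₁ p p * monMat (h p p)).det = 1 := by
      rw [Matrix.det_mul, (h₁ p).det p (hpU p), det_monMat, mul_one]
    simp only [Matrix.transpose_transpose, mul_assoc]
    rw [← mul_assoc (sgnMat ε) (sgnMat ε), sgnMat_mul_self hε, one_mul, ← mul_assoc, ← mul_assoc,
      mul_adj hd, one_mul]

end

/-! ### Conformal functions of a Lorentz variable -/

/-- The multiplication of the Lorentz numbers as a continuous bilinear map. -/
def mulB : LNum →L[ℝ] LNum →L[ℝ] LNum := (LinearMap.mul ℝ LNum).toContinuousBilinearMap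

@[simp] theorem mulB_apply (a b : LNum) : mulB a b = a * b := rfl

section

variable {f g : LNum → LNum} {U : Set LNum} {a : LNum}

theorem fderiv_mul_lorentz (hf : DifferentiableAt ℝ f a) (hg : DifferentiableAt ℝ g a) (h : LNum) :
    fderiv ℝ (fun y => f y * g y) a h = f a * fderiv ℝ g a h + fderiv ℝ f a h * g a := by
  have := mulB.hasFDerivAt_of_bilinear hf.hasFDerivAt hg.hasFDerivAt
  exact DFunLike.congr_fun this.fderiv h

theorem IsConformalOn.differentiableAt (hU : IsOpen U) (hf : IsConformalOn f U) (ha : a ∈ U) :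
    DifferentiableAt ℝ f a :=
  (hf.1.contDiffAt (hU.mem_nhds ha)).differentiableAt (by simp)

theorem IsConformalOn.mul (hU : IsOpen U) (hf : IsConformalOn f U) (hg : IsConformalOn g U) :
    IsConformalOn (fun y => f y * g y) U := by
  refine ⟨(mulB.contDiff.comp_contDiffOn hf.1).clm_apply hg.1, fun a ha h => ?_⟩
  have df := hf.differentiableAt hU ha
  have dg := hg.differentiableAt hU ha
  rw [fderiv_mul_lorentz df dg, fderiv_mul_lorentz df dg, hf.2 a ha, hg.2 a ha]
  ring

theorem IsConformalOn.add (hU : IsOpen U) (hf : IsConformalOn f U) (hg : IsConformalOn g U) :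
    IsConformalOn (fun y => f y + g y) U := by
  refine ⟨hf.1.add hg.1, fun a ha h => ?_⟩
  rw [fderiv_fun_add (hf.differentiableAt hU ha) (hg.differentiableAt hU ha), add_apply,
    add_apply, hf.2 a ha, hg.2 a ha, mul_add]

theorem IsConformalOn.neg (hf : IsConformalOn f U) : IsConformalOn (fun y => -f y) U := by
  refine ⟨hf.1.neg, fun a ha h => ?_⟩
  rw [fderiv_fun_neg, neg_apply, neg_apply, hf.2 a ha, mul_neg]

/-- The differential of a conformal function is multiplication by its derivative. -/
theorem IsConformalOn.fderiv_eq (hf : IsConformalOn f U) (ha : a ∈ U) (h : LNum) :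
    fderiv ℝ f a h = fderiv ℝ f a 1 * h := by
  have h1 : h = h.re • 1 + h.im • (σ * 1) := by
    rw [mul_one]
    exact coord_decomp h
  conv_lhs => rw [h1]
  conv_rhs => rw [h1]
  rw [map_add, map_smul, map_smul, hf.2 a ha, mul_add, mul_smul_comm, mul_smul_comm, mul_one,
    mul_one, mul_comm σ]

/-- The derivative of a conformal function is conformal, by the symmetry of second derivatives. -/
theorem IsConformalOn.deriv (hU : IsOpen U) (hf : IsConformalOn f U) :
    IsConformalOn (fun y => fderiv ℝ f y 1) U := by
  have hs := hf.1.fderiv_of_isOpen hU (m := ∞) (by simp)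
  refine ⟨hs.clm_apply contDiffOn_const, fun a ha h => ?_⟩
  have hd : DifferentiableAt ℝ (fderiv ℝ f) a :=
    (hs.contDiffAt (hU.mem_nhds ha)).differentiableAt (by simp)
  have hsymm : IsSymmSndFDerivAt ℝ f a :=
    (hf.1.contDiffAt (hU.mem_nhds ha)).isSymmSndFDerivAt
      (by simpa using (WithTop.coe_le_coe.mpr le_top : ((2 : ℕ∞) : WithTop ℕ∞) ≤ ∞))
  have happ : ∀ v h, fderiv ℝ (fun y => fderiv ℝ f y v) a h = fderiv ℝ (fderiv ℝ f) a h v := by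
    intro v h
    rw [fderiv_clm_apply hd (differentiableAt_const v)]
    simp
  have hσ : fderiv ℝ (fderiv ℝ f) a 1 (σ * h) = σ * fderiv ℝ (fderiv ℝ f) a 1 h := by
    have h1 : (fun y => fderiv ℝ f y (σ * h)) =ᶠ[𝓝 a] fun y => mulB σ (fderiv ℝ f y h) := by
      filter_upwards [hU.mem_nhds ha] with y hy
      exact hf.2 y hy h
    have hdh : DifferentiableAt ℝ (fun y => fderiv ℝ f y h) a :=
      hd.clm_apply (differentiableAt_const h)
    have h2 : HasFDerivAt (fun y => mulB σ (fderiv ℝ f y h)) _ a :=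
      (mulB σ).hasFDerivAt.comp a hdh.hasFDerivAt
    rw [← happ, h1.fderiv_eq, h2.fderiv, ContinuousLinearMap.comp_apply, happ, mulB_apply]
  rw [happ, happ, hsymm (σ * h) 1, hσ, hsymm h 1]

/-- A map whose differential is a multiple of that of a diffeomorphism `ψ` is conformal in the
coordinate `ψ`. -/
theorem isConformalOn_comp_symm {ψ : OpenPartialHomeomorph LNum LNum}
    (hψ : ContDiffOn ℝ ∞ ψ ψ.source) (hψ' : ContDiffOn ℝ ∞ ψ.symm ψ.target)
    (hf : ContDiffOn ℝ ∞ f ψ.source)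
    (hP : ∀ x ∈ ψ.source, ∃ P : LNum, ∀ h, fderiv ℝ f x h = P * fderiv ℝ ψ x h) :
    IsConformalOn (f ∘ ψ.symm) ψ.target := by
  refine ⟨hf.comp hψ' fun a ha => ψ.map_target ha, fun a ha h => ?_⟩
  have hx := ψ.map_target ha
  obtain ⟨P, hP⟩ := hP _ hx
  have ds : DifferentiableAt ℝ ψ.symm a :=
    (hψ'.contDiffAt (ψ.open_target.mem_nhds ha)).differentiableAt (by simp)
  have df : DifferentiableAt ℝ f (ψ.symm a) :=
    (hf.contDiffAt (ψ.open_source.mem_nhds hx)).differentiableAt (by simp)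
  have dψ : DifferentiableAt ℝ ψ (ψ.symm a) :=
    (hψ.contDiffAt (ψ.open_source.mem_nhds hx)).differentiableAt (by simp)
  have hid : ∀ h, fderiv ℝ ψ (ψ.symm a) (fderiv ℝ ψ.symm a h) = h := by
    intro h
    have e : ψ ∘ ψ.symm =ᶠ[𝓝 a] id := by
      filter_upwards [ψ.open_target.mem_nhds ha] with y hy
      exact ψ.right_inv hy
    have e2 := e.fderiv_eq (𝕜 := ℝ)
    rw [fderiv_comp a dψ ds, fderiv_id] at e2
    exact DFunLike.congr_fun e2 h
  have hc : ∀ h, fderiv ℝ (f ∘ ψ.symm) a h = P * h := by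
    intro h
    rw [fderiv_comp a df ds, ContinuousLinearMap.comp_apply, hP, hid]
  rw [hc, hc, mul_left_comm]

end

/-! ### The Lorentz structure defined by a pair of horizontal maps -/

section

variable {M : Type*} {ε : ℝ} {F : M → R22} {B₁ B₂ : M → Mat2}

/-- The map into `SL₂` of the Lorentz numbers with the given null components. -/
def combine (B₁ B₂ : M → Mat2) (h₁ : ∀ p, (B₁ p).det = 1) (h₂ : ∀ p, (B₂ p).det = 1) (p : M) :
    Matrix.SpecialLinearGroup (Fin 2) LNum :=
  ⟨Matrix.of (nullEntry (B₁ p) (B₂ p)), by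
    have k₁ := h₁ p
    have k₂ := h₂ p
    rw [Matrix.det_fin_two] at k₁ k₂ ⊢
    exact null_ext (by simpa [nullEntry] using k₁) (by simpa [nullEntry] using k₂)⟩

theorem toMat_combine (h₁ : ∀ p, (B₁ p).det = 1) (h₂ : ∀ p, (B₂ p).det = 1) (p : M) (k l : Fin 2) :
    toMat (combine B₁ B₂ h₁ h₂ p) k l = nullEntry (B₁ p) (B₂ p) k l := rfl

theorem fstComp_combine (h₁ : ∀ p, (B₁ p).det = 1) (h₂ : ∀ p, (B₂ p).det = 1) :
    fstComp (combine B₁ B₂ h₁ h₂) = B₁ := by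
  funext p
  ext k l
  simp [fstComp, fstMat, toMat_combine, nullEntry]

theorem sndComp_combine (h₁ : ∀ p, (B₁ p).det = 1) (h₂ : ∀ p, (B₂ p).det = 1) :
    sndComp (combine B₁ B₂ h₁ h₂) = B₂ := by
  funext p
  ext k l
  simp [sndComp, sndMat, toMat_combine, nullEntry]

variable [TopologicalSpace M] [ChartedSpace LNum M]

theorem contMDiff_nullEntry (h₁ : IsHorizontalOn B₁ Set.univ) (h₂ : IsHorizontalOn B₂ Set.univ)
    (k l : Fin 2) :
    ContMDiff 𝓘(ℝ, LNum) 𝓘(ℝ, LNum) ∞ (fun p => nullEntry (B₁ p) (B₂ p) k l) :=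
  (nullEquiv.symm : ℝ × ℝ →L[ℝ] LNum).contDiff.contMDiff.comp
    ((contMDiffOn_univ.mp (h₁.smooth k l)).prodMk_space (contMDiffOn_univ.mp (h₂.smooth k l)))

variable {B : M → Matrix.SpecialLinearGroup (Fin 2) LNum}

/-- A smooth map into `SL₂` of the Lorentz numbers with independent null forms is an immersion. -/
theorem eq_zero_of_dMat_eq_zero
    (hB : ∀ k l, ContMDiff 𝓘(ℝ, LNum) 𝓘(ℝ, LNum) ∞ (fun q => toMat (B q) k l)) {p : M}
    (hN : NullIndep ε (fstComp B) (sndComp B) p) {X : TangentSpace 𝓘(ℝ, LNum) p}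
    (hX : ∀ k l, dL (fun q => toMat (B q) k l) p X = 0) : X = 0 := by
  have hm := fun k l => (hB k l).mdifferentiableAt (x := p) (by simp)
  have hd : dMat B p X = 0 := by
    ext k l : 1
    exact hX k l
  refine hN X ?_ ?_ <;>
  · simp [nullFormOn₁, nullFormOn₂, mcForm_fstComp hm, mcForm_sndComp hm, hd, fstMat, sndMat]

theorem fderiv_comp_symm_injective
    (hB : ∀ k l, ContMDiff 𝓘(ℝ, LNum) 𝓘(ℝ, LNum) ∞ (fun q => toMat (B q) k l))
    (hN : ∀ p, NullIndep ε (fstComp B) (sndComp B) p) {φ : OpenPartialHomeomorph M LNum}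
    (hφ : φ ∈ IsManifold.maximalAtlas 𝓘(ℝ, LNum) ∞ M) {a : LNum} (ha : a ∈ φ.target) {h k : LNum}
    (hhk : ∀ i j, fderiv ℝ ((fun q => toMat (B q) i j) ∘ φ.symm) a h =
      fderiv ℝ ((fun q => toMat (B q) i j) ∘ φ.symm) a k) : h = k := by
  have hm := fun k l => (hB k l).mdifferentiableAt (x := φ.symm a) (by simp)
  have h0 : chartVec φ a (h - k) = 0 := eq_zero_of_dMat_eq_zero hB (hN _) fun i j => by
    exact (dV_chartVec hφ ha (hm i j) (h - k)).trans (by rw [map_sub, hhk, sub_self])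
  rw [← sub_eq_zero, ← dV_chart_chartVec hφ ha (h - k), h0, map_zero]

variable [IsManifold 𝓘(ℝ, LNum) ∞ M]

/-- Null coordinates give charts of the surface in which the entries of the map with null components
`B₁` and `B₂` are conformal. -/
theorem exists_conformal_chart (h₁ : IsHorizontalOn B₁ Set.univ) (h₂ : IsHorizontalOn B₂ Set.univ)
    (hN : ∀ p, NullIndep ε B₁ B₂ p) (p : M) :
    ∃ φ ∈ IsManifold.maximalAtlas 𝓘(ℝ, LNum) ∞ M, p ∈ φ.source ∧
      ∀ k l, IsConformalOn ((fun q => nullEntry (B₁ q) (B₂ q) k l) ∘ φ.symm) φ.target := by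
  have he := IsManifold.chart_mem_maximalAtlas (I := 𝓘(ℝ, LNum)) (n := ∞) p
  have hp : p ∈ (chartAt LNum p).source := mem_chart_source LNum p
  set e := chartAt LNum p
  have hx := e.map_source hp
  obtain ⟨ψ, hpψ, hψe, hψ, hψ', hP⟩ := exists_null_chart e.open_target (h₁.isHorizontal_univ he)
    (h₂.isHorizontal_univ he) hx ((nullIndep_iff he hx (fun k l => h₁.mdifferentiableAt k l _)
      (fun k l => h₂.mdifferentiableAt k l _)).mp (hN _))
  have htarget : (e.trans ψ).target = ψ.target := by
    rw [OpenPartialHomeomorph.trans_target]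
    exact Set.inter_eq_left.mpr fun a ha => hψe (ψ.map_target ha)
  refine ⟨e.trans ψ, (e.trans ψ).mem_maximalAtlas_of_contMDiffOn ?_ ?_, ?_, fun k l => ?_⟩
  · rw [OpenPartialHomeomorph.trans_source]
    exact contMDiffOn_comp_chart he hψ
  · rw [htarget]
    exact (contMDiffOn_symm_of_mem_maximalAtlas he).comp (contMDiffOn_iff_contDiffOn.mpr hψ')
      fun a ha => hψe (ψ.map_target ha)
  · rw [OpenPartialHomeomorph.trans_source]
    exact ⟨hp, hpψ⟩
  · rw [htarget]
    have hs := contDiffOn_comp_symm he ((contMDiff_nullEntry h₁ h₂ k l).contMDiffOn (s := Set.univ))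
    rw [Set.preimage_univ, Set.inter_univ] at hs
    exact isConformalOn_comp_symm hψ hψ' (hs.mono hψe) fun x hx => hP x hx k l

/-- The Lorentz structure for which a given map is conformal: its charts are all the smooth charts
in which the entries of the map are conformal. -/
def lorentzStructureOf (B : M → Matrix.SpecialLinearGroup (Fin 2) LNum)
    (hB : ∀ k l, ContMDiff 𝓘(ℝ, LNum) 𝓘(ℝ, LNum) ∞ (fun q => toMat (B q) k l))
    (hN : ∀ p, NullIndep ε (fstComp B) (sndComp B) p)
    (hcover : ∀ p, ∃ φ ∈ IsManifold.maximalAtlas 𝓘(ℝ, LNum) ∞ M, p ∈ φ.source ∧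
      ∀ k l, IsConformalOn ((fun q => toMat (B q) k l) ∘ φ.symm) φ.target) :
    LorentzStructure M where
  charts := {φ | φ ∈ IsManifold.maximalAtlas 𝓘(ℝ, LNum) ∞ M ∧
    ∀ k l, IsConformalOn ((fun q => toMat (B q) k l) ∘ φ.symm) φ.target}
  smooth := fun φ hφ => hφ.1
  cover := fun p => by
    obtain ⟨φ, hφ, hp, hc⟩ := hcover p
    exact ⟨φ, ⟨hφ, hc⟩, hp⟩
  conformal := fun φ hφ ψ hψ => by
    have hs : ContDiffOn ℝ ∞ (φ.symm.trans ψ) (φ.symm.trans ψ).source := by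
      rw [← contMDiffOn_iff_contDiffOn]
      exact (contMDiffOn_of_mem_maximalAtlas hψ.1).comp
        ((contMDiffOn_symm_of_mem_maximalAtlas hφ.1).mono fun a ha => ha.1) fun a ha => ha.2
    refine ⟨hs, fun a ha h => ?_⟩
    have ha₁ : a ∈ φ.target := ha.1
    have hb : φ.symm.trans ψ a ∈ ψ.target := (φ.symm.trans ψ).map_source ha |>.1
    have dτ : DifferentiableAt ℝ (φ.symm.trans ψ) a :=
      (hs.contDiffAt ((φ.symm.trans ψ).open_source.mem_nhds ha)).differentiableAt (by simp)
    have hchain : ∀ k l h, fderiv ℝ ((fun q => toMat (B q) k l) ∘ φ.symm) a h =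
        fderiv ℝ ((fun q => toMat (B q) k l) ∘ ψ.symm) (φ.symm.trans ψ a)
          (fderiv ℝ (φ.symm.trans ψ) a h) := by
      intro k l h
      have e : (fun q => toMat (B q) k l) ∘ φ.symm =ᶠ[𝓝 a]
          ((fun q => toMat (B q) k l) ∘ ψ.symm) ∘ (φ.symm.trans ψ) := by
        filter_upwards [(φ.symm.trans ψ).open_source.mem_nhds ha] with y hy
        have : ψ.symm (φ.symm.trans ψ y) = φ.symm y := ψ.left_inv hy.2
        simp only [Function.comp_apply, this]
      rw [e.fderiv_eq, fderiv_comp a ((hψ.2 k l).differentiableAt ψ.open_target hb) dτ]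
      rfl
    refine fderiv_comp_symm_injective hB hN hψ.1 hb fun k l => ?_
    rw [← hchain, (hφ.2 k l).2 a ha₁, hchain, (hψ.2 k l).2 _ hb]

end

section

variable {M : Type*} [TopologicalSpace M] [ChartedSpace LNum M] {ε : ℝ}
variable {B : M → Matrix.SpecialLinearGroup (Fin 2) LNum} {L : LorentzStructure M} {θ η : LForm M}

/-! ### The entries of the Maurer–Cartan form of a conformal map -/

/-- An entry of `B⁻¹ dB`. -/
def mcEntry (B : M → Matrix.SpecialLinearGroup (Fin 2) LNum) (k l : Fin 2) : LForm M :=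
  fun p => (mulB (toMat (B p)⁻¹ k 0)).comp (dL (fun q => toMat (B q) 0 l) p) +
    (mulB (toMat (B p)⁻¹ k 1)).comp (dL (fun q => toMat (B q) 1 l) p)

theorem mcEntry_apply (k l : Fin 2) (p : M) (X : TangentSpace 𝓘(ℝ, LNum) p) :
    mcEntry B k l p X = (toMat (B p)⁻¹ * dMat B p X) k l := by
  rw [Matrix.mul_apply, Fin.sum_univ_two]
  rfl

theorem isConformalOn_inv (hc : ∀ i j, L.IsConformalMap fun p => toMat (B p) i j)
    {φ : OpenPartialHomeomorph M LNum} (hφ : φ ∈ L.charts) (k l : Fin 2) :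
    IsConformalOn (fun a => toMat (B (φ.symm a))⁻¹ k l) φ.target := by
  have h := fun i j => (hc i j).2 φ hφ
  have hinv : ∀ a, toMat (B (φ.symm a))⁻¹ =
      !![toMat (B (φ.symm a)) 1 1, -toMat (B (φ.symm a)) 0 1;
        -toMat (B (φ.symm a)) 1 0, toMat (B (φ.symm a)) 0 0] := fun a =>
    (Matrix.SpecialLinearGroup.coe_inv _).trans (Matrix.adjugate_fin_two _)
  simp only [hinv]
  fin_cases k <;> fin_cases l
  · exact h 1 1
  · exact (h 0 1).neg
  · exact (h 1 0).neg
  · exact h 0 0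

theorem dL_eq (hL : ∀ φ ∈ L.charts, φ ∈ IsManifold.maximalAtlas 𝓘(ℝ, LNum) ∞ M) {f : M → LNum}
    (hf : L.IsConformalMap f) {φ : OpenPartialHomeomorph M LNum} (hφ : φ ∈ L.charts) {p : M}
    (hp : p ∈ φ.source) (X : TangentSpace 𝓘(ℝ, LNum) p) :
    dL f p X = fderiv ℝ (f ∘ φ.symm) (φ p) 1 * dL φ p X := by
  obtain ⟨x, hx, rfl⟩ : ∃ x ∈ φ.target, φ.symm x = p := ⟨φ p, φ.map_source hp, φ.left_inv hp⟩
  have h1 := dV_chartVec (hL φ hφ) hx (hf.1.mdifferentiableAt (by simp))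
    (dV φ (φ.symm x) X)
  rw [chartVec_dV_chart (hL φ hφ) hx] at h1
  rw [φ.right_inv hx, ← (hf.2 φ hφ).fderiv_eq hx]
  exact h1

theorem isConformalForm_mcEntry (hc : ∀ i j, L.IsConformalMap fun p => toMat (B p) i j)
    (k l : Fin 2) : L.IsConformalForm (mcEntry B k l) := by
  intro φ hφ
  have hd := fun i j => ((hc i j).2 φ hφ).deriv φ.open_target
  have hi := fun i j => isConformalOn_inv hc hφ i j
  refine ⟨_, ((hi k 0).mul φ.open_target (hd 0 l)).add φ.open_target
    ((hi k 1).mul φ.open_target (hd 1 l)), fun p hp X => ?_⟩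
  have e : mcEntry B k l p X = toMat (B p)⁻¹ k 0 * dL (fun q => toMat (B q) 0 l) p X +
    toMat (B p)⁻¹ k 1 * dL (fun q => toMat (B q) 1 l) p X := rfl
  rw [e, dL_eq L.smooth (hc 0 l) hφ hp, dL_eq L.smooth (hc 1 l) hφ hp]
  simp only [φ.left_inv hp]
  ring

/-- The converse of `null_system`: if `|P|² = |Q|²` the equations have a nonzero solution. -/
theorem exists_ne_zero_of_null_system {P₁ P₂ Q₁ Q₂ : ℝ} (hε : ε * ε = 1)
    (h : P₁ * P₂ = Q₁ * Q₂) : ∃ a₁ a₂ : ℝ, (a₁ ≠ 0 ∨ a₂ ≠ 0) ∧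
      P₁ * a₁ + ε * (Q₂ * a₂) = 0 ∧ P₂ * a₂ + ε * (Q₁ * a₁) = 0 := by
  have hε0 : ε ≠ 0 := fun h0 => by simp [h0] at hε
  by_cases hQ : Q₂ = 0 ∧ P₁ = 0
  · by_cases hP : P₂ = 0 ∧ Q₁ = 0
    · exact ⟨1, 1, Or.inl one_ne_zero, by simp [hQ], by simp [hP]⟩
    · refine ⟨P₂, -(ε * Q₁), ?_, by linear_combination h - Q₁ * Q₂ * hε, by ring⟩
      by_contra! hcon
      exact hP ⟨hcon.1, by simpa [hε0] using hcon.2⟩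
  · refine ⟨ε * Q₂, -P₁, ?_, by ring, by linear_combination Q₁ * Q₂ * hε - h⟩
    by_contra! hcon
    exact hQ ⟨by simpa [hε0] using hcon.1, by simpa using hcon.2⟩

/-- If the null forms are independent then `|θ|² ≠ |η|²`. -/
theorem normSqNe_of_nullIndep (hε : ε * ε = 1) (h : L.IsOffDiagonal B θ η)
    (hN : ∀ p, NullIndep ε (fstComp B) (sndComp B) p) : NormSqNe θ η := by
  intro p
  obtain ⟨φ, hφ, hp⟩ := L.cover p
  have hm := fun k l => (h.conformal k l).1.mdifferentiableAt (x := p) (by simp)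
  obtain ⟨P, -, hP⟩ := h.conformal_left φ hφ
  obtain ⟨Q, -, hQ⟩ := h.conformal_right φ hφ
  have hsurj : ∀ a, ∃ X, dL φ p X = a := by
    intro a
    obtain ⟨x, hx, rfl⟩ : ∃ x ∈ φ.target, φ.symm x = p := ⟨φ p, φ.map_source hp, φ.left_inv hp⟩
    exact ⟨chartVec φ x a, dV_chart_chartVec (L.smooth φ hφ) hx a⟩
  obtain ⟨X, hX⟩ := hsurj 1
  refine ⟨X, fun heq => ?_⟩
  rw [hP p hp, hQ p hp, hX, mul_one, mul_one] at heq
  have hPQ : nullFst (P (φ p)) * nullSnd (P (φ p)) = nullFst (Q (φ p)) * nullSnd (Q (φ p)) := by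
    simpa using congrArg nullFst heq
  obtain ⟨a₁, a₂, hne, e₁, e₂⟩ := exists_ne_zero_of_null_system hε hPQ
  obtain ⟨Y, hY⟩ := hsurj (ofNull a₁ a₂)
  have hY0 : Y = 0 := by
    refine hN p Y ?_ ?_
    · rw [nullFormOn₁, mcForm_fstComp hm, mcForm_sndComp hm, h.inv_mul_d]
      simpa [fstMat, sndMat, hP p hp, hQ p hp, hY] using e₁
    · rw [nullFormOn₂, mcForm_fstComp hm, mcForm_sndComp hm, h.inv_mul_d]
      simpa [fstMat, sndMat, hP p hp, hQ p hp, hY] using e₂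
  rw [hY0, map_zero] at hY
  have z₁ := congrArg nullFst hY
  have z₂ := congrArg nullSnd hY
  rw [map_zero, nullFst_ofNull] at z₁
  rw [map_zero, nullSnd_ofNull] at z₂
  exact hne.elim (fun h => h z₁.symm) fun h => h z₂.symm

variable [IsManifold 𝓘(ℝ, LNum) ∞ M]

theorem IsHorizontalOn.lower_diag {B₁ : M → Mat2} (h : IsHorizontalOn B₁ Set.univ) (p : M)
    (X : TangentSpace 𝓘(ℝ, LNum) p) : mcForm B₁ p X 1 1 = 0 := by
  obtain ⟨e, he, x, hx, rfl⟩ := exists_chart p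
  have hh := h.isHorizontal_univ he
  have t := fun i => trace_mc (i := i) e.open_target hh.smooth hh.det hx
  rw [← chartVec_dV_chart he hx X, mcForm_chartVec he hx fun k l => h.mdifferentiableAt k l _]
  simp [t, hh.diag x hx]

/-- A map into `SL₂` of the Lorentz numbers whose null components are horizontal and have
independent null forms is a conformal immersion for a suitable Lorentz structure. -/
theorem exists_offDiagonal (hε : ε * ε = 1) {B₁ B₂ : M → Mat2} (h₁ : IsHorizontalOn B₁ Set.univ)
    (h₂ : IsHorizontalOn B₂ Set.univ) (hN : ∀ p, NullIndep ε B₁ B₂ p) :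
    ∃ (L : LorentzStructure M) (B : M → Matrix.SpecialLinearGroup (Fin 2) LNum) (θ η : LForm M),
      L.IsOffDiagonal B θ η ∧ NormSqNe θ η ∧ fstComp B = B₁ ∧ sndComp B = B₂ := by
  obtain ⟨B, hBdef, rfl, rfl⟩ : ∃ B : M → Matrix.SpecialLinearGroup (Fin 2) LNum,
      (∀ p k l, toMat (B p) k l = nullEntry (B₁ p) (B₂ p) k l) ∧ fstComp B = B₁ ∧
        sndComp B = B₂ :=
    ⟨combine B₁ B₂ (fun p => h₁.det p trivial) (fun p => h₂.det p trivial), fun _ _ _ => rfl,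
      fstComp_combine _ _, sndComp_combine _ _⟩
  have hBfun : ∀ k l, (fun p => toMat (B p) k l) =
      fun p => nullEntry (fstComp B p) (sndComp B p) k l := fun k l => funext fun p => hBdef p k l
  have hB : ∀ k l, ContMDiff 𝓘(ℝ, LNum) 𝓘(ℝ, LNum) ∞ (fun q => toMat (B q) k l) := fun k l => by
    rw [hBfun]
    exact contMDiff_nullEntry h₁ h₂ k l
  have hcover := exists_conformal_chart h₁ h₂ hN
  simp only [← hBfun] at hcover
  have hc : ∀ i j, (lorentzStructureOf B hB hN hcover).IsConformalMap fun p => toMat (B p) i j :=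
    fun i j => ⟨hB i j, fun φ hφ => hφ.2 i j⟩
  have hm := fun p k l => (hB k l).mdifferentiableAt (x := p) (by simp)
  have hoff : (lorentzStructureOf B hB hN hcover).IsOffDiagonal B (mcEntry B 0 1)
      (mcEntry B 1 0) := by
    refine ⟨hc, fun p X Y hXY => ?_, isConformalForm_mcEntry hc 0 1, isConformalForm_mcEntry hc 1 0,
      fun p X => ?_⟩
    · rw [← sub_eq_zero]
      refine eq_zero_of_dMat_eq_zero hB (hN p) fun k l => ?_
      rw [map_sub, sub_eq_zero]
      exact congrFun (congrFun hXY k) l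
    · have e₁ := mcForm_fstComp (hm p) X
      have e₂ := mcForm_sndComp (hm p) X
      have d₁ := h₁.diag p trivial X
      have d₂ := h₂.diag p trivial X
      have t₁ := h₁.lower_diag p X
      have t₂ := h₂.lower_diag p X
      rw [e₁] at d₁ t₁
      rw [e₂] at d₂ t₂
      ext1 k l
      fin_cases k <;> fin_cases l
      · exact null_ext (d₁.trans (map_zero nullFst).symm) (d₂.trans (map_zero nullSnd).symm)
      · exact (mcEntry_apply 0 1 p X).symm
      · exact (mcEntry_apply 1 0 p X).symm
      · exact null_ext (t₁.trans (map_zero nullFst).symm) (t₂.trans (map_zero nullSnd).symm)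
  exact ⟨_, B, _, _, hoff, normSqNe_of_nullIndep hε hoff hN, rfl, rfl⟩

/-- The converse part of the theorem, for both signs. -/
theorem exists_offDiagonal_of_flat [SimplyConnectedSpace M] (hε : ε * ε = 1)
    {g : LorentzianMetric M} {F : M → R22} (hg : g.IsFlat)
    (hF : g.IsIsometricImmersion F {x | ip x x = -ε}) :
    ∃ (L : LorentzStructure M) (B : M → Matrix.SpecialLinearGroup (Fin 2) LNum) (θ η : LForm M),
      L.IsOffDiagonal B θ η ∧ NormSqNe θ η ∧
        ∀ p, toHerm (F p) = toMat (B p) * sgnL ε * (toMat (B p))ᴴ := by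
  obtain ⟨B₁, B₂, h₁, h₂, hFB⟩ := exists_global_lift hε hg hF
  obtain ⟨L, B, θ, η, hoff, hne, rfl, rfl⟩ := exists_offDiagonal hε h₁ h₂ fun p =>
    nullIndep_of_immersion isOpen_univ h₁ h₂ hF.contMDiff (fun q _ => hFB q) (Set.mem_univ p)
      (hF.immersion p)
  exact ⟨L, B, θ, η, hoff, hne, fun p => (toHerm_eq_iff ε _ _).mpr (hFB p)⟩

end

end LorentzSurf

end

open LorentzSurf in
theorem theorem2 {M : Type*} [TopologicalSpace M] [T2Space M] [SecondCountableTopology M]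
    [ChartedSpace LNum M] [IsManifold 𝓘(ℝ, LNum) ∞ M] [SimplyConnectedSpace M] :
    (∀ (L : LorentzStructure M) (B : M → Matrix.SpecialLinearGroup (Fin 2) LNum) (θ η : LForm M),
      L.IsOffDiagonal B θ η → NormSqNe θ η →
        ∃ F : M → R22, (∀ p, toHerm (F p) = toMat (B p) * (toMat (B p))ᴴ) ∧
          ∃ g : LorentzianMetric M, g.IsFlat ∧ g.IsIsometricImmersion F H21) ∧
    (∀ (L : LorentzStructure M) (B : M → Matrix.SpecialLinearGroup (Fin 2) LNum) (θ η : LForm M),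
      L.IsOffDiagonal B θ η → NormSqNe θ η →
        ∃ F : M → R22, (∀ p, toHerm (F p) = toMat (B p) * !![-1, 0; 0, 1] * (toMat (B p))ᴴ) ∧
          ∃ g : LorentzianMetric M, g.IsFlat ∧ g.IsIsometricImmersion F S12) ∧
    (∀ (g : LorentzianMetric M) (F : M → R22), g.IsFlat → g.IsIsometricImmersion F H21 →
      ∃ (L : LorentzStructure M) (B : M → Matrix.SpecialLinearGroup (Fin 2) LNum) (θ η : LForm M),
        L.IsOffDiagonal B θ η ∧ NormSqNe θ η ∧
          ∀ p, toHerm (F p) = toMat (B p) * (toMat (B p))ᴴ) ∧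
    (∀ (g : LorentzianMetric M) (F : M → R22), g.IsFlat → g.IsIsometricImmersion F S12 →
      ∃ (L : LorentzStructure M) (B : M → Matrix.SpecialLinearGroup (Fin 2) LNum) (θ η : LForm M),
        L.IsOffDiagonal B θ η ∧ NormSqNe θ η ∧
          ∀ p, toHerm (F p) = toMat (B p) * !![-1, 0; 0, 1] * (toMat (B p))ᴴ) := by
  have hH : H21 = {x | ip x x = -1} := rfl
  have hS : S12 = {x | ip x x = -(-1)} := by rw [neg_neg]; rfl
  have e₁ : (1 : ℝ) * 1 = 1 := one_mul 1
  have e₂ : (-1 : ℝ) * -1 = 1 := by norm_num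
  refine ⟨fun L B θ η h hne => ?_, fun L B θ η h hne => ?_, fun g F hg hF => ?_,
    fun g F hg hF => ?_⟩
  · have := exists_flat_of_offDiagonal e₁ h hne
    simpa only [sgnL_one, mul_one, ← hH] using this
  · have := exists_flat_of_offDiagonal e₂ h hne
    simpa only [sgnL_neg_one, ← hS] using this
  · have := exists_offDiagonal_of_flat e₁ hg hF
    simpa only [sgnL_one, mul_one] using this
  · rw [hS] at hF
    have := exists_offDiagonal_of_flat e₂ hg hF
    simpa only [sgnL_neg_one] using this
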